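/- Let $G$ be a compactly generated locally compact (Hausdorff) group with a fixed left Haar measure, let $S\subset G$ be a compact symmetric generating set containing the identity, and let $\ell(g)=\min\{n : g\in S^n\}$ be the associated word length. A representation $(\pi,E)$ of $G$ is a homomorphism $\pi$ from $G$ to the bounded invertible operators on a complex Banach space $E$ such that $g\mapsto\pi(g)x$ is continuous for every $x\in E$; write $E^\pi$ for its space of invariant vectors and $\pi(f)x=\int_G f(g)\,\pi(g)x\,dg$ for $f\in C_c(G)$. For $\varepsilon>0$ let $\mathcal E(\varepsilon)$ be the class of all complex Banach spaces $E$ with $$\tfrac12\left(\|x+y\|^2+\|x-y\|^2\right)\le(1+\varepsilon)\left(\|x\|^2+\|y\|^2\right)\qquad\text{for all }x,y\in E.$$ For a class $\mathcal E$ of Banach spaces and $c>0$ let $\mathcal F(\mathcal E,c\ell)$ be the class of all representations $(\pi,E)$ of $G$ with $E\in\mathcal E$ and $\|\pi(g)\|\le e^{c\ell(g)}$ for all $g\in G$. For $\mathcal F=\mathcal F(\mathcal E,c\ell)$ let $\mathcal C_{\mathcal F}(G)$ be the Banach algebra obtained by completing the convolution algebra $C_c(G)$ for the seminorm $\|f\|_{\mathcal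 F}=\sup_{(\pi,E)\in\mathcal F}\|\pi(f)\|$; each $(\pi,E)\in\mathcal F$ extends to $\mathcal C_{\mathcal F}(G)$ by continuity. A Kazhdan projection in $\mathcal C_{\mathcal F}(G)$ is an idempotent $p$ in the closure of $\{f\in C_c(G):\int f=1\}$ such that $\pi(p)$ is a projection onto $E^\pi$ for every $(\pi,E)\in\mathcal F$; it is central if it lies in the center of $\mathcal C_{\mathcal F}(G)$. The group $G$ has robust property (T) with respect to $\mathcal E$ if $\mathcal C_{\mathcal F(\mathcal E,s\ell)}(G)$ has a Kazhdan projection for some $s>0$. 1. If $G$ has Kazhdan's property (T), then there exists $\varepsilon>0$ such that $\mathcal C_{\mathcal F(\mathcal E(\varepsilon),\varepsilon\ell)}(G)$ contains a central Kazhdan projection, and every continuous affine action of $G$ on a Banach space with linear part in $\mathcal F(\mathcal E(\varepsilon),\varepsilon\ell)$ has a fixed point. 2. $G$ has property (T) if and only if there exists $\varepsilon>0$ such that $G$ has robust property (T) with respect to $\mathcal E(\varepsilon)$. -/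

import Mathlib

open scoped Pointwise CompactlySupported

universe u v

namespace KazhdanRobust

noncomputable section

/-! ### Groups and word length -/

/-- A compact symmetric generating set of `G` containing the identity. -/
structure IsCompactGeneratingSet {G : Type u} [Group G] [TopologicalSpace G] (S : Set G) :
    Prop where
  isCompact : IsCompact S
  one_mem : (1 : G) ∈ S
  inv_mem : ∀ g ∈ S, g⁻¹ ∈ S
  closure_eq_top : Subgroup.closure S = ⊤

/-- The word length `ℓ(g) = min {n | g ∈ Sⁿ}`. -/
def wordLength {G : Type u} [Group G] (S : Set G) (g : G) : ℕ :=
  sInf {n : ℕ | g ∈ S ^ n}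

/-! ### Representations on Banach spaces -/

/-- A strongly continuous representation of `G` on a complex Banach space. As `G` is a group, the
operators `π g` are automatically invertible. -/
structure BanachRep (G : Type u) [Group G] [TopologicalSpace G] : Type (max u (v + 1)) where
  E : Type v
  [normedAddCommGroup : NormedAddCommGroup E]
  [normedSpace : NormedSpace ℂ E]
  [completeSpace : CompleteSpace E]
  π : G →* (E →L[ℂ] E)
  continuous_orbit : ∀ x : E, Continuous fun g => π g x

attribute [instance] BanachRep.normedAddCommGroup BanachRep.normedSpace BanachRep.completeSpace

section Group

variable {G : Type u} [Group G] [TopologicalSpace G]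

/-- The space `E^π` of invariant vectors. -/
def BanachRep.invariants (ρ : BanachRep.{u, v} G) : Submodule ℂ ρ.E where
  carrier := {x | ∀ g, ρ.π g x = x}
  add_mem' := fun ha hb g => by rw [map_add, ha g, hb g]
  zero_mem' := fun g => map_zero _
  smul_mem' := fun c x hx g => by rw [map_smul, hx g]

/-- A continuous affine action of `G` on `E` with linear part `(π, E)`. -/
structure AffineAction (ρ : BanachRep.{u, v} G) where
  σ : G →* (ρ.E ≃ᵃ[ℂ] ρ.E)
  linear_eq : ∀ g x, (σ g).linear x = ρ.π g x
  continuous_orbit : ∀ x : ρ.E, Continuous fun g => σ g x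

/-- The affine action has a fixed point. -/
def AffineAction.HasFixedPoint {ρ : BanachRep.{u, v} G} (a : AffineAction ρ) : Prop :=
  ∃ x : ρ.E, ∀ g, a.σ g x = x

theorem BanachRep.exists_bound (ρ : BanachRep.{u, v} G) {K : Set G} (hK : IsCompact K) :
    ∃ C, ∀ g ∈ K, ‖ρ.π g‖ ≤ C := by
  have h : ∀ x, ∃ C, ∀ i : K, ‖ρ.π i x‖ ≤ C := by
    intro x
    obtain ⟨C, hC⟩ := hK.exists_bound_of_continuousOn (ρ.continuous_orbit x).continuousOn
    exact ⟨C, fun i => hC i i.2⟩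
  obtain ⟨C, hC⟩ := banach_steinhaus h
  exact ⟨C, fun g hg => hC ⟨g, hg⟩⟩

variable [IsTopologicalGroup G] [MeasurableSpace G] [BorelSpace G]
  (μ : MeasureTheory.Measure G) [μ.IsHaarMeasure]

theorem BanachRep.integrable_orbit (ρ : BanachRep.{u, v} G) (f : C_c(G, ℂ)) (x : ρ.E) :
    MeasureTheory.Integrable (fun g => f g • ρ.π g x) μ :=
  (f.continuous.smul (ρ.continuous_orbit x)).integrable_of_hasCompactSupport
    f.hasCompactSupport.smul_right

theorem norm_integral_orbit_le (ρ : BanachRep.{u, v} G) (f : C_c(G, ℂ)) {C : ℝ}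
    (hC : ∀ g ∈ tsupport f, ‖ρ.π g‖ ≤ C) (x : ρ.E) :
    ‖∫ g, f g • ρ.π g x ∂μ‖ ≤ (C * ∫ g, ‖f g‖ ∂μ) * ‖x‖ := by
  have hf : MeasureTheory.Integrable (fun g => ‖f g‖) μ :=
    (f.continuous.integrable_of_hasCompactSupport f.hasCompactSupport).norm
  calc ‖∫ g, f g • ρ.π g x ∂μ‖ ≤ ∫ g, ‖f g‖ * (C * ‖x‖) ∂μ := by
        refine MeasureTheory.norm_integral_le_of_norm_le (hf.mul_const _) (.of_forall fun g => ?_)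
        by_cases hg : g ∈ tsupport f
        · rw [norm_smul]
          exact mul_le_mul_of_nonneg_left ((ρ.π g).le_of_opNorm_le (hC g hg) x) (norm_nonneg _)
        · simp [image_eq_zero_of_notMem_tsupport hg]
    _ = (C * ∫ g, ‖f g‖ ∂μ) * ‖x‖ := by
        rw [MeasureTheory.integral_mul_const]; ring

/-- The operator `π(f) x = ∫ f(g) π(g) x dg` for `f ∈ C_c(G)`. -/
def BanachRep.integrate (ρ : BanachRep.{u, v} G) (f : C_c(G, ℂ)) : ρ.E →L[ℂ] ρ.E :=
  LinearMap.mkContinuousOfExistsBound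
    { toFun := fun x => ∫ g, f g • ρ.π g x ∂μ
      map_add' := fun x y => by
        simp only [map_add, smul_add]
        exact MeasureTheory.integral_add (ρ.integrable_orbit μ f x) (ρ.integrable_orbit μ f y)
      map_smul' := fun c x => by
        simp only [map_smul, RingHom.id_apply, smul_comm _ c]
        exact MeasureTheory.integral_smul c _ }
    (by
      obtain ⟨C, hC⟩ := ρ.exists_bound f.hasCompactSupport
      exact ⟨_, norm_integral_orbit_le μ ρ f hC⟩)

theorem BanachRep.integrate_apply (ρ : BanachRep.{u, v} G) (f : C_c(G, ℂ)) (x : ρ.E) :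
    ρ.integrate μ f x = ∫ g, f g • ρ.π g x ∂μ := rfl

theorem BanachRep.integrate_add (ρ : BanachRep.{u, v} G) (f h : C_c(G, ℂ)) :
    ρ.integrate μ (f + h) = ρ.integrate μ f + ρ.integrate μ h := by
  ext x
  simp only [_root_.add_apply, BanachRep.integrate_apply,
    CompactlySupportedContinuousMap.add_apply, add_smul]
  exact MeasureTheory.integral_add (ρ.integrable_orbit μ f x) (ρ.integrable_orbit μ h x)

theorem BanachRep.integrate_smul (ρ : BanachRep.{u, v} G) (c : ℂ) (f : C_c(G, ℂ)) :
    ρ.integrate μ (c • f) = c • ρ.integrate μ f := by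
  ext x
  simp only [_root_.smul_apply, BanachRep.integrate_apply,
    CompactlySupportedContinuousMap.smul_apply, smul_assoc]
  exact MeasureTheory.integral_smul c _

/-! ### Convolution on `C_c(G)` -/

/-- The convolution `(f ∗ h)(x) = ∫ f(y) h(y⁻¹ x) dy` on `C_c(G)`. -/
def convolution [T2Space G] (f h : C_c(G, ℂ)) : C_c(G, ℂ) where
  toFun := fun x => ∫ y, f y * h (y⁻¹ * x) ∂μ
  continuous_toFun := by
    rw [← continuousOn_univ]
    refine continuousOn_integral_of_compact_support (k := tsupport f)
      f.hasCompactSupport ?_ ?_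
    · have hf := f.continuous
      have hh := h.continuous
      exact Continuous.continuousOn (by unfold Function.uncurry; fun_prop)
    · intro p x _ hx
      simp [image_eq_zero_of_notMem_tsupport hx]
  hasCompactSupport' := by
    refine HasCompactSupport.intro
      (IsCompact.mul f.hasCompactSupport h.hasCompactSupport) fun x hx => ?_
    refine MeasureTheory.integral_eq_zero_of_ae (.of_forall fun y => ?_)
    by_cases hy : y ∈ tsupport f
    · have : y⁻¹ * x ∉ tsupport h := fun hh => hx ⟨y, hy, y⁻¹ * x, hh, by group⟩
      simp [image_eq_zero_of_notMem_tsupport this]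
    · simp [image_eq_zero_of_notMem_tsupport hy]

theorem convolution_apply [T2Space G] (f h : C_c(G, ℂ)) (x : G) :
    convolution μ f h x = ∫ y, f y * h (y⁻¹ * x) ∂μ := rfl

theorem integrable_convolution [T2Space G] (f h : C_c(G, ℂ)) (x : G) :
    MeasureTheory.Integrable (fun y => f y * h (y⁻¹ * x)) μ := by
  have hf := f.continuous
  have hh := h.continuous
  exact Continuous.integrable_of_hasCompactSupport (by fun_prop) f.hasCompactSupport.mul_right

theorem hasCompactSupport_aux {E : Type*} [NormedAddCommGroup E] [T2Space G] (f h : C_c(G, ℂ))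
    (F : G → G → E) (hF : ∀ y x, f y = 0 ∨ h (y⁻¹ * x) = 0 → F x y = 0) :
    HasCompactSupport (Function.uncurry F) := by
  refine HasCompactSupport.intro
    ((IsCompact.mul f.hasCompactSupport h.hasCompactSupport).prod f.hasCompactSupport) ?_
  rintro ⟨x, y⟩ hxy
  refine hF y x ?_
  by_contra hcon
  push Not at hcon
  have h1 : y ∈ tsupport f := subset_tsupport _ hcon.1
  have h2 : y⁻¹ * x ∈ tsupport h := subset_tsupport _ hcon.2
  exact hxy ⟨⟨y, h1, y⁻¹ * x, h2, by group⟩, h1⟩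

/-- `π(f ∗ h) = π(f) π(h)`. -/
theorem BanachRep.integrate_convolution [T2Space G] (ρ : BanachRep.{u, v} G) (f h : C_c(G, ℂ)) :
    ρ.integrate μ (convolution μ f h) = ρ.integrate μ f * ρ.integrate μ h := by
  ext x
  have hf := f.continuous
  have hh := h.continuous
  have hρ := ρ.continuous_orbit x
  have hsupp : HasCompactSupport
      (Function.uncurry fun z y : G => (f y * h (y⁻¹ * z)) • ρ.π z x) := by
    refine hasCompactSupport_aux f h _ fun y z hyz => ?_
    rcases hyz with h0 | h0 <;> simp [h0]
  calc ρ.integrate μ (convolution μ f h) x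
      = ∫ z, ∫ y, (f y * h (y⁻¹ * z)) • ρ.π z x ∂μ ∂μ := by
        rw [BanachRep.integrate_apply]
        refine MeasureTheory.integral_congr_ae (.of_forall fun z => ?_)
        simp only [convolution_apply]
        rw [integral_smul_const]
    _ = ∫ y, ∫ z, (f y * h (y⁻¹ * z)) • ρ.π z x ∂μ ∂μ :=
        MeasureTheory.integral_integral_swap_of_hasCompactSupport
          (by unfold Function.uncurry; fun_prop) hsupp
    _ = ∫ y, f y • ρ.π y (∫ z, h z • ρ.π z x ∂μ) ∂μ := by
        refine MeasureTheory.integral_congr_ae (.of_forall fun y => ?_)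
        dsimp only
        rw [← ContinuousLinearMap.integral_comp_comm _ (ρ.integrable_orbit μ h x),
          ← MeasureTheory.integral_smul,
          ← MeasureTheory.integral_mul_left_eq_self _ y]
        refine MeasureTheory.integral_congr_ae (.of_forall fun z => ?_)
        simp [mul_smul]
    _ = (ρ.integrate μ f * ρ.integrate μ h) x := rfl

theorem convolution_assoc [T2Space G] (f h k : C_c(G, ℂ)) :
    convolution μ (convolution μ f h) k = convolution μ f (convolution μ h k) := by
  ext x
  have hf := f.continuous
  have hh := h.continuous
  have hk := k.continuous
  have hsupp : HasCompactSupport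
      (Function.uncurry fun z y : G => (f y * h (y⁻¹ * z)) * k (z⁻¹ * x)) := by
    refine hasCompactSupport_aux f h _ fun y z hyz => ?_
    rcases hyz with h0 | h0 <;> simp [h0]
  calc convolution μ (convolution μ f h) k x
      = ∫ z, ∫ y, (f y * h (y⁻¹ * z)) * k (z⁻¹ * x) ∂μ ∂μ := by
        rw [convolution_apply]
        refine MeasureTheory.integral_congr_ae (.of_forall fun z => ?_)
        simp only [convolution_apply]
        rw [MeasureTheory.integral_mul_const]
    _ = ∫ y, ∫ z, (f y * h (y⁻¹ * z)) * k (z⁻¹ * x) ∂μ ∂μ :=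
        MeasureTheory.integral_integral_swap_of_hasCompactSupport
          (by unfold Function.uncurry; fun_prop) hsupp
    _ = ∫ y, f y * ∫ z, h z * k (z⁻¹ * (y⁻¹ * x)) ∂μ ∂μ := by
        refine MeasureTheory.integral_congr_ae (.of_forall fun y => ?_)
        dsimp only
        rw [← MeasureTheory.integral_const_mul,
          ← MeasureTheory.integral_mul_left_eq_self _ y]
        refine MeasureTheory.integral_congr_ae (.of_forall fun z => ?_)
        simp [mul_assoc]
    _ = convolution μ f (convolution μ h k) x := rfl

end Group

/-! ### Families of representations and the algebra `C_F(G)` -/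

/-- A class `F` of representations for which `sup_{(π,E) ∈ F} ‖π(g)‖` is bounded on compact
subsets of `G`. -/
structure RepFamily (G : Type u) [Group G] [TopologicalSpace G] : Type (max u (v + 1)) where
  carrier : Set (BanachRep.{u, v} G)
  bounded : ∀ K : Set G, IsCompact K → ∃ C, ∀ ρ ∈ carrier, ∀ g ∈ K, ‖ρ.π g‖ ≤ C

section Algebra

variable {G : Type u} [Group G] [TopologicalSpace G] [IsTopologicalGroup G] [T2Space G]
  [LocallyCompactSpace G] [MeasurableSpace G] [BorelSpace G]
  (μ : MeasureTheory.Measure G) [μ.IsHaarMeasure] (F : RepFamily.{u, v} G)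

/-- `‖f‖_F = sup {‖π(f)‖ | (π,E) ∈ F}`. -/
def familyNorm (f : C_c(G, ℂ)) : ℝ :=
  ⨆ ρ : F.carrier, ‖ρ.1.integrate μ f‖

theorem bddAbove_familyNorm (f : C_c(G, ℂ)) :
    BddAbove (Set.range fun ρ : F.carrier => ‖ρ.1.integrate μ f‖) := by
  obtain ⟨C, hC⟩ := F.bounded _ f.hasCompactSupport
  refine ⟨max C 0 * ∫ g, ‖f g‖ ∂μ, ?_⟩
  rintro _ ⟨ρ, rfl⟩
  have h0 : 0 ≤ ∫ g, ‖f g‖ ∂μ := MeasureTheory.integral_nonneg fun _ => norm_nonneg _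
  exact ContinuousLinearMap.opNorm_le_bound _ (mul_nonneg (le_max_right _ _) h0)
    (norm_integral_orbit_le μ ρ.1 f fun g hg => (hC ρ.1 ρ.2 g hg).trans (le_max_left _ _))

theorem familyNorm_nonneg (f : C_c(G, ℂ)) : 0 ≤ familyNorm μ F f :=
  Real.iSup_nonneg fun _ => norm_nonneg _

variable {F} in
theorem norm_integrate_le_familyNorm {ρ : BanachRep.{u, v} G} (hρ : ρ ∈ F.carrier)
    (f : C_c(G, ℂ)) : ‖ρ.integrate μ f‖ ≤ familyNorm μ F f :=
  le_ciSup (bddAbove_familyNorm μ F f) (⟨ρ, hρ⟩ : F.carrier)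

theorem familyNorm_le (f : C_c(G, ℂ)) {c : ℝ} (hc : 0 ≤ c)
    (h : ∀ ρ ∈ F.carrier, ‖ρ.integrate μ f‖ ≤ c) : familyNorm μ F f ≤ c :=
  Real.iSup_le (fun ρ => h ρ.1 ρ.2) hc

/-- `‖·‖_F` as a seminorm on `C_c(G)`. -/
def familySeminorm : Seminorm ℂ C_c(G, ℂ) :=
  Seminorm.ofSMulLE (familyNorm μ F)
    (le_antisymm (familyNorm_le μ F 0 le_rfl fun ρ _ => by
      have := ρ.integrate_smul μ 0 0
      rw [zero_smul, zero_smul] at this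
      rw [this, norm_zero]) (familyNorm_nonneg μ F 0))
    (fun f h => familyNorm_le μ F _
      (add_nonneg (familyNorm_nonneg μ F f) (familyNorm_nonneg μ F h)) fun ρ hρ => by
        rw [ρ.integrate_add μ]
        exact (norm_add_le _ _).trans (add_le_add (norm_integrate_le_familyNorm μ hρ f)
          (norm_integrate_le_familyNorm μ hρ h)))
    (fun c f => familyNorm_le μ F _
      (mul_nonneg (norm_nonneg _) (familyNorm_nonneg μ F f)) fun ρ hρ => by
        rw [ρ.integrate_smul μ, norm_smul]
        exact mul_le_mul_of_nonneg_left (norm_integrate_le_familyNorm μ hρ f) (norm_nonneg _))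

/-- `C_c(G)` with the convolution product and the seminorm `‖·‖_F`. -/
@[nolint unusedArguments]
def PreAlgebra (_μ : MeasureTheory.Measure G) [_μ.IsHaarMeasure] (_F : RepFamily.{u, v} G) :
    Type u :=
  C_c(G, ℂ)

/-- The identity `C_c(G) → PreAlgebra`. -/
def PreAlgebra.of (f : C_c(G, ℂ)) : PreAlgebra μ F := f

variable {μ F} in
/-- The identity `PreAlgebra → C_c(G)`. -/
def PreAlgebra.out (f : PreAlgebra μ F) : C_c(G, ℂ) := f

instance : AddCommGroup (PreAlgebra μ F) := inferInstanceAs (AddCommGroup C_c(G, ℂ))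

instance : Module ℂ (PreAlgebra μ F) := inferInstanceAs (Module ℂ C_c(G, ℂ))

instance : SeminormedAddCommGroup (PreAlgebra μ F) :=
  AddGroupSeminorm.toSeminormedAddCommGroup (E := PreAlgebra μ F)
    (familySeminorm μ F).toAddGroupSeminorm

theorem PreAlgebra.norm_def (f : PreAlgebra μ F) : ‖f‖ = familyNorm μ F f.out := rfl

instance : NormedSpace ℂ (PreAlgebra μ F) where
  norm_smul_le c f := (map_smul_eq_mul (familySeminorm μ F) c f.out).le

instance : NonUnitalSeminormedRing (PreAlgebra μ F) where
  __ := (inferInstance : SeminormedAddCommGroup (PreAlgebra μ F))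
  mul f h := PreAlgebra.of μ F (convolution μ f.out h.out)
  left_distrib f h k := by
    refine CompactlySupportedContinuousMap.ext (α := G) (β := ℂ) fun x => ?_
    change ∫ y, f.out y * (h.out (y⁻¹ * x) + k.out (y⁻¹ * x)) ∂μ
      = (∫ y, f.out y * h.out (y⁻¹ * x) ∂μ) + ∫ y, f.out y * k.out (y⁻¹ * x) ∂μ
    simp only [mul_add]
    exact MeasureTheory.integral_add (integrable_convolution μ _ _ x)
      (integrable_convolution μ _ _ x)
  right_distrib f h k := by
    refine CompactlySupportedContinuousMap.ext (α := G) (β := ℂ) fun x => ?_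
    change ∫ y, (f.out y + h.out y) * k.out (y⁻¹ * x) ∂μ
      = (∫ y, f.out y * k.out (y⁻¹ * x) ∂μ) + ∫ y, h.out y * k.out (y⁻¹ * x) ∂μ
    simp only [add_mul]
    exact MeasureTheory.integral_add (integrable_convolution μ _ _ x)
      (integrable_convolution μ _ _ x)
  zero_mul f := by
    refine CompactlySupportedContinuousMap.ext (α := G) (β := ℂ) fun x => ?_
    change ∫ y, (0 : ℂ) * f.out (y⁻¹ * x) ∂μ = 0
    simp
  mul_zero f := by
    refine CompactlySupportedContinuousMap.ext (α := G) (β := ℂ) fun x => ?_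
    change ∫ y, f.out y * (0 : ℂ) ∂μ = 0
    simp
  mul_assoc f h k := convolution_assoc μ f.out h.out k.out
  norm_mul_le f h := by
    refine familyNorm_le μ F _
      (mul_nonneg (familyNorm_nonneg μ F f.out) (familyNorm_nonneg μ F h.out)) fun ρ hρ => ?_
    change ‖ρ.integrate μ (convolution μ f.out h.out)‖ ≤ familyNorm μ F f.out * familyNorm μ F h.out
    rw [ρ.integrate_convolution μ]
    exact (norm_mul_le _ _).trans (mul_le_mul (norm_integrate_le_familyNorm μ hρ _)
      (norm_integrate_le_familyNorm μ hρ _) (norm_nonneg _) (familyNorm_nonneg μ F _))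

/-- The Banach algebra `C_F(G)`: the completion of `C_c(G)` for `‖·‖_F`. -/
abbrev CF : Type u := UniformSpace.Completion (PreAlgebra μ F)

/-- The canonical map `C_c(G) → C_F(G)`. -/
def CF.of (f : C_c(G, ℂ)) : CF μ F :=
  ((PreAlgebra.of μ F f : PreAlgebra μ F) : UniformSpace.Completion (PreAlgebra μ F))

/-- The product of `C_F(G)`, extending the convolution by continuity. -/
instance : Mul (CF μ F) :=
  ⟨Function.curry <| (UniformSpace.Completion.isDenseInducing_coe.prodMap
    UniformSpace.Completion.isDenseInducing_coe).extend
      ((↑) ∘ Function.uncurry fun f h : PreAlgebra μ F => f * h)⟩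

theorem CF.coe_mul (f h : PreAlgebra μ F) : ((f * h : PreAlgebra μ F) : CF μ F) = f * h :=
  ((UniformSpace.Completion.isDenseInducing_coe.prodMap
    UniformSpace.Completion.isDenseInducing_coe).extend_eq
      ((UniformSpace.Completion.continuous_coe _).comp
        (continuous_mul (M := PreAlgebra μ F))) (f, h)).symm

instance : ContinuousMul (CF μ F) where
  continuous_mul := by
    let m := (AddMonoidHom.mul : PreAlgebra μ F →+ PreAlgebra μ F →+ PreAlgebra μ F).compr₂
      UniformSpace.Completion.toCompl
    have : Continuous fun p : PreAlgebra μ F × PreAlgebra μ F => m p.1 p.2 :=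
      (UniformSpace.Completion.continuous_coe _).comp continuous_mul
    have di : IsDenseInducing (UniformSpace.Completion.toCompl : PreAlgebra μ F → CF μ F) :=
      UniformSpace.Completion.isDenseInducing_coe
    exact (di.extend_Z_bilin di this :)

instance : NonUnitalNormedRing (CF μ F) where
  __ := (inferInstance : NormedAddCommGroup (CF μ F))
  __ := (inferInstance : Mul (CF μ F))
  zero_mul a := UniformSpace.Completion.induction_on a
    (isClosed_eq (by fun_prop) continuous_const)
    fun a => by rw [← UniformSpace.Completion.coe_zero, ← CF.coe_mul, zero_mul]
  mul_zero a := UniformSpace.Completion.induction_on a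
    (isClosed_eq (by fun_prop) continuous_const)
    fun a => by rw [← UniformSpace.Completion.coe_zero, ← CF.coe_mul, mul_zero]
  mul_assoc a b c := UniformSpace.Completion.induction_on₃ a b c
    (isClosed_eq (by fun_prop) (by fun_prop))
    fun a b c => by rw [← CF.coe_mul, ← CF.coe_mul, ← CF.coe_mul, ← CF.coe_mul, mul_assoc]
  left_distrib a b c := UniformSpace.Completion.induction_on₃ a b c
    (isClosed_eq (by fun_prop) (by fun_prop))
    fun a b c => by
      rw [← UniformSpace.Completion.coe_add, ← CF.coe_mul, ← CF.coe_mul, ← CF.coe_mul,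
        ← UniformSpace.Completion.coe_add, mul_add]
  right_distrib a b c := UniformSpace.Completion.induction_on₃ a b c
    (isClosed_eq (by fun_prop) (by fun_prop))
    fun a b c => by
      rw [← UniformSpace.Completion.coe_add, ← CF.coe_mul, ← CF.coe_mul, ← CF.coe_mul,
        ← UniformSpace.Completion.coe_add, add_mul]
  norm_mul_le a b := by
    induction a, b using UniformSpace.Completion.induction_on₂ with
    | hp => apply isClosed_le <;> fun_prop
    | ih a b => simpa only [← CF.coe_mul, UniformSpace.Completion.norm_coe] using norm_mul_le a b

theorem uniformContinuous_integrate {ρ : BanachRep.{u, v} G} (hρ : ρ ∈ F.carrier) :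
    UniformContinuous fun f : PreAlgebra μ F => ρ.integrate μ f.out := by
  refine LipschitzWith.uniformContinuous (K := 1) (LipschitzWith.of_dist_le_mul fun f h => ?_)
  have hadd := ρ.integrate_add μ (f - h).out h.out
  have heq : (f - h).out + h.out = f.out := sub_add_cancel f h
  rw [heq] at hadd
  rw [dist_eq_norm, dist_eq_norm, hadd, add_sub_cancel_right, NNReal.coe_one, one_mul]
  exact norm_integrate_le_familyNorm μ hρ (f - h).out

variable {F} in
/-- For `(π,E) ∈ F`, the extension of `f ↦ π(f)` to `C_F(G)` by (uniform) continuity. -/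
def CF.rep (ρ : F.carrier) : CF μ F → (ρ.1.E →L[ℂ] ρ.1.E) :=
  UniformSpace.Completion.extension fun f : PreAlgebra μ F => ρ.1.integrate μ f.out

variable {F} in
theorem CF.rep_of (ρ : F.carrier) (f : C_c(G, ℂ)) :
    CF.rep μ ρ (CF.of μ F f) = ρ.1.integrate μ f :=
  UniformSpace.Completion.extension_coe (uniformContinuous_integrate μ F ρ.2) _

variable {F} in
theorem CF.continuous_rep (ρ : F.carrier) : Continuous (CF.rep μ ρ) :=
  UniformSpace.Completion.continuous_extension

variable {μ F}

/-- A Kazhdan projection in `C_F(G)`: an idempotent in the closure of `{f ∈ C_c(G) | ∫ f = 1}`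
such that `π(p)` is a projection onto `E^π` for all `(π,E) ∈ F`. -/
structure IsKazhdanProjection (p : CF μ F) : Prop where
  idempotent : IsIdempotentElem p
  mem_closure : p ∈ closure (CF.of μ F '' {f : C_c(G, ℂ) | ∫ g, f g ∂μ = 1})
  rep_idempotent : ∀ ρ : F.carrier, IsIdempotentElem (CF.rep μ ρ p)
  range_rep : ∀ ρ : F.carrier, Set.range (CF.rep μ ρ p) = ρ.1.invariants

/-- A Kazhdan projection in the center of `C_F(G)`. -/
structure IsCentralKazhdanProjection (p : CF μ F) : Prop extends IsKazhdanProjection p where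
  central : p ∈ Set.center (CF μ F)

end Algebra

/-! ### The classes `F(𝓔, m)` -/

/-- A class of complex Banach spaces. -/
abbrev BanachClass : Type (v + 1) :=
  ∀ (E : Type v) [NormedAddCommGroup E] [NormedSpace ℂ E] [CompleteSpace E], Prop

/-- The class `𝓔(ε)` of Banach spaces satisfying the `ε`-approximate parallelogram inequality. -/
def nearHilbert (ε : ℝ) : BanachClass.{v} := fun E _ _ _ =>
  ∀ x y : E, (1 / 2 : ℝ) * (‖x + y‖ ^ 2 + ‖x - y‖ ^ 2) ≤ (1 + ε) * (‖x‖ ^ 2 + ‖y‖ ^ 2)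

section WordLength

variable {G : Type u} [Group G] [TopologicalSpace G]

theorem IsCompactGeneratingSet.exists_mem_pow {S : Set G} (hS : IsCompactGeneratingSet S) (g : G) :
    ∃ n : ℕ, g ∈ S ^ n := by
  have hg : g ∈ Subgroup.closure S := by rw [hS.closure_eq_top]; trivial
  induction hg using Subgroup.closure_induction with
  | mem x hx => exact ⟨1, by simpa using hx⟩
  | one => exact ⟨0, by simp⟩
  | mul x y _ _ hx hy =>
    obtain ⟨n, hn⟩ := hx
    obtain ⟨m, hm⟩ := hy
    exact ⟨n + m, by rw [pow_add]; exact Set.mul_mem_mul hn hm⟩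
  | inv x _ hx =>
    obtain ⟨n, hn⟩ := hx
    have hinv : S⁻¹ = S := by
      ext s
      exact ⟨fun h => by simpa using hS.inv_mem _ h, fun h => hS.inv_mem _ h⟩
    refine ⟨n, ?_⟩
    rw [← hinv, inv_pow]
    simpa using hn

theorem wordLength_le {S : Set G} {g : G} {n : ℕ} (h : g ∈ S ^ n) : wordLength S g ≤ n :=
  Nat.sInf_le h

/-- The word length is bounded on compact sets. -/
theorem IsCompactGeneratingSet.wordLength_bounded [IsTopologicalGroup G] [T2Space G]
    [LocallyCompactSpace G] {S : Set G} (hS : IsCompactGeneratingSet S) {K : Set G}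
    (hK : IsCompact K) : ∃ N : ℕ, ∀ g ∈ K, wordLength S g ≤ N := by
  have hcomp : ∀ n : ℕ, IsCompact (S ^ n) := fun n => by
    induction n with
    | zero => simp
    | succ n ih => rw [pow_succ]; exact ih.mul hS.isCompact
  obtain ⟨n, x, hx⟩ := nonempty_interior_of_iUnion_of_closed
    (fun n => (hcomp n).isClosed) (Set.iUnion_eq_univ_iff.2 hS.exists_mem_pow)
  let U : G → Set G := fun g => (fun y => x * g⁻¹ * y) ⁻¹' interior (S ^ n)
  obtain ⟨t, ht⟩ := hK.elim_finite_subcover U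
    (fun g => isOpen_interior.preimage (continuous_const_mul _))
    (fun g _ => Set.mem_iUnion.2 ⟨g, by simpa [U] using hx⟩)
  choose N hN using fun g : G => hS.exists_mem_pow (g * x⁻¹)
  refine ⟨t.sup N + n, fun y hy => ?_⟩
  obtain ⟨g, hgt, hgy⟩ := Set.mem_iUnion₂.1 (ht hy)
  have hmem : y ∈ S ^ (N g + n) := by
    rw [pow_add]
    exact ⟨g * x⁻¹, hN g, x * g⁻¹ * y, interior_subset hgy, by group⟩
  exact (wordLength_le hmem).trans (Nat.add_le_add_right (Finset.le_sup hgt) n)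

/-- The class `F(𝓔, cℓ)` of all representations `(π,E)` with `E ∈ 𝓔` and
`‖π(g)‖ ≤ exp (c ℓ(g))` for all `g`. -/
def repFamily [IsTopologicalGroup G] [T2Space G] [LocallyCompactSpace G] {S : Set G}
    (hS : IsCompactGeneratingSet S) (𝓔 : BanachClass.{v}) (c : ℝ) : RepFamily.{u, v} G where
  carrier := {ρ | 𝓔 ρ.E ∧ ∀ g, ‖ρ.π g‖ ≤ Real.exp (c * wordLength S g)}
  bounded := fun K hK => by
    obtain ⟨N, hN⟩ := hS.wordLength_bounded hK
    refine ⟨Real.exp (|c| * N), fun ρ hρ g hg => (hρ.2 g).trans (Real.exp_le_exp.2 ?_)⟩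
    exact mul_le_mul (le_abs_self c) (by exact_mod_cast hN g hg) (Nat.cast_nonneg _) (abs_nonneg c)

end WordLength

/-! ### Property (T) and robust property (T) -/

/-- Kazhdan's property (T): there are a compact set `Q` and `δ > 0` such that every strongly
continuous unitary representation on a complex Hilbert space that has a `(Q, δ)`-invariant vector
has a nonzero invariant vector. -/
def PropertyT (G : Type u) [Group G] [TopologicalSpace G] : Prop :=
  ∃ Q : Set G, IsCompact Q ∧ ∃ δ : ℝ, 0 < δ ∧
    ∀ (H : Type v) [NormedAddCommGroup H] [InnerProductSpace ℂ H] [CompleteSpace H]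
      (π : G →* unitary (H →L[ℂ] H)),
      (∀ x : H, Continuous fun g => (π g : H →L[ℂ] H) x) →
      (∃ x : H, x ≠ 0 ∧ ∀ g ∈ Q, ‖(π g : H →L[ℂ] H) x - x‖ < δ * ‖x‖) →
      ∃ y : H, y ≠ 0 ∧ ∀ g, (π g : H →L[ℂ] H) y = y

/-- Robust property (T) with respect to `𝓔`: for some `s > 0`, `C_{F(𝓔, sℓ)}(G)` has a Kazhdan
projection. -/
def RobustPropertyT {G : Type u} [Group G] [TopologicalSpace G] [IsTopologicalGroup G] [T2Space G]
    [LocallyCompactSpace G] [MeasurableSpace G] [BorelSpace G] (μ : MeasureTheory.Measure G)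
    [μ.IsHaarMeasure] {S : Set G} (hS : IsCompactGeneratingSet S) (𝓔 : BanachClass.{v}) : Prop :=
  ∃ s : ℝ, 0 < s ∧ ∃ p : CF μ (repFamily hS 𝓔 s), IsKazhdanProjection p

end

end KazhdanRobust

open KazhdanRobust

/-!
Under property (T) a bump function averages unitary representations towards their invariant vectors
with a uniform spectral gap, and positivity of the Gaussian kernels `exp (-t ‖x - y‖²)` forces
affine isometric actions on Hilbert spaces to have fixed points. Hence some convolution power `φ`
of the bump function shrinks displacements in all these actions by as large a factor as we like. If
no `ε` made `φ` halve displacements for all affine actions with linear part in `F(𝓔(ε), εℓ)`, an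
ultraproduct of normalized counterexamples with `ε → 0` would be an affine isometric action on a
Hilbert space, hence a contradiction; the cocycles are first averaged once to make them
equicontinuous, so that the limit is continuous.

Iterating such a `φ` converges geometrically to a fixed point. For linear actions the convergence
is uniform over the family, so the powers of `φ` converge to a Kazhdan projection `p`. The family is
closed under passing to the continuous part of the contragredient, which provides enough invariant
functionals to see that `p` is central. Conversely, unitary representations lie in every family
`F(𝓔(ε), sℓ)`, and an `f ∈ C_c(G)` of integral `1` close to `p` yields a Kazhdan pair.
-/

namespace KazhdanRobust

noncomputable section

open Filter Topology MeasureTheory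

/-! ### Continuous vectors, restrictions and completions -/

section Linear

variable {G : Type u} [Group G] {E : Type v} [NormedAddCommGroup E] [NormedSpace ℂ E]

theorem map_apply_inv_apply (π : G →* (E →L[ℂ] E)) (g : G) (x : E) : π g (π g⁻¹ x) = x := by
  rw [← mul_apply_eq_comp, ← map_mul, mul_inv_cancel, map_one, one_apply_eq_self]

/-- The restriction of a linear representation to an invariant subspace. -/
def restrictHom (π : G →* (E →L[ℂ] E)) (W : Submodule ℂ E) (hW : ∀ g, ∀ x ∈ W, π g x ∈ W) :
    G →* (W →L[ℂ] W) where
  toFun g := (π g).restrict (hW g)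
  map_one' := by ext x; simp
  map_mul' g h := by ext x; simp

theorem norm_pow_apply_le {T : E →L[ℂ] E} {c : ℝ} (hc : 0 ≤ c) (hT : ∀ x, ‖T x‖ ≤ c * ‖x‖) (m : ℕ)
    (x : E) : ‖(T ^ m) x‖ ≤ c ^ m * ‖x‖ := by
  induction m with
  | zero => simp
  | succ m ih =>
    rw [pow_succ', mul_apply_eq_comp, pow_succ', mul_assoc]
    exact (hT _).trans (mul_le_mul_of_nonneg_left ih hc)

end Linear

section ContinuousVectors

variable {G : Type u} [Group G] [TopologicalSpace G] [IsTopologicalGroup G]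

theorem continuous_orbit_of_tendsto_one {E : Type v} [SeminormedAddCommGroup E] [NormedSpace ℂ E]
    (π : G →* (E →L[ℂ] E)) {x : E} (h : Tendsto (fun g => π g x) (𝓝 1) (𝓝 x)) :
    Continuous fun g => π g x := by
  refine continuous_iff_continuousAt.2 fun g₀ => ?_
  have htranslate : Tendsto (fun g => g₀⁻¹ * g) (𝓝 g₀) (𝓝 1) := by
    simpa using (continuous_const_mul g₀⁻¹).tendsto g₀
  refine (((π g₀).continuous.tendsto x).comp (h.comp htranslate)).congr fun g => ?_
  simp only [Function.comp_apply]
  rw [← mul_apply_eq_comp, ← map_mul, mul_inv_cancel_left]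

variable {E : Type v} [NormedAddCommGroup E] [NormedSpace ℂ E] (π : G →* (E →L[ℂ] E))

/-- The subspace of vectors whose orbit map is continuous, on which a representation that is not
assumed strongly continuous becomes so. -/
def continuousVectors : Submodule ℂ E where
  carrier := {x | Continuous fun g => π g x}
  add_mem' ha hb := by
    simp only [Set.mem_ofPred_eq, map_add] at ha hb ⊢
    exact ha.add hb
  zero_mem' := by simpa using continuous_const
  smul_mem' c x hx := by
    simp only [Set.mem_ofPred_eq, map_smul] at hx ⊢
    exact hx.const_smul c

theorem map_mem_continuousVectors (g : G) {x : E} (hx : x ∈ continuousVectors π) :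
    π g x ∈ continuousVectors π := by
  have hshift : Continuous fun k : G => π (k * g) x := hx.comp (continuous_mul_const g)
  change Continuous fun k => π k (π g x)
  simpa using hshift

theorem isClosed_continuousVectors {C : ℝ} (hC : ∀ᶠ g in 𝓝 1, ‖π g‖ ≤ C) :
    IsClosed (continuousVectors π : Set E) := by
  rw [← closure_subset_iff_isClosed]
  intro x hx
  refine continuous_orbit_of_tendsto_one π (Metric.tendsto_nhds.2 fun η hη => ?_)
  have hC0 : 0 ≤ C := hC.exists.elim fun g hg => (norm_nonneg _).trans hg
  obtain ⟨y, hy, hxy⟩ := Metric.mem_closure_iff.1 hx (η / (2 * (C + 1))) (by positivity)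
  have hy_one : Tendsto (fun g => π g y) (𝓝 1) (𝓝 y) := by
    simpa using (show Continuous fun g => π g y from hy).tendsto 1
  filter_upwards [hC, Metric.tendsto_nhds.1 hy_one (η / 2) (by positivity)] with g hg hgy
  rw [dist_eq_norm] at hxy hgy ⊢
  rw [lt_div_iff₀ (by positivity)] at hxy
  calc ‖π g x - x‖ = ‖π g (x - y) + (π g y - y) - (x - y)‖ := by rw [map_sub]; congr 1; abel
    _ ≤ ‖π g (x - y)‖ + ‖π g y - y‖ + ‖x - y‖ :=
        (norm_sub_le _ _).trans (add_le_add_left (norm_add_le _ _) _)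
    _ ≤ C * ‖x - y‖ + ‖π g y - y‖ + ‖x - y‖ := by
        gcongr
        exact (π g).le_of_opNorm_le hg _
    _ < η := by linarith

/-- The strongly continuous representation on the space of continuous vectors. -/
def continuousPart [CompleteSpace E] {C : ℝ} (hC : ∀ᶠ g in 𝓝 1, ‖π g‖ ≤ C) :
    BanachRep.{u, v} G :=
  haveI : CompleteSpace (continuousVectors π) :=
    (isClosed_continuousVectors π hC).completeSpace_coe
  { E := continuousVectors π
    π := restrictHom π _ fun g _ hx => map_mem_continuousVectors π g hx
    continuous_orbit := fun x => Continuous.subtype_mk x.2 _ }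

end ContinuousVectors

section Unitary

variable {G : Type u} [Group G] [TopologicalSpace G]

/-- A representation is unitary if its norm is Hilbertian (that is, satisfies the parallelogram
identity) and invariant. -/
structure BanachRep.IsUnitary (ρ : BanachRep.{u, v} G) : Prop where
  parallelogram : ∀ x y : ρ.E,
    ‖x + y‖ * ‖x + y‖ + ‖x - y‖ * ‖x - y‖ = 2 * (‖x‖ * ‖x‖ + ‖y‖ * ‖y‖)
  norm_map : ∀ g x, ‖ρ.π g x‖ = ‖x‖

/-- The restriction of a representation to a closed invariant subspace. -/
def BanachRep.subrep (ρ : BanachRep.{u, v} G) (W : Submodule ℂ ρ.E)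
    (hW : IsClosed (W : Set ρ.E)) (hinv : ∀ g, ∀ x ∈ W, ρ.π g x ∈ W) : BanachRep.{u, v} G :=
  haveI : CompleteSpace W := hW.completeSpace_coe
  { E := W
    π := restrictHom ρ.π W hinv
    continuous_orbit := fun x => Continuous.subtype_mk (ρ.continuous_orbit x) _ }

theorem BanachRep.IsUnitary.norm_le_one {ρ : BanachRep.{u, v} G} (hρ : ρ.IsUnitary) (g : G) :
    ‖ρ.π g‖ ≤ 1 :=
  ContinuousLinearMap.opNorm_le_bound _ zero_le_one fun x => by rw [hρ.norm_map, one_mul]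

theorem BanachRep.IsUnitary.subrep {ρ : BanachRep.{u, v} G} (hρ : ρ.IsUnitary)
    {W : Submodule ℂ ρ.E} (hW : IsClosed (W : Set ρ.E)) (hinv : ∀ g, ∀ x ∈ W, ρ.π g x ∈ W) :
    (ρ.subrep W hW hinv).IsUnitary :=
  ⟨fun x y => hρ.parallelogram (x : W).1 (y : W).1, fun g x => hρ.norm_map g (x : W).1⟩

end Unitary

section Completion

open UniformSpace

variable {G : Type u} [Group G]

/-- The extension of a linear representation to the completion of its space. -/
def completionHom {X : Type v} [SeminormedAddCommGroup X] [NormedSpace ℂ X]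
    (π : G →* (X →L[ℂ] X)) : G →* (Completion X →L[ℂ] Completion X) where
  toFun g := (π g).completion
  map_one' := by
    ext x
    induction x using Completion.induction_on with
    | hp => exact isClosed_eq (ContinuousLinearMap.continuous _) continuous_id
    | ih x => simp
  map_mul' g h := by
    ext x
    induction x using Completion.induction_on with
    | hp => exact isClosed_eq (ContinuousLinearMap.continuous _) (ContinuousLinearMap.continuous _)
    | ih x => simp

theorem completionHom_coe {X : Type v} [SeminormedAddCommGroup X] [NormedSpace ℂ X]
    (π : G →* (X →L[ℂ] X)) (g : G) (x : X) : completionHom π g (x : Completion X) = π g x :=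
  (π g).completion_apply_coe x

theorem norm_completionHom {X : Type v} [SeminormedAddCommGroup X] [NormedSpace ℂ X]
    {π : G →* (X →L[ℂ] X)} (hπ : ∀ g x, ‖π g x‖ = ‖x‖) (g : G) (x : Completion X) :
    ‖completionHom π g x‖ = ‖x‖ := by
  induction x using Completion.induction_on with
  | hp => exact isClosed_eq (ContinuousLinearMap.continuous _).norm continuous_norm
  | ih x => rw [completionHom_coe, Completion.norm_coe, Completion.norm_coe, hπ]

theorem completion_parallelogram {X : Type v} [SeminormedAddCommGroup X]
    (hX : ∀ x y : X, ‖x + y‖ * ‖x + y‖ + ‖x - y‖ * ‖x - y‖ = 2 * (‖x‖ * ‖x‖ + ‖y‖ * ‖y‖))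
    (x y : Completion X) :
    ‖x + y‖ * ‖x + y‖ + ‖x - y‖ * ‖x - y‖ = 2 * (‖x‖ * ‖x‖ + ‖y‖ * ‖y‖) := by
  induction x, y using Completion.induction_on₂ with
  | hp => exact isClosed_eq (by fun_prop) (by fun_prop)
  | ih x y =>
    simpa only [← Completion.coe_add, ← Completion.coe_sub, Completion.norm_coe] using hX x y

variable [TopologicalSpace G] [IsTopologicalGroup G]

theorem exists_unitary_completion {X : Type v} [SeminormedAddCommGroup X] [NormedSpace ℂ X]
    (hX : ∀ x y : X, ‖x + y‖ * ‖x + y‖ + ‖x - y‖ * ‖x - y‖ = 2 * (‖x‖ * ‖x‖ + ‖y‖ * ‖y‖))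
    (π : G →* (X →L[ℂ] X)) (hπ : ∀ g x, ‖π g x‖ = ‖x‖) (hc : ∀ x, Continuous fun g => π g x) :
    ∃ ρ : BanachRep.{u, v} G, ρ.IsUnitary ∧
      ∃ T : X →ₗᵢ[ℂ] ρ.E, ∀ g x, T (π g x) = ρ.π g (T x) := by
  have hbound : ∀ᶠ g in 𝓝 (1 : G), ‖completionHom π g‖ ≤ 1 := .of_forall fun g =>
    ContinuousLinearMap.opNorm_le_bound _ zero_le_one fun x => by
      rw [norm_completionHom hπ, one_mul]
  have hcontinuous : ∀ y, y ∈ continuousVectors (completionHom π) := fun y => by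
    induction y using Completion.induction_on with
    | hp => exact isClosed_continuousVectors _ hbound
    | ih x =>
      change Continuous fun g => completionHom π g x
      simp only [completionHom_coe]
      exact (Completion.continuous_coe X).comp (hc x)
  exact ⟨{ E := Completion X, π := completionHom π, continuous_orbit := hcontinuous },
    ⟨completion_parallelogram hX, norm_completionHom hπ⟩,
    Completion.toComplₗᵢ, fun g x => (completionHom_coe π g x).symm⟩

theorem exists_unitary_of_seminorm {E : Type v} [AddCommGroup E] [Module ℂ E] (p : Seminorm ℂ E)
    (hp : ∀ x y, p (x + y) * p (x + y) + p (x - y) * p (x - y) = 2 * (p x * p x + p y * p y))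
    (π : G →* (E →ₗ[ℂ] E)) (hπ : ∀ g x, p (π g x) = p x)
    (hc : ∀ x, Tendsto (fun g => p (π g x - x)) (𝓝 1) (𝓝 0)) :
    ∃ ρ : BanachRep.{u, v} G, ρ.IsUnitary ∧
      ∃ T : E →ₗ[ℂ] ρ.E, (∀ x, ‖T x‖ = p x) ∧ ∀ g x, T (π g x) = ρ.π g (T x) := by
  let _ : SeminormedAddCommGroup E := p.toSeminormedAddCommGroup
  let _ : NormedSpace ℂ E := { norm_smul_le := fun c x => (map_smul_eq_mul p c x).le }
  let πL : G →* (E →L[ℂ] E) :=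
    { toFun := fun g => (π g).mkContinuous 1 fun x => by
        rw [one_mul]
        exact (hπ g x).le
      map_one' := by ext x; simp
      map_mul' := fun g h => by ext x; simp }
  obtain ⟨ρ, hρ, T, hT⟩ := exists_unitary_completion hp πL hπ fun x =>
    continuous_orbit_of_tendsto_one πL (tendsto_iff_norm_sub_tendsto_zero.2 (hc x))
  exact ⟨ρ, hρ, T.toLinearMap, fun x => T.norm_map x, hT⟩

end Completion

/-! ### Kazhdan pairs and the spectral gap of unitary representations -/

section KazhdanPair

section InnerProduct

variable {G : Type u} [Group G] {H : Type v} [NormedAddCommGroup H] [InnerProductSpace ℂ H]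
  (π : G →* (H →L[ℂ] H))

theorem inner_map_left_of_isometric (hπ : ∀ g x, ‖π g x‖ = ‖x‖) (g : G) (x y : H) :
    inner ℂ (π g x) y = inner ℂ x (π g⁻¹ y) := by
  conv_lhs => rw [← map_apply_inv_apply π g y]
  exact (⟨(π g).toLinearMap, hπ g⟩ : H →ₗᵢ[ℂ] H).inner_map_map x (π g⁻¹ y)

/-- An isometric linear action on a Hilbert space, as a homomorphism to the unitary group. -/
def unitaryHom [CompleteSpace H] (hπ : ∀ g x, ‖π g x‖ = ‖x‖) : G →* unitary (H →L[ℂ] H) :=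
  have hstar : ∀ g, star (π g) = π g⁻¹ := fun g => by
    rw [ContinuousLinearMap.star_eq_adjoint, eq_comm, ContinuousLinearMap.eq_adjoint_iff]
    intro x y
    rw [inner_map_left_of_isometric π hπ, inv_inv]
  { toFun := fun g => ⟨π g, by
      rw [Unitary.mem_iff, hstar, ← map_mul, ← map_mul, inv_mul_cancel, mul_inv_cancel, map_one]
      exact ⟨rfl, rfl⟩⟩
    map_one' := Subtype.ext (map_one π)
    map_mul' := fun g h => Subtype.ext (map_mul π g h) }

end InnerProduct

variable {G : Type u} [Group G] [TopologicalSpace G] {Q : Set G} {δ : ℝ}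

theorem BanachRep.isClosed_invariants (ρ : BanachRep.{u, v} G) :
    IsClosed (ρ.invariants : Set ρ.E) := by
  have hinter : (ρ.invariants : Set ρ.E) = ⋂ g, {x | ρ.π g x = x} := by
    ext x
    simp [BanachRep.invariants]
  rw [hinter]
  exact isClosed_iInter fun g => isClosed_eq (ρ.π g).continuous continuous_id

theorem BanachRep.IsUnitary.exists_isCompl_invariants {ρ : BanachRep.{u, v} G}
    (hρ : ρ.IsUnitary) :
    ∃ W : Submodule ℂ ρ.E, IsClosed (W : Set ρ.E) ∧ (∀ g, ∀ x ∈ W, ρ.π g x ∈ W) ∧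
      IsCompl ρ.invariants W := by
  let _ : InnerProductSpace ℂ ρ.E := InnerProductSpace.ofNorm ℂ hρ.parallelogram
  have : CompleteSpace ρ.invariants := ρ.isClosed_invariants.completeSpace_coe
  refine ⟨ρ.invariantsᗮ, Submodule.isClosed_orthogonal _, fun g x hx => ?_,
    Submodule.isCompl_orthogonal _⟩
  rw [Submodule.mem_orthogonal'] at hx ⊢
  intro z hz
  rw [inner_map_left_of_isometric ρ.π hρ.norm_map, hz g⁻¹, hx z hz]

/-- `(Q, δ)` is a Kazhdan pair: every unitary representation with a `(Q, δ)`-invariant vector has a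
nonzero invariant vector. -/
def IsKazhdanPair (Q : Set G) (δ : ℝ) : Prop :=
  ∀ (H : Type v) [NormedAddCommGroup H] [InnerProductSpace ℂ H] [CompleteSpace H]
    (π : G →* unitary (H →L[ℂ] H)),
    (∀ x : H, Continuous fun g => (π g : H →L[ℂ] H) x) →
    (∃ x : H, x ≠ 0 ∧ ∀ g ∈ Q, ‖(π g : H →L[ℂ] H) x - x‖ < δ * ‖x‖) →
    ∃ y : H, y ≠ 0 ∧ ∀ g, (π g : H →L[ℂ] H) y = y

/-- `δ` is a Kazhdan constant of `ρ` for `Q`: `δ ‖x‖ ≤ sup_{g ∈ Q} ‖π(g) x - x‖` for all `x`. The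
supremum is expressed through its upper bounds `r ≥ 0`. -/
def BanachRep.IsKazhdanConstant (ρ : BanachRep.{u, v} G) (Q : Set G) (δ : ℝ) : Prop :=
  ∀ (x : ρ.E) (r : ℝ), 0 ≤ r → (∀ g ∈ Q, ‖ρ.π g x - x‖ ≤ r) → δ * ‖x‖ ≤ r

theorem IsKazhdanPair.isKazhdanConstant (hQ : IsKazhdanPair.{u, v} Q δ) {ρ : BanachRep.{u, v} G}
    (hρ : ρ.IsUnitary) (hinv : ρ.invariants = ⊥) : ρ.IsKazhdanConstant Q δ := by
  intro x r hr hx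
  by_contra! hlt
  let _ : InnerProductSpace ℂ ρ.E := InnerProductSpace.ofNorm ℂ hρ.parallelogram
  have hx0 : x ≠ 0 := by
    rintro rfl
    simp only [norm_zero, mul_zero] at hlt
    exact hr.not_gt hlt
  obtain ⟨y, hy0, hy⟩ := hQ ρ.E (unitaryHom ρ.π hρ.norm_map) ρ.continuous_orbit
    ⟨x, hx0, fun g hg => (hx g hg).trans_lt hlt⟩
  have hy_inv : y ∈ ρ.invariants := hy
  rw [hinv] at hy_inv
  exact hy0 hy_inv

theorem IsKazhdanPair.exists_decomposition (hQ : IsKazhdanPair.{u, v} Q δ)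
    {ρ : BanachRep.{u, v} G} (hρ : ρ.IsUnitary) :
    ∃ (W : Submodule ℂ ρ.E) (hW : IsClosed (W : Set ρ.E)) (hinv : ∀ g, ∀ x ∈ W, ρ.π g x ∈ W),
      (ρ.subrep W hW hinv).IsKazhdanConstant Q δ ∧
      ∀ (x : ρ.E) (r : ℝ), 0 ≤ r → (∀ g ∈ Q, ‖ρ.π g x - x‖ ≤ r) →
        ∃ z ∈ ρ.invariants, x - z ∈ W ∧ δ * ‖x - z‖ ≤ r := by
  obtain ⟨W, hW, hinv, hcompl⟩ := hρ.exists_isCompl_invariants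
  have hconst : (ρ.subrep W hW hinv).IsKazhdanConstant Q δ := by
    refine hQ.isKazhdanConstant (hρ.subrep hW hinv) ?_
    refine (Submodule.eq_bot_iff _).2 fun w hw => Subtype.ext ?_
    exact Submodule.disjoint_def.1 hcompl.disjoint _ (fun g => congrArg Subtype.val (hw g))
      (w : W).2
  refine ⟨W, hW, hinv, hconst, fun x r hr hx => ?_⟩
  obtain ⟨z, hz, w, hw, rfl⟩ := Submodule.mem_sup.1
    (hcompl.sup_eq_top ▸ Submodule.mem_top : x ∈ ρ.invariants ⊔ W)
  refine ⟨z, hz, ?_⟩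
  rw [add_sub_cancel_left]
  refine ⟨hw, hconst (⟨w, hw⟩ : W) r hr fun g hg => ?_⟩
  have hmove : ρ.π g (z + w) - (z + w) = ρ.π g w - w := by
    rw [map_add, hz g, add_sub_add_left_eq_sub]
  exact (congrArg norm hmove).symm.trans_le (hx g hg)

theorem IsKazhdanPair.exists_invariant_near (hQ : IsKazhdanPair.{u, v} Q δ)
    {ρ : BanachRep.{u, v} G} (hρ : ρ.IsUnitary) {x : ρ.E} {r : ℝ} (hr : 0 ≤ r)
    (hx : ∀ g ∈ Q, ‖ρ.π g x - x‖ ≤ r) : ∃ z ∈ ρ.invariants, δ * ‖x - z‖ ≤ r := by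
  obtain ⟨W, hW, hinv, -, hdecomp⟩ := hQ.exists_decomposition hρ
  obtain ⟨z, hz, -, hnear⟩ := hdecomp x r hr hx
  exact ⟨z, hz, hnear⟩

end KazhdanPair

section Variance

variable {X : Type*} [MeasurableSpace X] {μ : Measure X} {H : Type*} [NormedAddCommGroup H]
  [InnerProductSpace ℝ H] [CompleteSpace H] {χ : X → ℝ} {F : X → H}

theorem integral_mul_norm_sub_sq (hχ : Integrable χ μ) (hF : Integrable (fun g => χ g • F g) μ)
    (hF2 : Integrable (fun g => χ g * ‖F g‖ ^ 2) μ) (y : H) :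
    ∫ g, χ g * ‖F g - y‖ ^ 2 ∂μ = (∫ g, χ g * ‖F g‖ ^ 2 ∂μ)
      - 2 * inner ℝ y (∫ g, χ g • F g ∂μ) + (∫ g, χ g ∂μ) * ‖y‖ ^ 2 := by
  have hexpand : ∀ g, χ g * ‖F g - y‖ ^ 2 =
      χ g * ‖F g‖ ^ 2 - 2 * inner ℝ y (χ g • F g) + χ g * ‖y‖ ^ 2 := fun g => by
    rw [norm_sub_sq_real, inner_smul_right, real_inner_comm]
    ring
  have hinner : Integrable (fun g => 2 * inner ℝ y (χ g • F g)) μ :=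
    (hF.const_inner y).const_mul 2
  have hdiff : Integrable (fun g => χ g * ‖F g‖ ^ 2 - 2 * inner ℝ y (χ g • F g)) μ :=
    hF2.sub hinner
  simp only [hexpand]
  rw [integral_add hdiff (hχ.mul_const _), integral_sub hF2 hinner, integral_const_mul,
    integral_inner hF, integral_mul_const]

theorem integral_mul_norm_sub_mean_sq (hχ : Integrable χ μ)
    (hF : Integrable (fun g => χ g • F g) μ) (hF2 : Integrable (fun g => χ g * ‖F g‖ ^ 2) μ)
    {m : H} (hm : (∫ g, χ g ∂μ) • m = ∫ g, χ g • F g ∂μ) (y : H) :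
    ∫ g, χ g * ‖F g - y‖ ^ 2 ∂μ =
      (∫ g, χ g * ‖F g - m‖ ^ 2 ∂μ) + (∫ g, χ g ∂μ) * ‖m - y‖ ^ 2 := by
  rw [integral_mul_norm_sub_sq hχ hF hF2, integral_mul_norm_sub_sq hχ hF hF2, ← hm,
    inner_smul_right, inner_smul_right, real_inner_self_eq_norm_sq, norm_sub_sq_real,
    real_inner_comm]
  ring

end Variance

section Normalization

variable {X : Type*} [TopologicalSpace X] [MeasurableSpace X] (μ : Measure X)

/-- The complex-valued function `χ / ∫ χ`. It has integral `1` as soon as `∫ χ ≠ 0`. -/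
def normalization (χ : C_c(X, ℝ)) : C_c(X, ℂ) where
  toFun g := (((∫ k, χ k ∂μ)⁻¹ * χ g : ℝ) : ℂ)
  continuous_toFun := by
    have := χ.continuous
    fun_prop
  hasCompactSupport' := χ.hasCompactSupport.mono fun g => by
    simp only [Function.mem_support]
    contrapose!
    intro h
    simp [h]

theorem integral_normalization {χ : C_c(X, ℝ)} (hχ : ∫ g, χ g ∂μ ≠ 0) :
    ∫ g, normalization μ χ g ∂μ = 1 := by
  change ∫ g, (((∫ k, χ k ∂μ)⁻¹ * χ g : ℝ) : ℂ) ∂μ = 1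
  rw [integral_complex_ofReal, integral_const_mul, inv_mul_cancel₀ hχ, Complex.ofReal_one]

end Normalization

section Average

variable {G : Type u} [Group G] [TopologicalSpace G] [MeasurableSpace G] [BorelSpace G]
  (μ : Measure G) [μ.IsHaarMeasure]

theorem BanachRep.IsUnitary.integral_mul_norm_sub_sq {ρ : BanachRep.{u, v} G} (hρ : ρ.IsUnitary)
    {χ : G → ℝ} (hχ : Continuous χ) (hχc : HasCompactSupport χ) {x m : ρ.E}
    (hm : (∫ g, χ g ∂μ) • m = ∫ g, χ g • ρ.π g x ∂μ) (y : ρ.E) :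
    ∫ g, χ g * ‖ρ.π g x - y‖ ^ 2 ∂μ =
      (∫ g, χ g * ‖ρ.π g x - m‖ ^ 2 ∂μ) + (∫ g, χ g ∂μ) * ‖m - y‖ ^ 2 := by
  let _ : InnerProductSpace ℝ ρ.E := InnerProductSpace.ofNorm ℝ hρ.parallelogram
  have horbit := ρ.continuous_orbit x
  exact integral_mul_norm_sub_mean_sq (hχ.integrable_of_hasCompactSupport hχc)
    ((hχ.smul horbit).integrable_of_hasCompactSupport hχc.smul_right)
    (Continuous.integrable_of_hasCompactSupport (by fun_prop) hχc.mul_right) hm y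

variable [IsTopologicalGroup G]

theorem BanachRep.map_integrate {ρ ρ' : BanachRep.{u, v} G} (T : ρ.E →L[ℂ] ρ'.E)
    (hT : ∀ g x, T (ρ.π g x) = ρ'.π g (T x)) (f : C_c(G, ℂ)) (x : ρ.E) :
    T (ρ.integrate μ f x) = ρ'.integrate μ f (T x) := by
  rw [BanachRep.integrate_apply, BanachRep.integrate_apply,
    ← ContinuousLinearMap.integral_comp_comm _ (ρ.integrable_orbit μ f x)]
  simp only [map_smul, hT]

theorem BanachRep.map_integrate_pow {ρ ρ' : BanachRep.{u, v} G} (T : ρ.E →L[ℂ] ρ'.E)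
    (hT : ∀ g x, T (ρ.π g x) = ρ'.π g (T x)) (f : C_c(G, ℂ)) (m : ℕ) (x : ρ.E) :
    T ((ρ.integrate μ f ^ m) x) = (ρ'.integrate μ f ^ m) (T x) := by
  induction m with
  | zero => simp
  | succ m ih =>
    rw [pow_succ', mul_apply_eq_comp, map_integrate μ T hT, ih, pow_succ', mul_apply_eq_comp]

theorem BanachRep.map_integrate_of_map_orbit_eq {ρ : BanachRep.{u, v} G} {E' : Type*}
    [NormedAddCommGroup E'] [NormedSpace ℂ E'] [CompleteSpace E'] (T : ρ.E →L[ℂ] E') {x : ρ.E}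
    (hT : ∀ g, T (ρ.π g x) = T x) (f : C_c(G, ℂ)) :
    T (ρ.integrate μ f x) = (∫ g, f g ∂μ) • T x := by
  rw [BanachRep.integrate_apply, ← T.integral_comp_comm (ρ.integrable_orbit μ f x)]
  simp only [map_smul, hT]
  rw [integral_smul_const]

theorem BanachRep.integrate_of_mem_invariants {ρ : BanachRep.{u, v} G} (f : C_c(G, ℂ)) {x : ρ.E}
    (hx : x ∈ ρ.invariants) : ρ.integrate μ f x = (∫ g, f g ∂μ) • x :=
  map_integrate_of_map_orbit_eq μ (ContinuousLinearMap.id ℂ ρ.E) hx f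

theorem BanachRep.integrate_eq_self {ρ : BanachRep.{u, v} G} {f : C_c(G, ℂ)}
    (hf : ∫ g, f g ∂μ = 1) {x : ρ.E} (hx : x ∈ ρ.invariants) : ρ.integrate μ f x = x := by
  rw [integrate_of_mem_invariants μ f hx, hf, one_smul]

theorem BanachRep.integrate_pow_eq_self {ρ : BanachRep.{u, v} G} {f : C_c(G, ℂ)}
    (hf : ∫ g, f g ∂μ = 1) {x : ρ.E} (hx : x ∈ ρ.invariants) (m : ℕ) :
    (ρ.integrate μ f ^ m) x = x := by
  induction m with
  | zero => simp
  | succ m ih => rw [pow_succ, mul_apply_eq_comp, integrate_eq_self μ hf hx, ih]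

theorem integral_smul_integrate_normalization (ρ : BanachRep.{u, v} G) {χ : C_c(G, ℝ)}
    (hχ : ∫ g, χ g ∂μ ≠ 0) (x : ρ.E) :
    (∫ g, χ g ∂μ) • ρ.integrate μ (normalization μ χ) x = ∫ g, χ g • ρ.π g x ∂μ := by
  rw [BanachRep.integrate_apply, ← integral_smul]
  refine integral_congr_ae (.of_forall fun g => ?_)
  change (∫ k, χ k ∂μ) • (((∫ k, χ k ∂μ)⁻¹ * χ g : ℝ) : ℂ) • ρ.π g x = χ g • ρ.π g x
  rw [Complex.coe_smul, smul_smul, mul_inv_cancel_left₀ hχ]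

theorem map_integral_smul_orbit (ρ : BanachRep.{u, v} G) (χ : C_c(G, ℝ)) (q : G) (x : ρ.E) :
    ρ.π q (∫ g, χ g • ρ.π g x ∂μ) = ∫ g, χ (q⁻¹ * g) • ρ.π g x ∂μ := by
  have hint : Integrable (fun g => χ g • ρ.π g x) μ :=
    (χ.continuous.smul (ρ.continuous_orbit x)).integrable_of_hasCompactSupport
      χ.hasCompactSupport.smul_right
  rw [← ContinuousLinearMap.integral_comp_comm _ hint,
    ← integral_mul_left_eq_self (fun g => χ (q⁻¹ * g) • ρ.π g x) q]
  refine integral_congr_ae (.of_forall fun g => ?_)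
  simp

theorem BanachRep.IsUnitary.mul_norm_map_average_sub_sq_le {ρ : BanachRep.{u, v} G}
    (hρ : ρ.IsUnitary) {χ w : C_c(G, ℝ)} (hχ : 0 < ∫ g, χ g ∂μ) (hw : 0 < ∫ g, w g ∂μ)
    (hw0 : ∀ g, 0 ≤ w g) {q : G} (hwχ : ∀ g, w (q⁻¹ * g) ≤ χ g) (x : ρ.E) :
    (∫ g, w g ∂μ) * ‖ρ.π q (ρ.integrate μ (normalization μ w) x) -
        ρ.integrate μ (normalization μ χ) x‖ ^ 2 ≤
      (∫ g, χ g ∂μ) * (‖x‖ ^ 2 - ‖ρ.integrate μ (normalization μ χ) x‖ ^ 2) := by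
  set y := ρ.integrate μ (normalization μ χ) x
  have hwc : Continuous fun g => w (q⁻¹ * g) := w.continuous.comp (continuous_const_mul _)
  have hws : HasCompactSupport fun g => w (q⁻¹ * g) :=
    w.hasCompactSupport.comp_homeomorph (Homeomorph.mulLeft q⁻¹)
  have horbit := ρ.continuous_orbit x
  have hwint : ∫ g, w (q⁻¹ * g) ∂μ = ∫ g, w g ∂μ := integral_mul_left_eq_self (fun g => w g) q⁻¹
  have hvar_w := hρ.integral_mul_norm_sub_sq μ hwc hws (x := x)
    (m := ρ.π q (ρ.integrate μ (normalization μ w) x)) (by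
      rw [hwint, ← map_integral_smul_orbit, ← integral_smul_integrate_normalization μ ρ hw.ne',
        ContinuousLinearMap.map_smul_of_tower]) y
  have hvar_χ := hρ.integral_mul_norm_sub_sq μ (χ := fun g => χ g) χ.continuous
    χ.hasCompactSupport (x := x) (m := y)
    (integral_smul_integrate_normalization μ ρ hχ.ne' x) 0
  simp only [sub_zero, hρ.norm_map] at hvar_χ
  rw [integral_mul_const] at hvar_χ
  have hmono : ∫ g, w (q⁻¹ * g) * ‖ρ.π g x - y‖ ^ 2 ∂μ ≤ ∫ g, χ g * ‖ρ.π g x - y‖ ^ 2 ∂μ :=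
    integral_mono
      (Continuous.integrable_of_hasCompactSupport (by fun_prop) hws.mul_right)
      (Continuous.integrable_of_hasCompactSupport (by have := χ.continuous; fun_prop)
        χ.hasCompactSupport.mul_right)
      fun g => mul_le_mul_of_nonneg_right (hwχ g) (sq_nonneg _)
  have hnonneg : 0 ≤ ∫ g, w (q⁻¹ * g) *
      ‖ρ.π g x - ρ.π q (ρ.integrate μ (normalization μ w) x)‖ ^ 2 ∂μ :=
    integral_nonneg fun g => mul_nonneg (hw0 _) (sq_nonneg _)
  rw [hwint] at hvar_w
  linarith

theorem BanachRep.IsUnitary.norm_average_le {ρ : BanachRep.{u, v} G} (hρ : ρ.IsUnitary)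
    {χ w : C_c(G, ℝ)} (hχ : 0 < ∫ g, χ g ∂μ) (hw : 0 < ∫ g, w g ∂μ) (hw0 : ∀ g, 0 ≤ w g)
    {Q : Set G} (hwχ : ∀ q ∈ insert 1 Q, ∀ g, w (q⁻¹ * g) ≤ χ g) {δ : ℝ} (hδ : 0 < δ)
    (hconst : ρ.IsKazhdanConstant Q δ) (x : ρ.E) :
    ‖ρ.integrate μ (normalization μ χ) x‖ ≤ (1 + 2 / δ) * √((∫ g, χ g ∂μ) / (∫ g, w g ∂μ) *
      (‖x‖ ^ 2 - ‖ρ.integrate μ (normalization μ χ) x‖ ^ 2)) := by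
  set y := ρ.integrate μ (normalization μ χ) x
  set y₀ := ρ.integrate μ (normalization μ w) x
  set k := √((∫ g, χ g ∂μ) / (∫ g, w g ∂μ) * (‖x‖ ^ 2 - ‖y‖ ^ 2))
  have hclose : ∀ q ∈ insert 1 Q, ‖ρ.π q y₀ - y‖ ≤ k := fun q hq => by
    refine Real.le_sqrt_of_sq_le ?_
    rw [div_mul_eq_mul_div, le_div_iff₀' hw]
    exact hρ.mul_norm_map_average_sub_sq_le μ hχ hw hw0 (hwχ q hq) x
  have hclose_one : ‖y₀ - y‖ ≤ k := by simpa using hclose 1 (Set.mem_insert _ _)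
  have hy₀ : δ * ‖y₀‖ ≤ 2 * k := hconst y₀ _ (by positivity) fun q hq =>
    calc ‖ρ.π q y₀ - y₀‖ = ‖(ρ.π q y₀ - y) - (y₀ - y)‖ := by rw [sub_sub_sub_cancel_right]
      _ ≤ ‖ρ.π q y₀ - y‖ + ‖y₀ - y‖ := norm_sub_le _ _
      _ ≤ 2 * k := by linarith [hclose q (Set.mem_insert_of_mem _ hq)]
  calc ‖y‖ = ‖y₀ - (y₀ - y)‖ := by rw [sub_sub_cancel]
    _ ≤ ‖y₀‖ + ‖y₀ - y‖ := norm_sub_le _ _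
    _ ≤ 2 * k / δ + k := add_le_add ((le_div_iff₀' hδ).2 hy₀) hclose_one
    _ = (1 + 2 / δ) * k := by ring

end Average

section SpectralGap

theorem le_sqrt_mul_of_le_mul_sqrt {s t b d : ℝ} (ht : 0 ≤ t) (hst : s ≤ t) (hs : 0 ≤ s)
    (hd : 0 ≤ d) (h : s ≤ b * √(d * (t ^ 2 - s ^ 2))) :
    s ≤ √(b ^ 2 * d / (b ^ 2 * d + 1)) * t := by
  have hsq : s ^ 2 ≤ b ^ 2 * d * (t ^ 2 - s ^ 2) := by
    calc s ^ 2 ≤ (b * √(d * (t ^ 2 - s ^ 2))) ^ 2 := by gcongr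
      _ = b ^ 2 * d * (t ^ 2 - s ^ 2) := by
        rw [mul_pow, Real.sq_sqrt (mul_nonneg hd (by nlinarith))]
        ring
  rw [← Real.sqrt_sq ht, ← Real.sqrt_mul (by positivity)]
  refine Real.le_sqrt_of_sq_le ?_
  rw [div_mul_eq_mul_div, le_div_iff₀ (by positivity)]
  linarith

variable {G : Type u} [Group G] [TopologicalSpace G] [IsTopologicalGroup G]
  [LocallyCompactSpace G]

theorem exists_nonneg_bump {K : Set G} (hK : IsCompact K) :
    ∃ χ : C_c(G, ℝ), (∀ g ∈ K, χ g = 1) ∧ ∀ g, 0 ≤ χ g ∧ χ g ≤ 1 := by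
  obtain ⟨f, hf_one, -, hf_supp, hf_mem⟩ :=
    exists_continuous_one_zero_of_isCompact hK isClosed_empty (Set.disjoint_empty K)
  exact ⟨⟨f, hf_supp⟩, fun g hg => hf_one hg, hf_mem⟩

theorem exists_bump_dominating {Q : Set G} (hQ : IsCompact Q) {w : C_c(G, ℝ)}
    (hw : ∀ g, w g ≤ 1) :
    ∃ χ : C_c(G, ℝ), ∀ q ∈ Q, ∀ g, w (q⁻¹ * g) ≤ χ g := by
  obtain ⟨χ, hχ_one, hχ⟩ := exists_nonneg_bump (hQ.mul w.hasCompactSupport)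
  refine ⟨χ, fun q hq g => ?_⟩
  by_cases hg : q⁻¹ * g ∈ tsupport w
  · rw [hχ_one g ⟨q, hq, q⁻¹ * g, hg, by group⟩]
    exact hw _
  · rw [image_eq_zero_of_notMem_tsupport hg]
    exact (hχ g).1

variable [MeasurableSpace G] [BorelSpace G] (μ : Measure G) [μ.IsHaarMeasure]

theorem exists_nonneg_bump_integral_pos :
    ∃ w : C_c(G, ℝ), (∀ g, 0 ≤ w g ∧ w g ≤ 1) ∧ 0 < ∫ g, w g ∂μ := by
  obtain ⟨w, hw_one, hw⟩ := exists_nonneg_bump (isCompact_singleton (x := (1 : G)))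
  exact ⟨w, hw, w.continuous.integral_pos_of_hasCompactSupport_nonneg_nonzero w.hasCompactSupport
    (fun g => (hw g).1) (x := 1) (by rw [hw_one 1 rfl]; exact one_ne_zero)⟩

/-- If `‖π(χ) x‖` is close to `‖x‖`, the orbit of `x` is nearly constant on the support of `χ`, so
the average of `x` over a bump whose translates by `Q` stay below `χ` is nearly `Q`-invariant. -/
theorem exists_contracting_average {Q : Set G} (hQ : IsCompact Q) {δ : ℝ} (hδ : 0 < δ) :
    ∃ f : C_c(G, ℂ), ∫ g, f g ∂μ = 1 ∧ ∃ c : ℝ, 0 ≤ c ∧ c < 1 ∧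
      ∀ ρ : BanachRep.{u, v} G, ρ.IsUnitary → ρ.IsKazhdanConstant Q δ →
        ∀ x, ‖ρ.integrate μ f x‖ ≤ c * ‖x‖ := by
  obtain ⟨w, hw, hw_pos⟩ := exists_nonneg_bump_integral_pos μ
  obtain ⟨χ, hwχ⟩ := exists_bump_dominating (hQ.insert 1) fun g => (hw g).2
  have hχ_pos : 0 < ∫ g, χ g ∂μ := hw_pos.trans_le <| integral_mono
    (w.continuous.integrable_of_hasCompactSupport w.hasCompactSupport)
    (χ.continuous.integrable_of_hasCompactSupport χ.hasCompactSupport)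
    fun g => by simpa using hwχ 1 (Set.mem_insert _ _) g
  set d := (∫ g, χ g ∂μ) / ∫ g, w g ∂μ
  have hd : 0 ≤ d := by positivity
  refine ⟨normalization μ χ, integral_normalization μ hχ_pos.ne', _, Real.sqrt_nonneg _,
    (Real.sqrt_lt' one_pos).2 ?_, fun ρ hρ hconst x =>
      le_sqrt_mul_of_le_mul_sqrt (norm_nonneg _) ?_ (norm_nonneg _) hd
        (hρ.norm_average_le μ hχ_pos hw_pos (fun g => (hw g).1) hwχ hδ hconst x)⟩
  · rw [one_pow, div_lt_one (by positivity)]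
    exact lt_add_one _
  · have hsq := hρ.mul_norm_map_average_sub_sq_le μ hχ_pos hw_pos (fun g => (hw g).1)
      (hwχ 1 (Set.mem_insert _ _)) x
    have hnonneg := nonneg_of_mul_nonneg_right
      ((mul_nonneg hw_pos.le (sq_nonneg _)).trans hsq) hχ_pos
    exact (sq_le_sq₀ (norm_nonneg _) (norm_nonneg _)).1 (sub_nonneg.1 hnonneg)

theorem IsKazhdanPair.exists_spectral_gap {Q : Set G} {δ : ℝ} (hK : IsKazhdanPair.{u, v} Q δ)
    (hQ : IsCompact Q) (hδ : 0 < δ) :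
    ∃ f : C_c(G, ℂ), ∫ g, f g ∂μ = 1 ∧ ∃ c : ℝ, 0 ≤ c ∧ c < 1 ∧
      ∀ ρ : BanachRep.{u, v} G, ρ.IsUnitary → ∀ (x : ρ.E) (r : ℝ), 0 ≤ r →
        (∀ g ∈ Q, ‖ρ.π g x - x‖ ≤ r) →
        ∃ z ∈ ρ.invariants, ∀ m : ℕ, δ * ‖(ρ.integrate μ f ^ m) x - z‖ ≤ c ^ m * r := by
  obtain ⟨f, hf, c, hc, hc_lt, hcontract⟩ := exists_contracting_average.{u, v} μ hQ hδ
  refine ⟨f, hf, c, hc, hc_lt, fun ρ hρ x r hr hx => ?_⟩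
  obtain ⟨W, hW, hinv, hconst, hdecomp⟩ := hK.exists_decomposition hρ
  obtain ⟨z, hz, hxz, hnear⟩ := hdecomp x r hr hx
  refine ⟨z, hz, fun m => ?_⟩
  have hdecay : ‖(ρ.integrate μ f ^ m) (x - z)‖ ≤ c ^ m * ‖x - z‖ := by
    have hsub := norm_pow_apply_le hc
      (hcontract (ρ.subrep W hW hinv) (hρ.subrep hW hinv) hconst) m (⟨x - z, hxz⟩ : W)
    have hincl := BanachRep.map_integrate_pow μ (ρ := ρ.subrep W hW hinv) (ρ' := ρ) W.subtypeL
      (fun g x => rfl) f m (⟨x - z, hxz⟩ : W)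
    exact (congrArg norm hincl).symm.trans_le hsub
  rw [map_sub, BanachRep.integrate_pow_eq_self μ hf hz] at hdecay
  calc δ * ‖(ρ.integrate μ f ^ m) x - z‖ ≤ δ * (c ^ m * ‖x - z‖) := by gcongr
    _ = c ^ m * (δ * ‖x - z‖) := by ring
    _ ≤ c ^ m * r := by gcongr

end SpectralGap

/-! ### Gaussian kernels and cocycles of unitary representations -/

section Kernel

open scoped ComplexOrder Matrix

variable {X : Type v} {K : Matrix X X ℂ}

theorem posSemidef_of_inner {H : Type*} [NormedAddCommGroup H] [InnerProductSpace ℂ H]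
    (w : X → H) : (Matrix.of fun i j => inner ℂ (w i) (w j)).PosSemidef := by
  refine ⟨Matrix.ext fun i j => inner_conj_symm _ _, fun c => ?_⟩
  have hsum : (c.sum fun i a => c.sum fun j b =>
      star a * (Matrix.of fun i j => inner ℂ (w i) (w j)) i j * b) =
      inner ℂ (c.sum fun i a => a • w i) (c.sum fun i a => a • w i) := by
    simp only [Finsupp.sum]
    rw [sum_inner]
    refine Finset.sum_congr rfl fun i _ => ?_
    rw [inner_sum]
    refine Finset.sum_congr rfl fun j _ => ?_
    rw [inner_smul_left, inner_smul_right, Matrix.of_apply, RCLike.star_def]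
    ring
  rw [hsum, inner_self_eq_norm_sq_to_K]
  have hnonneg := Complex.zero_le_real.2 (sq_nonneg ‖c.sum fun i a => a • w i‖)
  rwa [Complex.ofReal_pow] at hnonneg

theorem posSemidef_map_pow (hK : K.PosSemidef) (k : ℕ) : (K.map (· ^ k)).PosSemidef := by
  induction k with
  | zero =>
    convert posSemidef_of_inner (X := X) (H := ℂ) fun _ => 1 using 1
    ext i j
    simp
  | succ k ih =>
    have hsucc : K.map (· ^ (k + 1)) = K.map (· ^ k) ⊙ K := by
      ext i j
      simp [pow_succ]
    rw [hsucc]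
    exact ih.hadamard hK

theorem posSemidef_of_tendsto {A : ℕ → Matrix X X ℂ} (hA : ∀ n, (A n).PosSemidef)
    (hlim : ∀ i j, Tendsto (fun n => A n i j) atTop (𝓝 (K i j))) : K.PosSemidef := by
  refine ⟨Matrix.ext fun i j => ?_, fun c => ?_⟩
  · exact tendsto_nhds_unique ((hlim j i).star.congr fun n => (hA n).isHermitian.apply i j)
      (hlim i j)
  · exact ge_of_tendsto' (f := fun n => c.sum fun i a => c.sum fun j b => star a * A n i j * b)
      (tendsto_finsetSum _ fun i _ => tendsto_finsetSum _ fun j _ =>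
        ((hlim i j).const_mul _).mul_const _) fun n => (hA n).2 c

theorem posSemidef_map_exp (hK : K.PosSemidef) : (K.map Complex.exp).PosSemidef := by
  refine posSemidef_of_tendsto
    (A := fun n => ∑ k ∈ Finset.range n, (k.factorial : ℂ)⁻¹ • K.map (· ^ k))
    (fun n => Matrix.posSemidef_sum _ fun k _ => (posSemidef_map_pow hK k).smul
      (inv_nonneg.2 (by exact_mod_cast Nat.zero_le _))) fun i j => ?_
  have hseries := (NormedSpace.expSeries_div_hasSum_exp (K i j)).tendsto_sum_nat
  rw [← Complex.exp_eq_exp_ℂ] at hseries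
  refine hseries.congr fun n => ?_
  rw [Matrix.sum_apply]
  exact Finset.sum_congr rfl fun k _ => by simp [div_eq_inv_mul]

/-- The Gaussian kernel `exp (-t ‖x - y‖²)`. -/
def gaussianKernel (H : Type v) [NormedAddCommGroup H] (t : ℝ) : Matrix H H ℂ :=
  Matrix.of fun x y => ((Real.exp (-(t * ‖x - y‖ ^ 2)) : ℝ) : ℂ)

/-- Expanding the square, the Gaussian kernel is the product of a rank-one kernel and the
exponential of the positive kernel `2 t Re ⟨x, y⟩`. -/
theorem posSemidef_gaussianKernel (H : Type v) [NormedAddCommGroup H] [InnerProductSpace ℂ H]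
    {t : ℝ} (ht : 0 ≤ t) : (gaussianKernel H t).PosSemidef := by
  have hrank := posSemidef_of_inner (X := H) (H := ℂ)
    fun x => ((Real.exp (-(t * ‖x‖ ^ 2)) : ℝ) : ℂ)
  have hinner := posSemidef_of_inner (X := H) (H := H) id
  have hexp := posSemidef_map_exp ((hinner.add hinner.transpose).smul
    (show (0 : ℂ) ≤ (t : ℂ) by exact_mod_cast ht))
  refine (congrArg Matrix.PosSemidef (Matrix.ext fun x y => ?_)).mpr (hrank.hadamard hexp)
  have hre : inner ℂ x y + inner ℂ y x = ((2 * (inner ℂ x y).re : ℝ) : ℂ) := by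
    rw [← inner_conj_symm y x, Complex.add_conj]
  simp only [gaussianKernel, Matrix.of_apply, Matrix.hadamard_apply, Matrix.map_apply,
    Matrix.smul_apply, Matrix.add_apply, Matrix.transpose_apply, id, hre, smul_eq_mul,
    RCLike.inner_apply, Complex.conj_ofReal]
  norm_cast
  rw [← Real.exp_add, ← Real.exp_add, norm_sub_sq (𝕜 := ℂ) x y, RCLike.re_to_complex]
  ring_nf

/-- The sesquilinear form defined by a kernel on finitely supported functions. -/
def kernelForm (K : Matrix X X ℂ) (c d : X →₀ ℂ) : ℂ :=
  c.sum fun i a => d.sum fun j b => star a * K i j * b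

theorem kernelForm_add_left (K : Matrix X X ℂ) (c d e : X →₀ ℂ) :
    kernelForm K (c + d) e = kernelForm K c e + kernelForm K d e := by
  unfold kernelForm
  rw [Finsupp.sum_add_index'] <;> simp [← Finsupp.sum_add, add_mul]

theorem kernelForm_add_right (K : Matrix X X ℂ) (c d e : X →₀ ℂ) :
    kernelForm K c (d + e) = kernelForm K c d + kernelForm K c e := by
  unfold kernelForm
  rw [← Finsupp.sum_add]
  refine Finsupp.sum_congr fun i _ => ?_
  rw [Finsupp.sum_add_index'] <;> simp [mul_add]

theorem kernelForm_smul_left (K : Matrix X X ℂ) (r : ℂ) (c d : X →₀ ℂ) :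
    kernelForm K (r • c) d = (starRingEnd ℂ) r * kernelForm K c d := by
  unfold kernelForm
  rw [Finsupp.sum_smul_index] <;> simp [Finsupp.mul_sum, mul_assoc]

theorem kernelForm_single (K : Matrix X X ℂ) (x y : X) (a b : ℂ) :
    kernelForm K (Finsupp.single x a) (Finsupp.single y b) = star a * K x y * b := by
  unfold kernelForm
  rw [Finsupp.sum_single_index, Finsupp.sum_single_index] <;> simp

theorem kernelForm_single_sub_single (K : Matrix X X ℂ) (x y : X) :
    kernelForm K (Finsupp.single x 1 - Finsupp.single y 1)
      (Finsupp.single x 1 - Finsupp.single y 1) = K x x - K x y - K y x + K y y := by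
  rw [sub_eq_add_neg, ← Finsupp.single_neg]
  simp only [kernelForm_add_left, kernelForm_add_right, kernelForm_single, star_neg, star_one]
  ring

theorem kernelForm_mapDomain {σ : X → X} (hσ : ∀ x y, K (σ x) (σ y) = K x y) (c d : X →₀ ℂ) :
    kernelForm K (c.mapDomain σ) (d.mapDomain σ) = kernelForm K c d := by
  unfold kernelForm
  rw [Finsupp.sum_mapDomain_index (by simp) (by simp [← Finsupp.sum_add, add_mul])]
  refine Finsupp.sum_congr fun i _ => ?_
  rw [Finsupp.sum_mapDomain_index (by simp) (by simp [mul_add])]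
  simp only [hσ]

theorem exists_kernel_seminorm (hK : K.PosSemidef) :
    ∃ p : Seminorm ℂ (X →₀ ℂ), (∀ c, p c * p c = (kernelForm K c c).re) ∧
      ∀ x y, p (x + y) * p (x + y) + p (x - y) * p (x - y) = 2 * (p x * p x + p y * p y) := by
  let core : PreInnerProductSpace.Core ℂ (X →₀ ℂ) :=
    { inner := kernelForm K
      conj_inner_symm := fun c d => by
        unfold kernelForm
        rw [Finsupp.sum_comm]
        simp only [map_finsuppSum]
        refine Finsupp.sum_congr fun i _ => Finsupp.sum_congr fun j _ => ?_
        rw [← hK.isHermitian.apply i j]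
        simp only [RCLike.star_def, map_mul, Complex.conj_conj]
        ring
      re_inner_nonneg := fun c => (Complex.le_def.1 (hK.2 c)).1
      add_left := kernelForm_add_left K
      smul_left := fun c d r => kernelForm_smul_left K r c d }
  let _ : SeminormedAddCommGroup (X →₀ ℂ) :=
    InnerProductSpace.Core.toSeminormedAddCommGroup (𝕜 := ℂ)
  let _ : InnerProductSpace ℂ (X →₀ ℂ) := .ofCore core
  refine ⟨normSeminorm ℂ (X →₀ ℂ), fun c => (inner_self_eq_norm_mul_norm (𝕜 := ℂ) c).symm,
    fun x y => ?_⟩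
  simp only [coe_normSeminorm, ← pow_two]
  exact parallelogram_law_with_norm ℂ x y

variable {G : Type u} [Group G] [TopologicalSpace G] [MulAction G X]

theorem tendsto_kernel_seminorm_sub {p : Seminorm ℂ (X →₀ ℂ)} (hK : K.PosSemidef)
    (hp : ∀ c, p c * p c = (kernelForm K c c).re)
    (hinv : ∀ (g : G) (x y : X), K (g • x) (g • y) = K x y)
    (hc : ∀ x, Continuous fun g : G => K (g • x) x) (c : X →₀ ℂ) :
    Tendsto (fun g : G => p (c.mapDomain (g • ·) - c)) (𝓝 1) (𝓝 0) := by
  induction c using Finsupp.induction_linear with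
  | zero => simp
  | add c d hc hd =>
    refine squeeze_zero (fun g => apply_nonneg p _) (fun g => ?_) (by simpa using hc.add hd)
    rw [Finsupp.mapDomain_add, add_sub_add_comm]
    exact map_add_le_add p _ _
  | single x a =>
    have hp_single : ∀ g : G,
        p ((Finsupp.single x a).mapDomain (g • ·) - Finsupp.single x a) =
        ‖a‖ * √(K x x - K (g • x) x - star (K (g • x) x) + K x x).re := fun g => by
      have hscale : (Finsupp.single x a).mapDomain (g • ·) - Finsupp.single x a =
          a • (Finsupp.single (g • x) 1 - Finsupp.single x 1) := by
        simp [smul_sub]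
      have hsq := hp (Finsupp.single (g • x) 1 - Finsupp.single x 1)
      rw [kernelForm_single_sub_single, hinv, ← hK.isHermitian.apply x (g • x)] at hsq
      rw [hscale, map_smul_eq_mul, ← hsq, Real.sqrt_mul_self (apply_nonneg p _)]
    have hcont : Continuous fun g : G =>
        ‖a‖ * √(K x x - K (g • x) x - star (K (g • x) x) + K x x).re := by
      have := Complex.continuous_re.comp (hc x)
      simp only [Complex.add_re, Complex.sub_re, RCLike.star_def, Complex.conj_re]
      fun_prop
    simp only [hp_single]
    simpa using hcont.tendsto 1

variable [IsTopologicalGroup G]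

theorem exists_unitary_of_kernel (hK : K.PosSemidef)
    (hinv : ∀ (g : G) (x y : X), K (g • x) (g • y) = K x y)
    (hc : ∀ x, Continuous fun g : G => K (g • x) x) :
    ∃ ρ : BanachRep.{u, v} G, ρ.IsUnitary ∧
      ∃ Φ : X → ρ.E, (∀ (g : G) x, Φ (g • x) = ρ.π g (Φ x)) ∧
        ∀ x y, ‖Φ x - Φ y‖ ^ 2 = (K x x - K x y - K y x + K y y).re := by
  obtain ⟨p, hp, hpar⟩ := exists_kernel_seminorm hK
  let π : G →* ((X →₀ ℂ) →ₗ[ℂ] (X →₀ ℂ)) :=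
    { toFun := fun g => Finsupp.lmapDomain ℂ ℂ (g • ·)
      map_one' := by simp only [one_smul]; exact Finsupp.lmapDomain_id ℂ ℂ
      map_mul' := fun g h => by simp only [mul_smul]; exact Finsupp.lmapDomain_comp ℂ ℂ _ _ }
  have hp_inv : ∀ g c, p (π g c) = p c := fun g c => by
    refine (mul_self_inj (apply_nonneg p _) (apply_nonneg p _)).1 ?_
    rw [hp, hp]
    exact congrArg Complex.re (kernelForm_mapDomain (hinv g) c c)
  obtain ⟨ρ, hρ, T, hT, hTπ⟩ := exists_unitary_of_seminorm p hpar π hp_inv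
    (tendsto_kernel_seminorm_sub hK hp hinv hc)
  refine ⟨ρ, hρ, fun x => T (Finsupp.single x 1), fun g x => ?_, fun x y => ?_⟩
  · rw [← hTπ]
    exact congrArg T Finsupp.mapDomain_single.symm
  · rw [← map_sub, hT, pow_two, hp, kernelForm_single_sub_single]

end Kernel

section Cocycle

variable {G : Type u} [Group G] [TopologicalSpace G]

/-- A continuous cocycle of a representation. -/
structure BanachRep.IsCocycle (ρ : BanachRep.{u, v} G) (b : G → ρ.E) : Prop where
  continuous : Continuous b
  map_mul : ∀ g h, b (g * h) = b g + ρ.π g (b h)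

/-- The displacement `b(g) + π(g) x - x` of `x` under the affine action with linear part `ρ` and
translation part `b`. As a function of `g` it is a cocycle cohomologous to `b`. -/
def BanachRep.displacement (ρ : BanachRep.{u, v} G) (b : G → ρ.E) (x : ρ.E) (g : G) : ρ.E :=
  b g + ρ.π g x - x

namespace BanachRep.IsCocycle

variable {ρ : BanachRep.{u, v} G} {b : G → ρ.E}

theorem map_one (hb : ρ.IsCocycle b) : b 1 = 0 := by
  simpa using hb.map_mul 1 1

/-- The affine action `x ↦ b(g) + π(g) x` defined by a cocycle. -/
abbrev mulAction (hb : ρ.IsCocycle b) : MulAction G ρ.E where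
  smul g x := b g + ρ.π g x
  one_smul x := show b 1 + ρ.π 1 x = x by simp [hb.map_one]
  mul_smul g h x := show b (g * h) + ρ.π (g * h) x = b g + ρ.π g (b h + ρ.π h x) by
    simp [hb.map_mul, add_assoc]

end BanachRep.IsCocycle

section Circumcenter

variable {ι : Type*} [Nonempty ι] {H : Type*} [NormedAddCommGroup H] [InnerProductSpace ℝ H]
  {b : ι → H}

/-- The squared circumradius of a family of vectors. -/
def sqCircumradius (b : ι → H) : ℝ :=
  sInf {r | ∃ x, ∀ i, ‖x - b i‖ ^ 2 ≤ r}

theorem norm_sub_sq_le_of_sqCircumradius {x y : H} {r s : ℝ} (hx : ∀ i, ‖x - b i‖ ^ 2 ≤ r)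
    (hy : ∀ i, ‖y - b i‖ ^ 2 ≤ s) :
    ‖x - y‖ ^ 2 ≤ 2 * (r - sqCircumradius b) + 2 * (s - sqCircumradius b) := by
  have hmidpoint : ∀ w, ‖x - y‖ ^ 2 =
      2 * ‖x - w‖ ^ 2 + 2 * ‖y - w‖ ^ 2 - 4 * ‖(1 / 2 : ℝ) • (x + y) - w‖ ^ 2 := fun w => by
    have hpar := parallelogram_law_with_norm ℝ (x - w) (y - w)
    have htwice : x - w + (y - w) = (2 : ℝ) • ((1 / 2 : ℝ) • (x + y) - w) := by module
    rw [htwice, norm_smul, sub_sub_sub_cancel_right, Real.norm_two, mul_pow] at hpar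
    linarith
  have hbdd : BddBelow {r | ∃ x, ∀ i, ‖x - b i‖ ^ 2 ≤ r} :=
    ⟨0, fun r ⟨x, hx⟩ => (sq_nonneg _).trans (hx (Classical.arbitrary ι))⟩
  have hle : sqCircumradius b ≤ (2 * r + 2 * s - ‖x - y‖ ^ 2) / 4 :=
    csInf_le hbdd ⟨(1 / 2 : ℝ) • (x + y), fun i => by linarith [hmidpoint (b i), hx i, hy i]⟩
  linarith

theorem exists_circumcenter [CompleteSpace H] {R : ℝ} (hR : ∀ i, ‖b i‖ ≤ R) :
    ∃ y, ∀ i, ‖y - b i‖ ^ 2 ≤ sqCircumradius b := by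
  have hne : {r | ∃ x, ∀ i, ‖x - b i‖ ^ 2 ≤ r}.Nonempty :=
    ⟨R ^ 2, 0, fun i => by simpa using pow_le_pow_left₀ (norm_nonneg _) (hR i) 2⟩
  have happrox : ∀ n : ℕ, ∃ x, ∀ i, ‖x - b i‖ ^ 2 ≤ sqCircumradius b + 1 / ((n : ℝ) + 1) :=
    fun n => by
      obtain ⟨r, ⟨x, hx⟩, hr⟩ := exists_lt_of_csInf_lt hne
        (lt_add_of_pos_right (sqCircumradius b) (by positivity : 0 < 1 / ((n : ℝ) + 1)))
      exact ⟨x, fun i => (hx i).trans hr.le⟩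
  choose x hx using happrox
  have hcauchy : CauchySeq x := by
    refine Metric.cauchySeq_iff'.2 fun η hη => ?_
    obtain ⟨N, hN⟩ := exists_nat_one_div_lt (show 0 < η ^ 2 / 4 by positivity)
    refine ⟨N, fun n hn => ?_⟩
    have hdist := norm_sub_sq_le_of_sqCircumradius (hx n) (hx N)
    have hmono : 1 / ((n : ℝ) + 1) ≤ 1 / ((N : ℝ) + 1) := by gcongr
    rw [dist_eq_norm]
    refine lt_of_pow_lt_pow_left₀ 2 hη.le ?_
    linarith
  obtain ⟨y, hy⟩ := cauchySeq_tendsto_of_complete hcauchy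
  refine ⟨y, fun i => le_of_tendsto_of_tendsto' ((hy.sub_const _).norm.pow 2) ?_
    fun n => hx n i⟩
  simpa using (tendsto_one_div_add_atTop_nhds_zero_nat (𝕜 := ℝ)).const_add (sqCircumradius b)

end Circumcenter

theorem BanachRep.IsUnitary.exists_displacement_eq_zero_of_bounded {ρ : BanachRep.{u, v} G}
    (hρ : ρ.IsUnitary) {b : G → ρ.E} (hb : ρ.IsCocycle b) {R : ℝ} (hR : ∀ g, ‖b g‖ ≤ R) :
    ∃ x, ∀ g, ρ.displacement b x g = 0 := by
  let _ : InnerProductSpace ℝ ρ.E := InnerProductSpace.ofNorm ℝ hρ.parallelogram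
  obtain ⟨y, hy⟩ := exists_circumcenter hR
  refine ⟨y, fun g => ?_⟩
  have hmoved : ∀ k, ‖b g + ρ.π g y - b k‖ ^ 2 ≤ sqCircumradius b := fun k => by
    have hk : b k = b g + ρ.π g (b (g⁻¹ * k)) := by rw [← hb.map_mul, mul_inv_cancel_left]
    rw [hk, add_sub_add_left_eq_sub, ← map_sub, hρ.norm_map]
    exact hy _
  have hsq := norm_sub_sq_le_of_sqCircumradius hmoved hy
  rw [sub_self, mul_zero, add_zero] at hsq
  exact norm_eq_zero.1 (pow_eq_zero_iff two_ne_zero |>.1 (hsq.antisymm (sq_nonneg _)))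

variable [IsTopologicalGroup G]

theorem BanachRep.IsUnitary.exists_gaussian_vector {ρ : BanachRep.{u, v} G} (hρ : ρ.IsUnitary)
    {b : G → ρ.E} (hb : ρ.IsCocycle b) {t : ℝ} (ht : 0 ≤ t) :
    ∃ ρ' : BanachRep.{u, v} G, ρ'.IsUnitary ∧
      ∃ ξ, ∀ g, ‖ρ'.π g ξ - ξ‖ ^ 2 = 2 * (1 - Real.exp (-(t * ‖b g‖ ^ 2))) := by
  let _ : InnerProductSpace ℂ ρ.E := InnerProductSpace.ofNorm ℂ hρ.parallelogram
  let _ : MulAction G ρ.E := hb.mulAction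
  have hsmul : ∀ (g : G) (x : ρ.E), g • x = b g + ρ.π g x := fun _ _ => rfl
  obtain ⟨ρ', hρ', Φ, hΦ, hΦ_norm⟩ := exists_unitary_of_kernel (G := G)
    (posSemidef_gaussianKernel ρ.E ht)
    (fun g x y => by
      simp only [gaussianKernel, Matrix.of_apply, hsmul, add_sub_add_left_eq_sub, ← map_sub,
        hρ.norm_map])
    (fun x => by
      have := hb.continuous
      have := ρ.continuous_orbit x
      simp only [gaussianKernel, Matrix.of_apply, hsmul]
      fun_prop)
  refine ⟨ρ', hρ', Φ 0, fun g => ?_⟩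
  rw [← hΦ, hΦ_norm, hsmul]
  simp only [gaussianKernel, Matrix.of_apply, map_zero, add_zero, sub_zero, zero_sub, norm_neg,
    norm_zero, Complex.add_re, Complex.sub_re, Complex.ofReal_re]
  norm_num
  ring

theorem IsKazhdanPair.exists_norm_cocycle_le {Q : Set G} {δ : ℝ} (hK : IsKazhdanPair.{u, v} Q δ)
    (hQ : IsCompact Q) (hδ : 0 < δ) {ρ : BanachRep.{u, v} G} (hρ : ρ.IsUnitary) {b : G → ρ.E}
    (hb : ρ.IsCocycle b) : ∃ R : ℝ, ∀ g, ‖b g‖ ≤ R := by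
  obtain ⟨B, hB⟩ := hQ.exists_bound_of_continuousOn hb.continuous.continuousOn
  obtain ⟨t, ht, htB⟩ : ∃ t : ℝ, 0 < t ∧ t * B ^ 2 ≤ δ ^ 2 / 32 :=
    ⟨δ ^ 2 / (32 * (B ^ 2 + 1)), by positivity, by
      rw [div_mul_eq_mul_div, div_le_div_iff₀ (by positivity) (by norm_num)]
      nlinarith [sq_nonneg δ]⟩
  obtain ⟨ρ', hρ', ξ, hξ⟩ := hρ.exists_gaussian_vector hb ht.le
  have hsmall : ∀ g ∈ Q, ‖ρ'.π g ξ - ξ‖ ≤ δ / 4 := fun g hg => by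
    refine le_of_sq_le_sq ?_ (by positivity)
    have hbg : t * ‖b g‖ ^ 2 ≤ t * B ^ 2 := by gcongr; exact hB g hg
    rw [hξ]
    linarith [Real.add_one_le_exp (-(t * ‖b g‖ ^ 2))]
  obtain ⟨z, hz, hξz⟩ := hK.exists_invariant_near hρ' (by positivity) hsmall
  have hnear : ‖ξ - z‖ ≤ 1 / 4 := by
    rw [← le_div_iff₀' hδ] at hξz
    exact hξz.trans_eq (by field_simp)
  have hmove : ∀ g, ‖ρ'.π g ξ - ξ‖ ≤ 1 / 2 := fun g =>
    calc ‖ρ'.π g ξ - ξ‖ = ‖ρ'.π g (ξ - z) - (ξ - z)‖ := by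
          rw [map_sub, hz g, sub_sub_sub_cancel_right]
      _ ≤ ‖ρ'.π g (ξ - z)‖ + ‖ξ - z‖ := norm_sub_le _ _
      _ ≤ 1 / 2 := by rw [hρ'.norm_map]; linarith
  refine ⟨√(1 / t), fun g => Real.le_sqrt_of_sq_le ((le_div_iff₀' ht).2 ?_)⟩
  have hexp : 7 / 8 ≤ Real.exp (-(t * ‖b g‖ ^ 2)) := by
    nlinarith [hξ g, pow_le_pow_left₀ (norm_nonneg _) (hmove g) 2]
  rw [Real.exp_neg, le_inv_comm₀ (by norm_num) (Real.exp_pos _)] at hexp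
  linarith [Real.add_one_le_exp (t * ‖b g‖ ^ 2)]

theorem IsKazhdanPair.exists_displacement_eq_zero {Q : Set G} {δ : ℝ}
    (hK : IsKazhdanPair.{u, v} Q δ) (hQ : IsCompact Q) (hδ : 0 < δ) {ρ : BanachRep.{u, v} G}
    (hρ : ρ.IsUnitary) {b : G → ρ.E} (hb : ρ.IsCocycle b) :
    ∃ x, ∀ g, ρ.displacement b x g = 0 := by
  obtain ⟨R, hR⟩ := hK.exists_norm_cocycle_le hQ hδ hρ hb
  exact hρ.exists_displacement_eq_zero_of_bounded hb hR

end Cocycle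

/-! ### Affine actions and their means -/

section Displacement

variable {G : Type u} [Group G] [TopologicalSpace G]

theorem BanachRep.isCocycle_zero (ρ : BanachRep.{u, v} G) : ρ.IsCocycle 0 where
  continuous := continuous_zero
  map_mul g h := by simp

theorem BanachRep.displacement_zero_left (ρ : BanachRep.{u, v} G) (x : ρ.E) (g : G) :
    ρ.displacement 0 x g = ρ.π g x - x := by
  rw [BanachRep.displacement, Pi.zero_apply, zero_add]

theorem BanachRep.displacement_zero_right (ρ : BanachRep.{u, v} G) (b : G → ρ.E) :
    ρ.displacement b 0 = b := by
  funext g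
  simp [BanachRep.displacement]

theorem BanachRep.displacement_displacement (ρ : BanachRep.{u, v} G) (b : G → ρ.E) (x y : ρ.E) :
    ρ.displacement (ρ.displacement b x) y = ρ.displacement b (x + y) := by
  funext g
  simp only [BanachRep.displacement, map_add]
  abel

theorem BanachRep.displacement_smul (ρ : BanachRep.{u, v} G) (b : G → ρ.E) (t : ℂ) (x : ρ.E)
    (g : G) : ρ.displacement (t • b) (t • x) g = t • ρ.displacement b x g := by
  simp only [BanachRep.displacement, Pi.smul_apply, map_smul, smul_add, smul_sub]

theorem BanachRep.map_displacement {ρ τ : BanachRep.{u, v} G} (T : ρ.E →L[ℂ] τ.E)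
    (hT : ∀ g x, T (ρ.π g x) = τ.π g (T x)) (b : G → ρ.E) (x : ρ.E) (g : G) :
    T (ρ.displacement b x g) = τ.displacement (fun g => T (b g)) (T x) g := by
  simp only [BanachRep.displacement, map_add, map_sub, hT]

variable {ρ : BanachRep.{u, v} G} {b : G → ρ.E}

theorem BanachRep.IsCocycle.displacement (hb : ρ.IsCocycle b) (x : ρ.E) :
    ρ.IsCocycle (ρ.displacement b x) where
  continuous := (hb.continuous.add (ρ.continuous_orbit x)).sub continuous_const
  map_mul g h := by
    simp only [BanachRep.displacement, hb.map_mul, _root_.map_mul, mul_apply_eq_comp, map_add,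
      map_sub]
    abel

theorem BanachRep.IsCocycle.smul (hb : ρ.IsCocycle b) (t : ℂ) : ρ.IsCocycle (t • b) where
  continuous := hb.continuous.const_smul t
  map_mul g h := by simp only [Pi.smul_apply, hb.map_mul, smul_add, map_smul]

theorem BanachRep.IsCocycle.map {τ : BanachRep.{u, v} G} (hb : ρ.IsCocycle b)
    (T : ρ.E →L[ℂ] τ.E) (hT : ∀ g x, T (ρ.π g x) = τ.π g (T x)) :
    τ.IsCocycle fun g => T (b g) where
  continuous := T.continuous.comp hb.continuous
  map_mul g h := by rw [hb.map_mul, map_add, hT]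

theorem BanachRep.IsCocycle.norm_le_of_mem_pow (hb : ρ.IsCocycle b) {S : Set G} {A M : ℝ}
    (hA : 1 ≤ A) (hπ : ∀ s ∈ S, ‖ρ.π s‖ ≤ A) (hM : ∀ s ∈ S, ‖b s‖ ≤ M) (hM0 : 0 ≤ M) {n : ℕ}
    {g : G} (hg : g ∈ S ^ n) : ‖b g‖ ≤ n * A ^ n * M := by
  induction n generalizing g with
  | zero =>
    rw [pow_zero, Set.mem_one] at hg
    simp [hg, hb.map_one]
  | succ n ih =>
    rw [pow_succ'] at hg
    obtain ⟨s, hs, h, hh, rfl⟩ := hg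
    have hM_le : M ≤ A ^ (n + 1) * M := le_mul_of_one_le_left hM0 (one_le_pow₀ hA)
    calc ‖b (s * h)‖ = ‖b s + ρ.π s (b h)‖ := by rw [hb.map_mul]
      _ ≤ ‖b s‖ + ‖ρ.π s (b h)‖ := norm_add_le _ _
      _ ≤ M + A * (n * A ^ n * M) := by
        refine add_le_add (hM s hs) (((ρ.π s).le_of_opNorm_le (hπ s hs) _).trans ?_)
        exact mul_le_mul_of_nonneg_left (ih hh) (by linarith)
      _ ≤ A ^ (n + 1) * M + A * (n * A ^ n * M) := by linarith
      _ = (n + 1 : ℕ) * A ^ (n + 1) * M := by rw [pow_succ]; push_cast; ring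

theorem IsCompactGeneratingSet.eq_zero_of_isCocycle {S : Set G} (hS : IsCompactGeneratingSet S)
    (hb : ρ.IsCocycle b) (h : ∀ s ∈ S, b s = 0) (g : G) : b g = 0 := by
  obtain ⟨n, hn⟩ := hS.exists_mem_pow g
  induction n generalizing g with
  | zero =>
    rw [pow_zero, Set.mem_one] at hn
    rw [hn, hb.map_one]
  | succ n ih =>
    rw [pow_succ'] at hn
    obtain ⟨s, hs, k, hk, rfl⟩ := hn
    change b (s * k) = 0
    rw [hb.map_mul, h s hs, ih k hk, map_zero, add_zero]

variable [IsTopologicalGroup G] [T2Space G] [LocallyCompactSpace G]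

theorem IsCompactGeneratingSet.exists_cocycle_bound {S : Set G} (hS : IsCompactGeneratingSet S)
    {K : Set G} (hK : IsCompact K) {A : ℝ} (hA : 1 ≤ A) :
    ∃ C : ℝ, 0 ≤ C ∧ ∀ (ρ : BanachRep.{u, v} G), (∀ s ∈ S, ‖ρ.π s‖ ≤ A) → ∀ b, ρ.IsCocycle b →
      ∀ M : ℝ, 0 ≤ M → (∀ s ∈ S, ‖b s‖ ≤ M) → ∀ g ∈ K, ‖b g‖ ≤ C * M := by
  obtain ⟨N, hN⟩ := hS.wordLength_bounded hK
  refine ⟨N * A ^ N, by positivity, fun ρ hπ b hb M hM0 hM g hg => ?_⟩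
  have hmem : g ∈ S ^ wordLength S g := Nat.sInf_mem (hS.exists_mem_pow g)
  have hpow : A ^ wordLength S g ≤ A ^ N := pow_le_pow_right₀ hA (hN g hg)
  refine (hb.norm_le_of_mem_pow hA hπ hM hM0 hmem).trans ?_
  gcongr
  exact hN g hg

end Displacement

section Average

variable {G : Type u} [MeasurableSpace G] (μ : Measure G)

theorem norm_integral_smul_le {E : Type v} [NormedAddCommGroup E] [NormedSpace ℂ E] {f : G → ℂ}
    (hf : Integrable f μ) {b : G → E} {C : ℝ} (hC : ∀ g, f g ≠ 0 → ‖b g‖ ≤ C) :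
    ‖∫ g, f g • b g ∂μ‖ ≤ (∫ g, ‖f g‖ ∂μ) * C := by
  rw [← integral_mul_const]
  refine norm_integral_le_of_norm_le (hf.norm.mul_const _) (.of_forall fun g => ?_)
  by_cases hg : f g = 0
  · simp [hg]
  · rw [norm_smul]
    exact mul_le_mul_of_nonneg_left (hC g hg) (norm_nonneg _)

variable [TopologicalSpace G]

section Integrable

variable [BorelSpace G] [IsFiniteMeasureOnCompacts μ]

theorem integrable_of_compactlySupported (f : C_c(G, ℂ)) : Integrable f μ :=
  f.continuous.integrable_of_hasCompactSupport f.hasCompactSupport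

theorem integrable_smul_of_continuous {E : Type v} [NormedAddCommGroup E] [NormedSpace ℂ E]
    (f : C_c(G, ℂ)) {b : G → E} (hb : Continuous b) : Integrable (fun g => f g • b g) μ :=
  (f.continuous.smul hb).integrable_of_hasCompactSupport f.hasCompactSupport.smul_right

end Integrable

variable [Group G]

/-- The mean, with weight `f`, of the orbit of `x` under the affine action with linear part `ρ` and
translation part `b`. -/
def BanachRep.affineMean (ρ : BanachRep.{u, v} G) (b : G → ρ.E) (f : C_c(G, ℂ)) (x : ρ.E) : ρ.E :=
  ∫ g, f g • (b g + ρ.π g x) ∂μ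

theorem BanachRep.affineMean_smul (ρ : BanachRep.{u, v} G) (b : G → ρ.E) (f : C_c(G, ℂ)) (t : ℂ)
    (x : ρ.E) : ρ.affineMean μ (t • b) f (t • x) = t • ρ.affineMean μ b f x := by
  simp only [BanachRep.affineMean, Pi.smul_apply, map_smul, ← smul_add, smul_comm _ t]
  exact integral_smul t _

variable [BorelSpace G] [μ.IsHaarMeasure]

theorem BanachRep.IsCocycle.integrable_affine_orbit {ρ : BanachRep.{u, v} G} {b : G → ρ.E}
    (hb : ρ.IsCocycle b) (f : C_c(G, ℂ)) (x : ρ.E) :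
    Integrable (fun g => f g • (b g + ρ.π g x)) μ :=
  integrable_smul_of_continuous μ f (hb.continuous.add (ρ.continuous_orbit x))

variable {ρ : BanachRep.{u, v} G} {b : G → ρ.E}

theorem BanachRep.IsCocycle.affineMean_sub_self (hb : ρ.IsCocycle b) {f : C_c(G, ℂ)}
    (hf : ∫ g, f g ∂μ = 1) (x : ρ.E) :
    ρ.affineMean μ b f x - x = ∫ g, f g • ρ.displacement b x g ∂μ := by
  simp only [BanachRep.displacement, smul_sub]
  rw [integral_sub (hb.integrable_affine_orbit μ f x)
    ((integrable_of_compactlySupported μ f).smul_const x), integral_smul_const, hf, one_smul,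
    BanachRep.affineMean]

theorem BanachRep.IsCocycle.affineMean_displacement_add (hb : ρ.IsCocycle b) {f : C_c(G, ℂ)}
    (hf : ∫ g, f g ∂μ = 1) (a x : ρ.E) :
    ρ.affineMean μ (ρ.displacement b a) f x + a = ρ.affineMean μ b f (x + a) := by
  have hsplit : ρ.affineMean μ (ρ.displacement b a) f x
      = ∫ g, (f g • (b g + ρ.π g (x + a)) - f g • a) ∂μ := by
    refine integral_congr_ae (.of_forall fun g => ?_)
    simp only [BanachRep.displacement, map_add, ← smul_sub]
    congr 1
    abel
  rw [hsplit, integral_sub (hb.integrable_affine_orbit μ f _)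
    ((integrable_of_compactlySupported μ f).smul_const a), integral_smul_const, hf, one_smul,
    sub_add_cancel, BanachRep.affineMean]

theorem BanachRep.IsCocycle.iterate_affineMean_displacement_add (hb : ρ.IsCocycle b)
    {f : C_c(G, ℂ)} (hf : ∫ g, f g ∂μ = 1) (a x : ρ.E) (m : ℕ) :
    (ρ.affineMean μ (ρ.displacement b a) f)^[m] x + a = (ρ.affineMean μ b f)^[m] (x + a) :=
  Function.Semiconj.iterate_right (f := (· + a)) (hb.affineMean_displacement_add μ hf a) m x

theorem BanachRep.IsCocycle.map_affineMean {τ : BanachRep.{u, v} G} (hb : ρ.IsCocycle b)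
    (T : ρ.E →L[ℂ] τ.E) (hT : ∀ g x, T (ρ.π g x) = τ.π g (T x)) (f : C_c(G, ℂ)) (x : ρ.E) :
    T (ρ.affineMean μ b f x) = τ.affineMean μ (fun g => T (b g)) f (T x) := by
  simp only [BanachRep.affineMean,
    ← ContinuousLinearMap.integral_comp_comm _ (hb.integrable_affine_orbit μ f x), map_smul,
    map_add, hT]

theorem BanachRep.IsCocycle.map_iterate_affineMean {τ : BanachRep.{u, v} G} (hb : ρ.IsCocycle b)
    (T : ρ.E →L[ℂ] τ.E) (hT : ∀ g x, T (ρ.π g x) = τ.π g (T x)) (f : C_c(G, ℂ)) (m : ℕ)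
    (x : ρ.E) :
    T ((ρ.affineMean μ b f)^[m] x) = (τ.affineMean μ (fun g => T (b g)) f)^[m] (T x) :=
  Function.Semiconj.iterate_right (f := T) (hb.map_affineMean μ T hT f) m x

variable [IsTopologicalGroup G]

theorem integrable_translate_sub (f : C_c(G, ℂ)) (g : G) :
    Integrable (fun k => f (g⁻¹ * k) - f k) μ := by
  have := f.continuous
  exact Continuous.integrable_of_hasCompactSupport (by fun_prop)
    ((f.hasCompactSupport.comp_homeomorph (Homeomorph.mulLeft g⁻¹)).sub f.hasCompactSupport)

theorem BanachRep.affineMean_zero (ρ : BanachRep.{u, v} G) (f : C_c(G, ℂ)) :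
    ρ.affineMean μ 0 f = ρ.integrate μ f := by
  funext x
  simp only [BanachRep.affineMean, BanachRep.integrate_apply, Pi.zero_apply, zero_add]

theorem BanachRep.IsCocycle.displacement_affineMean (hb : ρ.IsCocycle b) {f : C_c(G, ℂ)}
    (hf : ∫ g, f g ∂μ = 1) (x : ρ.E) (g : G) :
    ρ.displacement b (ρ.affineMean μ b f x) g
      = ∫ k, (f (g⁻¹ * k) - f k) • (b k + ρ.π k x) ∂μ := by
  have horbit := hb.integrable_affine_orbit μ f x
  have htranslate : Integrable (fun k => f (g⁻¹ * k) • (b k + ρ.π k x)) μ :=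
    ((f.continuous.comp (continuous_const_mul g⁻¹)).smul
      (hb.continuous.add (ρ.continuous_orbit x))).integrable_of_hasCompactSupport
      (f.hasCompactSupport.comp_homeomorph (Homeomorph.mulLeft g⁻¹)).smul_right
  have hmove : b g + ρ.π g (ρ.affineMean μ b f x)
      = ∫ k, f (g⁻¹ * k) • (b k + ρ.π k x) ∂μ := by
    have hconst : b g = ∫ k, f k • b g ∂μ := by rw [integral_smul_const, hf, one_smul]
    rw [← integral_mul_left_eq_self (fun k => f (g⁻¹ * k) • (b k + ρ.π k x)) g,
      BanachRep.affineMean, ← ContinuousLinearMap.integral_comp_comm _ horbit]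
    nth_rewrite 1 [hconst]
    rw [← integral_add ((integrable_of_compactlySupported μ f).smul_const _)
      ((ρ.π g).integrable_comp horbit)]
    refine integral_congr_ae (.of_forall fun k => ?_)
    simp [hb.map_mul, smul_add, add_assoc]
  simp only [sub_smul]
  rw [integral_sub htranslate horbit, BanachRep.displacement, hmove, BanachRep.affineMean]

end Average

section Convolution

variable {G : Type u} [Group G] [TopologicalSpace G] [IsTopologicalGroup G]
  [MeasurableSpace G] [BorelSpace G] (μ : Measure G) [μ.IsHaarMeasure]

/-- The linear representation `(x, t) ↦ (π(g) x + t b(g), t)` on `E × ℂ`, which restricts to the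
affine action with translation part `b` on the hyperplane `t = 1`. -/
def BanachRep.affineExtension (ρ : BanachRep.{u, v} G) {b : G → ρ.E} (hb : ρ.IsCocycle b) :
    BanachRep.{u, v} G where
  E := ρ.E × ℂ
  π :=
    { toFun := fun g => (ρ.π g ∘L ContinuousLinearMap.fst ℂ ρ.E ℂ +
        (ContinuousLinearMap.snd ℂ ρ.E ℂ).smulRight (b g)).prod (ContinuousLinearMap.snd ℂ ρ.E ℂ)
      map_one' := by ext x <;> simp [hb.map_one]
      map_mul' := fun g h => by ext x <;> simp [hb.map_mul, add_comm] }
  continuous_orbit := fun x =>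
    ((ρ.continuous_orbit x.1).add (continuous_const.smul hb.continuous)).prodMk continuous_const

theorem BanachRep.affineExtension_integrate (ρ : BanachRep.{u, v} G) {b : G → ρ.E}
    (hb : ρ.IsCocycle b) (f : C_c(G, ℂ)) (x : ρ.E) :
    (ρ.affineExtension hb).integrate μ f ((x, 1) : ρ.E × ℂ)
      = ((ρ.affineMean μ b f x, ∫ g, f g ∂μ) : ρ.E × ℂ) := by
  have horbit : ∀ g, f g • (ρ.affineExtension hb).π g ((x, 1) : ρ.E × ℂ)
      = ((f g • (b g + ρ.π g x), f g) : ρ.E × ℂ) := fun g =>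
    Prod.ext (by change f g • (ρ.π g x + (1 : ℂ) • b g) = _; rw [one_smul, add_comm])
      (mul_one (f g))
  exact (BanachRep.integrate_apply μ _ f _).trans ((integral_congr_ae (.of_forall horbit)).trans
    (integral_pair (hb.integrable_affine_orbit μ f x) (integrable_of_compactlySupported μ f)))

variable [T2Space G]

theorem BanachRep.integrate_convolution_apply (ρ : BanachRep.{u, v} G) (f h : C_c(G, ℂ))
    (x : ρ.E) : ρ.integrate μ (convolution μ f h) x = ρ.integrate μ f (ρ.integrate μ h x) := by
  rw [ρ.integrate_convolution μ, mul_apply_eq_comp]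

theorem BanachRep.IsCocycle.affineMean_convolution {ρ : BanachRep.{u, v} G} {b : G → ρ.E}
    (hb : ρ.IsCocycle b) (f : C_c(G, ℂ)) {h : C_c(G, ℂ)} (hh : ∫ g, h g ∂μ = 1) (x : ρ.E) :
    ρ.affineMean μ b (convolution μ f h) x = ρ.affineMean μ b f (ρ.affineMean μ b h x) := by
  have hext := (ρ.affineExtension hb).integrate_convolution_apply μ f h ((x, 1) : ρ.E × ℂ)
  simp only [affineExtension_integrate, hh] at hext
  exact congrArg Prod.fst hext

theorem integral_convolution_eq_one {f h : C_c(G, ℂ)} (hf : ∫ g, f g ∂μ = 1)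
    (hh : ∫ g, h g ∂μ = 1) : ∫ g, convolution μ f h g ∂μ = 1 := by
  let trivialRep : BanachRep.{u, 0} G :=
    { E := ℂ, π := 1, continuous_orbit := fun x => continuous_const }
  have hinv : (1 : ℂ) ∈ trivialRep.invariants := fun g => rfl
  have hconv := trivialRep.integrate_convolution_apply μ f h (1 : ℂ)
  rw [BanachRep.integrate_eq_self μ hh hinv, BanachRep.integrate_eq_self μ hf hinv,
    BanachRep.integrate_apply] at hconv
  refine Eq.trans (integral_congr_ae (.of_forall fun g => ?_)) hconv
  exact (mul_one _).symm

/-- The convolution power `f ∗ ⋯ ∗ f` with `m + 1` factors. -/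
def convPow (f : C_c(G, ℂ)) : ℕ → C_c(G, ℂ)
  | 0 => f
  | m + 1 => convolution μ f (convPow f m)

theorem integral_convPow {f : C_c(G, ℂ)} (hf : ∫ g, f g ∂μ = 1) (m : ℕ) :
    ∫ g, convPow μ f m g ∂μ = 1 := by
  induction m with
  | zero => exact hf
  | succ m ih => exact integral_convolution_eq_one μ hf ih

theorem BanachRep.IsCocycle.affineMean_convPow {ρ : BanachRep.{u, v} G} {b : G → ρ.E}
    (hb : ρ.IsCocycle b) {f : C_c(G, ℂ)} (hf : ∫ g, f g ∂μ = 1) (m : ℕ) (x : ρ.E) :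
    ρ.affineMean μ b (convPow μ f m) x = (ρ.affineMean μ b f)^[m + 1] x := by
  induction m with
  | zero => rfl
  | succ m ih =>
    rw [convPow, hb.affineMean_convolution μ f (integral_convPow μ hf m), ih]
    exact (Function.iterate_succ_apply' _ _ _).symm

end Convolution

section Smoothing

variable {G : Type u} [Group G] [TopologicalSpace G] [IsTopologicalGroup G] [LocallyCompactSpace G]
  [MeasurableSpace G] [BorelSpace G] (μ : Measure G) [μ.IsHaarMeasure]

theorem tendsto_integral_norm_translate_sub (f : C_c(G, ℂ)) :
    Tendsto (fun g : G => ∫ k, ‖f (g⁻¹ * k) - f k‖ ∂μ) (𝓝 1) (𝓝 0) := by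
  obtain ⟨V, hV, hV1⟩ := exists_compact_mem_nhds (1 : G)
  have := f.continuous
  have hcont : ContinuousOn (fun g : G => ∫ k, ‖f (g⁻¹ * k) - f k‖ ∂μ) V := by
    refine continuousOn_integral_of_compact_support
      (k := V * tsupport f ∪ tsupport f) ((hV.mul f.hasCompactSupport).union f.hasCompactSupport)
      ?_ ?_
    · exact Continuous.continuousOn (by unfold Function.uncurry; fun_prop)
    · intro g k hg hk
      rw [Set.mem_union, not_or] at hk
      have hgk : g⁻¹ * k ∉ tsupport f := fun h => hk.1 ⟨g, hg, g⁻¹ * k, h, by group⟩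
      simp [image_eq_zero_of_notMem_tsupport hgk, image_eq_zero_of_notMem_tsupport hk.2]
  simpa using (hcont.continuousAt hV1).tendsto

theorem exists_compact_norm_integral_translate_sub_le (f : C_c(G, ℂ)) :
    ∃ K : Set G, IsCompact K ∧ ∀ η : ℝ, 0 < η → ∀ᶠ g in 𝓝 (1 : G), ∀ (E : Type v)
      [NormedAddCommGroup E] [NormedSpace ℂ E] (b : G → E) (M : ℝ), 0 ≤ M →
      (∀ k ∈ K, ‖b k‖ ≤ M) → ‖∫ k, (f (g⁻¹ * k) - f k) • b k ∂μ‖ ≤ η * M := by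
  obtain ⟨V, hV, hV1⟩ := exists_compact_mem_nhds (1 : G)
  refine ⟨V * tsupport f ∪ tsupport f,
    (hV.mul f.hasCompactSupport).union f.hasCompactSupport, fun η hη => ?_⟩
  filter_upwards [hV1, (tendsto_integral_norm_translate_sub μ f).eventually (gt_mem_nhds hη)]
    with g hgV hgη E _ _ b M hM0 hM
  refine (norm_integral_smul_le μ (integrable_translate_sub μ f g) fun k hk => hM k ?_).trans
    (mul_le_mul_of_nonneg_right hgη.le hM0)
  by_contra hkK
  rw [Set.mem_union, not_or] at hkK
  have hgk : g⁻¹ * k ∉ tsupport f := fun h => hkK.1 ⟨g, hgV, g⁻¹ * k, h, by group⟩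
  exact hk (by simp [image_eq_zero_of_notMem_tsupport hgk, image_eq_zero_of_notMem_tsupport hkK.2])

theorem IsCompactGeneratingSet.eventually_norm_displacement_affineMean_le [T2Space G] {S : Set G}
    (hS : IsCompactGeneratingSet S) {f : C_c(G, ℂ)} (hf : ∫ g, f g ∂μ = 1) {A : ℝ} (hA : 1 ≤ A)
    {η : ℝ} (hη : 0 < η) :
    ∀ᶠ g in 𝓝 (1 : G), ∀ (ρ : BanachRep.{u, v} G), (∀ s ∈ S, ‖ρ.π s‖ ≤ A) → ∀ b, ρ.IsCocycle b →
      (∀ s ∈ S, ‖b s‖ ≤ 1) → ‖ρ.displacement b (ρ.affineMean μ b f 0) g‖ ≤ η := by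
  obtain ⟨K, hK, hsmall⟩ := exists_compact_norm_integral_translate_sub_le μ f
  obtain ⟨C, hC0, hC⟩ := hS.exists_cocycle_bound.{u, v} hK hA
  filter_upwards [hsmall (η / (C + 1)) (by positivity)] with g hg ρ hπ b hb hb1
  have hbK : ∀ k ∈ K, ‖b k + ρ.π k 0‖ ≤ C := fun k hk => by
    simpa using hC ρ hπ b hb 1 zero_le_one hb1 k hk
  rw [hb.displacement_affineMean μ hf]
  refine (hg ρ.E _ C hC0 hbK).trans ?_
  rw [div_mul_eq_mul_div, div_le_iff₀ (by positivity)]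
  nlinarith

end Smoothing

/-! ### Limits of representations along an ultrafilter -/

section UltraSeminorm

open scoped ENNReal

variable {ι : Type*} {E : ι → Type*} [∀ i, NormedAddCommGroup (E i)]

theorem tendsto_limUnder_norm (𝒰 : Ultrafilter ι) (x : lp E ∞) :
    Tendsto (fun i => ‖x i‖) 𝒰 (𝓝 (limUnder 𝒰 fun i => ‖x i‖)) := by
  have hmem : ∀ i, ‖x i‖ ∈ Set.Icc 0 ‖x‖ := fun i =>
    ⟨norm_nonneg _, lp.norm_apply_le_norm ENNReal.top_ne_zero x i⟩
  obtain ⟨a, -, ha⟩ := isCompact_Icc.ultrafilter_le_nhds (𝒰.map fun i => ‖x i‖)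
    (le_principal_iff.2 (univ_mem' (f := (𝒰 : Filter ι)) hmem))
  exact tendsto_nhds_limUnder ⟨a, ha⟩

variable [∀ i, NormedSpace ℂ (E i)]

/-- The diagonal operator on bounded families defined by a uniformly bounded family of operators. -/
def lpMap (A : ∀ i, E i →L[ℂ] E i) (hA : ∃ C, ∀ i, ‖A i‖ ≤ C) : lp E ∞ →L[ℂ] lp E ∞ :=
  LinearMap.mkContinuousOfExistsBound
    { toFun := fun x => ⟨fun i => A i (x i), memℓp_infty <| by
        obtain ⟨C, hC⟩ := hA
        refine ⟨C * ‖x‖, ?_⟩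
        rintro _ ⟨i, rfl⟩
        exact (A i).le_of_opNorm_le_of_le (hC i) (lp.norm_apply_le_norm ENNReal.top_ne_zero x i)⟩
      map_add' := fun x y => by ext i; exact map_add (A i) _ _
      map_smul' := fun c x => by ext i; exact map_smul (A i) c _ } <| by
    obtain ⟨C, hC⟩ := hA
    refine ⟨|C|, fun x => lp.norm_le_of_forall_le (by positivity) fun i => ?_⟩
    exact (A i).le_of_opNorm_le_of_le ((hC i).trans (le_abs_self C))
      (lp.norm_apply_le_norm ENNReal.top_ne_zero x i)

theorem lpMap_apply (A : ∀ i, E i →L[ℂ] E i) (hA : ∃ C, ∀ i, ‖A i‖ ≤ C) (x : lp E ∞) (i : ι) :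
    lpMap A hA x i = A i (x i) := rfl

theorem norm_lpMap_le {A : ∀ i, E i →L[ℂ] E i} (hA : ∃ C, ∀ i, ‖A i‖ ≤ C) {C : ℝ} (hC0 : 0 ≤ C)
    (hC : ∀ i, ‖A i‖ ≤ C) : ‖lpMap A hA‖ ≤ C :=
  ContinuousLinearMap.opNorm_le_bound _ hC0 fun x =>
    lp.norm_le_of_forall_le (mul_nonneg hC0 (norm_nonneg _)) fun i =>
      (A i).le_of_opNorm_le_of_le (hC i) (lp.norm_apply_le_norm ENNReal.top_ne_zero x i)

variable (𝒰 : Ultrafilter ι)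

/-- The limit along an ultrafilter of the norms of a bounded family, that is, the norm of its class
in the ultraproduct of the spaces `E i`. -/
def ultraSeminorm : Seminorm ℂ (lp E ∞) :=
  Seminorm.of (fun x => limUnder 𝒰 fun i => ‖x i‖)
    (fun x y => le_of_tendsto_of_tendsto' (tendsto_limUnder_norm 𝒰 (x + y))
      ((tendsto_limUnder_norm 𝒰 x).add (tendsto_limUnder_norm 𝒰 y)) fun i => by
        simpa using norm_add_le (x i) (y i))
    (fun c x => tendsto_nhds_unique (tendsto_limUnder_norm 𝒰 (c • x))
      (((tendsto_limUnder_norm 𝒰 x).const_mul ‖c‖).congr fun i => by simp [norm_smul]))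

theorem tendsto_ultraSeminorm (x : lp E ∞) :
    Tendsto (fun i => ‖x i‖) 𝒰 (𝓝 (ultraSeminorm 𝒰 x)) :=
  tendsto_limUnder_norm 𝒰 x

theorem ultraSeminorm_le_norm (x : lp E ∞) : ultraSeminorm 𝒰 x ≤ ‖x‖ :=
  le_of_tendsto' (tendsto_ultraSeminorm 𝒰 x) fun i =>
    lp.norm_apply_le_norm ENNReal.top_ne_zero x i

variable {𝒰} [∀ i, CompleteSpace (E i)] {ε : ι → ℝ}

theorem ultraSeminorm_parallelogram_le (hε : Tendsto ε 𝒰 (𝓝 0))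
    (hE : ∀ i, nearHilbert (ε i) (E i)) (x y : lp E ∞) :
    ultraSeminorm 𝒰 (x + y) * ultraSeminorm 𝒰 (x + y) +
      ultraSeminorm 𝒰 (x - y) * ultraSeminorm 𝒰 (x - y) ≤
      2 * (ultraSeminorm 𝒰 x * ultraSeminorm 𝒰 x + ultraSeminorm 𝒰 y * ultraSeminorm 𝒰 y) := by
  have hsq : ∀ z : lp E ∞, Tendsto (fun i => ‖z i‖ * ‖z i‖) 𝒰
      (𝓝 (ultraSeminorm 𝒰 z * ultraSeminorm 𝒰 z)) := fun z =>
    (tendsto_ultraSeminorm 𝒰 z).mul (tendsto_ultraSeminorm 𝒰 z)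
  have hright := ((hε.const_add 1).mul ((hsq x).add (hsq y))).const_mul 2
  rw [add_zero, one_mul] at hright
  refine le_of_tendsto_of_tendsto' ((hsq (x + y)).add (hsq (x - y))) hright fun i => ?_
  have hi := hE i (x i) (y i)
  simp only [lp.coeFn_add, lp.coeFn_sub, Pi.add_apply, Pi.sub_apply]
  simp only [pow_two] at hi
  linarith

-- Applied to `x + y` and `x - y`, the parallelogram inequality becomes its own converse.
theorem ultraSeminorm_parallelogram (hε : Tendsto ε 𝒰 (𝓝 0))
    (hE : ∀ i, nearHilbert (ε i) (E i)) (x y : lp E ∞) :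
    ultraSeminorm 𝒰 (x + y) * ultraSeminorm 𝒰 (x + y) +
      ultraSeminorm 𝒰 (x - y) * ultraSeminorm 𝒰 (x - y) =
      2 * (ultraSeminorm 𝒰 x * ultraSeminorm 𝒰 x + ultraSeminorm 𝒰 y * ultraSeminorm 𝒰 y) := by
  refine le_antisymm (ultraSeminorm_parallelogram_le hε hE x y) ?_
  have hconverse := ultraSeminorm_parallelogram_le hε hE (x + y) (x - y)
  have hadd : x + y + (x - y) = (2 : ℂ) • x := by rw [two_smul]; abel
  have hsub : x + y - (x - y) = (2 : ℂ) • y := by rw [two_smul]; abel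
  rw [hadd, hsub, map_smul_eq_mul, map_smul_eq_mul, Complex.norm_ofNat] at hconverse
  linarith

end UltraSeminorm

section BoundedProduct

open scoped ENNReal

variable {G : Type u} [Group G] [TopologicalSpace G]

/-- Local boundedness of a family of representations, uniformly in the index. -/
def IsLocallyBounded {ι : Type} (ρ : ι → BanachRep.{u, v} G) : Prop :=
  ∀ g₀ : G, ∃ C : ℝ, 0 ≤ C ∧ ∀ᶠ g in 𝓝 g₀, ∀ i, ‖(ρ i).π g‖ ≤ C

variable {ι : Type} {ρ : ι → BanachRep.{u, v} G}

theorem IsLocallyBounded.exists_bound (hloc : IsLocallyBounded ρ) (g : G) :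
    ∃ C, ∀ i, ‖(ρ i).π g‖ ≤ C :=
  (hloc g).imp fun _ hC => hC.2.self_of_nhds

/-- The diagonal action on bounded families of vectors; its orbit maps need not be continuous. -/
def diagonalHom (hloc : IsLocallyBounded ρ) :
    G →* (lp (fun i => (ρ i).E) ∞ →L[ℂ] lp (fun i => (ρ i).E) ∞) where
  toFun g := lpMap (fun i => (ρ i).π g) (hloc.exists_bound g)
  map_one' := by ext x i; simp [lpMap_apply]
  map_mul' g h := by ext x i; simp [lpMap_apply]

variable [IsTopologicalGroup G]

theorem continuous_of_map_mul {E : Type v} [NormedAddCommGroup E] [NormedSpace ℂ E]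
    (π : G →* (E →L[ℂ] E)) {c : G → E} (hmul : ∀ g h, c (g * h) = c g + π g (c h))
    (hone : Tendsto c (𝓝 1) (𝓝 0)) : Continuous c := by
  refine continuous_iff_continuousAt.2 fun g₀ => ?_
  have htranslate : Tendsto (fun g => g₀⁻¹ * g) (𝓝 g₀) (𝓝 1) := by
    simpa using (continuous_const_mul g₀⁻¹).tendsto g₀
  have hlim := (((π g₀).continuous.tendsto 0).comp (hone.comp htranslate)).const_add (c g₀)
  rw [map_zero, add_zero] at hlim
  refine hlim.congr fun g => ?_
  simp only [Function.comp_apply]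
  rw [← hmul, mul_inv_cancel_left]

theorem mem_continuousVectors_of_map_mul {E : Type v} [NormedAddCommGroup E] [NormedSpace ℂ E]
    (π : G →* (E →L[ℂ] E)) {c : G → E} (hmul : ∀ g h, c (g * h) = c g + π g (c h))
    (hc : Continuous c) (g : G) : c g ∈ continuousVectors π := by
  have horbit : (fun k => π k (c g)) = fun k => c (k * g) - c k :=
    funext fun k => by rw [hmul, add_sub_cancel_left]
  change Continuous fun k => π k (c g)
  rw [horbit]
  exact (hc.comp (continuous_mul_const g)).sub hc

/-- The continuous part of the diagonal representation on bounded families of vectors. -/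
def boundedProduct (hloc : IsLocallyBounded ρ) : BanachRep.{u, v} G :=
  continuousPart (diagonalHom hloc) (C := (hloc 1).choose) <| by
    obtain ⟨hC0, hC⟩ := (hloc 1).choose_spec
    exact hC.mono fun g hg => norm_lpMap_le (hloc.exists_bound g) hC0 hg

variable (hloc : IsLocallyBounded ρ)

/-- The inclusion of the bounded product into all bounded families. -/
def boundedProductIncl : (boundedProduct hloc).E →L[ℂ] lp (fun i => (ρ i).E) ∞ :=
  (continuousVectors (diagonalHom hloc)).subtypeL

/-- The `i`-th coordinate on the bounded product. -/
def boundedProductCoord (i : ι) : (boundedProduct hloc).E →L[ℂ] (ρ i).E :=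
  lp.evalCLM ℂ (fun i => (ρ i).E) ∞ i ∘L boundedProductIncl hloc

theorem boundedProductCoord_map (i : ι) (g : G) (x : (boundedProduct hloc).E) :
    boundedProductCoord hloc i ((boundedProduct hloc).π g x)
      = (ρ i).π g (boundedProductCoord hloc i x) := rfl

theorem norm_boundedProductCoord_le (i : ι) (x : (boundedProduct hloc).E) :
    ‖boundedProductCoord hloc i x‖ ≤ ‖x‖ :=
  lp.norm_apply_le_norm ENNReal.top_ne_zero (boundedProductIncl hloc x) i

theorem exists_cocycle_boundedProduct {b : ∀ i, G → (ρ i).E} (hb : ∀ i, (ρ i).IsCocycle (b i))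
    (hbdd : ∀ g, ∃ C, ∀ i, ‖b i g‖ ≤ C)
    (hequi : ∀ η : ℝ, 0 < η → ∀ᶠ g in 𝓝 (1 : G), ∀ i, ‖b i g‖ ≤ η) :
    ∃ c, (boundedProduct hloc).IsCocycle c ∧ ∀ i g, boundedProductCoord hloc i (c g) = b i g := by
  let c : G → lp (fun i => (ρ i).E) ∞ := fun g => ⟨fun i => b i g, memℓp_infty <| by
    obtain ⟨C, hC⟩ := hbdd g
    exact ⟨C, by rintro _ ⟨i, rfl⟩; exact hC i⟩⟩
  have hmul : ∀ g h, c (g * h) = c g + diagonalHom hloc g (c h) := fun g h =>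
    lp.ext (funext fun i => (hb i).map_mul g h)
  have hone : Tendsto c (𝓝 1) (𝓝 0) := by
    refine Metric.tendsto_nhds.2 fun η hη => ?_
    filter_upwards [hequi (η / 2) (by positivity)] with g hg
    rw [dist_zero_right]
    exact (lp.norm_le_of_forall_le (by positivity) hg).trans_lt (by linarith)
  have hc := continuous_of_map_mul (diagonalHom hloc) hmul hone
  exact ⟨fun g => ⟨c g, mem_continuousVectors_of_map_mul _ hmul hc g⟩,
    ⟨Continuous.subtype_mk hc _, fun g h => Subtype.ext (hmul g h)⟩, fun i g => rfl⟩

end BoundedProduct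

section UnitaryLimit

open scoped ENNReal

variable {G : Type u} [Group G] [TopologicalSpace G] {ι : Type} {ρ : ι → BanachRep.{u, v} G}
  {𝒰 : Ultrafilter ι} (hloc : IsLocallyBounded ρ)

theorem ultraSeminorm_diagonalHom {r : G → ι → ℝ} (hr : ∀ g, Tendsto (r g) 𝒰 (𝓝 1))
    (hρ : ∀ g i, ‖(ρ i).π g‖ ≤ r g i) (g : G) (x : lp (fun i => (ρ i).E) ∞) :
    ultraSeminorm 𝒰 (diagonalHom hloc g x) = ultraSeminorm 𝒰 x := by
  have hle : ∀ g x, ultraSeminorm 𝒰 (diagonalHom hloc g x) ≤ ultraSeminorm 𝒰 x := fun g x => by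
    have hlim := (hr g).mul (tendsto_ultraSeminorm 𝒰 x)
    rw [one_mul] at hlim
    exact le_of_tendsto_of_tendsto' (tendsto_ultraSeminorm 𝒰 _) hlim fun i =>
      ((ρ i).π g).le_of_opNorm_le (hρ g i) _
  refine le_antisymm (hle g x) ?_
  have hinv := map_apply_inv_apply (diagonalHom hloc) g⁻¹ x
  rw [inv_inv] at hinv
  simpa only [hinv] using hle g⁻¹ (diagonalHom hloc g x)

variable [IsTopologicalGroup G]

theorem exists_unitary_limit {ε : ι → ℝ} (hε : Tendsto ε 𝒰 (𝓝 0))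
    (hE : ∀ i, nearHilbert (ε i) (ρ i).E) {r : G → ι → ℝ} (hr : ∀ g, Tendsto (r g) 𝒰 (𝓝 1))
    (hρ : ∀ g i, ‖(ρ i).π g‖ ≤ r g i) :
    ∃ ρ' : BanachRep.{u, v} G, ρ'.IsUnitary ∧ ∃ T : (boundedProduct hloc).E →L[ℂ] ρ'.E,
      (∀ g x, T ((boundedProduct hloc).π g x) = ρ'.π g (T x)) ∧
      ∀ x, Tendsto (fun i => ‖boundedProductCoord hloc i x‖) 𝒰 (𝓝 ‖T x‖) := by
  let X := boundedProduct hloc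
  let incl := boundedProductIncl hloc
  let p : Seminorm ℂ X.E := (ultraSeminorm 𝒰).comp incl.toLinearMap
  let π : G →* (X.E →ₗ[ℂ] X.E) :=
    { toFun := fun g => (X.π g).toLinearMap
      map_one' := by rw [map_one]; rfl
      map_mul' := fun g h => by rw [map_mul]; rfl }
  have hp_parallelogram : ∀ x y : X.E, p (x + y) * p (x + y) + p (x - y) * p (x - y)
      = 2 * (p x * p x + p y * p y) := fun x y =>
    ultraSeminorm_parallelogram hε hE (incl x) (incl y)
  have hp_tendsto : ∀ x : X.E, Tendsto (fun g => p (X.π g x - x)) (𝓝 1) (𝓝 0) := fun x => by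
    have horbit : Tendsto (fun g => ‖X.π g x - x‖) (𝓝 1) (𝓝 0) := by
      simpa using tendsto_iff_norm_sub_tendsto_zero.1 ((X.continuous_orbit x).tendsto 1)
    exact squeeze_zero (fun g => apply_nonneg p _) (fun g => ultraSeminorm_le_norm 𝒰 _) horbit
  obtain ⟨ρ', hρ', T, hT, hTπ⟩ := exists_unitary_of_seminorm p hp_parallelogram π
    (fun g x => ultraSeminorm_diagonalHom hloc hr hρ g (incl x)) hp_tendsto
  refine ⟨ρ', hρ', T.mkContinuous 1 fun x => ?_, hTπ, fun x => ?_⟩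
  · rw [hT, one_mul]
    exact ultraSeminorm_le_norm 𝒰 (incl x)
  · rw [LinearMap.mkContinuous_apply, hT]
    exact tendsto_ultraSeminorm 𝒰 (incl x)

theorem exists_le_norm_limit {H : Type*} [NormedAddCommGroup H] [NormedSpace ℂ H]
    {T : (boundedProduct hloc).E →L[ℂ] H}
    (hT : ∀ x, Tendsto (fun i => ‖boundedProductCoord hloc i x‖) 𝒰 (𝓝 ‖T x‖)) {S : Set G}
    (hS : IsCompact S) {d : G → (boundedProduct hloc).E} (hd : Continuous d) {s : ι → G}
    (hs : ∀ i, s i ∈ S) {r : ℝ} (hr : ∀ i, r ≤ ‖boundedProductCoord hloc i (d (s i))‖) :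
    ∃ s₀ ∈ S, r ≤ ‖T (d s₀)‖ := by
  obtain ⟨s₀, hs₀, hlim⟩ := hS.ultrafilter_le_nhds (𝒰.map s)
    (le_principal_iff.2 (univ_mem' (f := (𝒰 : Filter ι)) hs))
  have hdist : Tendsto (fun i => ‖d (s i) - d s₀‖) 𝒰 (𝓝 0) :=
    tendsto_iff_norm_sub_tendsto_zero.1 ((hd.tendsto s₀).comp hlim)
  have hsum := hdist.add (hT (d s₀))
  rw [zero_add] at hsum
  refine ⟨s₀, hs₀, ge_of_tendsto' hsum fun i => ?_⟩
  calc r ≤ ‖boundedProductCoord hloc i (d (s i) - d s₀) + boundedProductCoord hloc i (d s₀)‖ := by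
        rw [map_sub, sub_add_cancel]
        exact hr i
    _ ≤ ‖d (s i) - d s₀‖ + ‖boundedProductCoord hloc i (d s₀)‖ :=
        (norm_add_le _ _).trans (add_le_add_left (norm_boundedProductCoord_le hloc i _) _)

end UnitaryLimit

/-! ### Means contract displacements -/

section Bounds

variable {G : Type u} [Group G] [TopologicalSpace G] [IsTopologicalGroup G] [T2Space G]
  [LocallyCompactSpace G] {S : Set G} (hS : IsCompactGeneratingSet S)

theorem IsCompactGeneratingSet.exists_eventually_wordLength_le (hS : IsCompactGeneratingSet S)
    (g₀ : G) : ∃ N : ℕ, ∀ᶠ g in 𝓝 g₀, wordLength S g ≤ N := by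
  obtain ⟨V, hV, hVg₀⟩ := exists_compact_mem_nhds g₀
  exact (hS.wordLength_bounded hV).imp fun N hN => mem_of_superset hVg₀ hN

theorem norm_le_exp_wordLength {𝓔 : BanachClass.{v}} {c : ℝ} (hc : c ≤ 1) {ρ : BanachRep.{u, v} G}
    (hρ : ρ ∈ (repFamily hS 𝓔 c).carrier) (g : G) : ‖ρ.π g‖ ≤ Real.exp (wordLength S g) :=
  (hρ.2 g).trans (Real.exp_le_exp.2 (mul_le_of_le_one_left (Nat.cast_nonneg _) hc))

theorem norm_le_exp_one {𝓔 : BanachClass.{v}} {c : ℝ} (hc : c ≤ 1) {ρ : BanachRep.{u, v} G}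
    (hρ : ρ ∈ (repFamily hS 𝓔 c).carrier) {s : G} (hs : s ∈ S) : ‖ρ.π s‖ ≤ Real.exp 1 := by
  have hlength : wordLength S s ≤ 1 := wordLength_le (by rwa [pow_one])
  exact (norm_le_exp_wordLength hS hc hρ s).trans (Real.exp_le_exp.2 (by exact_mod_cast hlength))

theorem isLocallyBounded_of_mem_repFamily {ι : Type} {ρ : ι → BanachRep.{u, v} G}
    {𝓔 : ι → BanachClass.{v}} {c : ι → ℝ} (hc : ∀ i, c i ≤ 1)
    (hρ : ∀ i, ρ i ∈ (repFamily hS (𝓔 i) (c i)).carrier) : IsLocallyBounded ρ := by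
  intro g₀
  obtain ⟨N, hN⟩ := hS.exists_eventually_wordLength_le g₀
  refine ⟨Real.exp N, (Real.exp_pos _).le, hN.mono fun g hg i => ?_⟩
  exact (norm_le_exp_wordLength hS (hc i) (hρ i) g).trans
    (Real.exp_le_exp.2 (by exact_mod_cast hg))

variable [MeasurableSpace G] [BorelSpace G] (μ : Measure G) [μ.IsHaarMeasure] {f : C_c(G, ℂ)}

theorem IsCompactGeneratingSet.exists_affineMean_sub_bound (hS : IsCompactGeneratingSet S)
    (hf : ∫ g, f g ∂μ = 1) {A : ℝ} (hA : 1 ≤ A) :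
    ∃ C : ℝ, 0 ≤ C ∧ ∀ (ρ : BanachRep.{u, v} G), (∀ s ∈ S, ‖ρ.π s‖ ≤ A) → ∀ b, ρ.IsCocycle b →
      ∀ (x : ρ.E) (M : ℝ), 0 ≤ M → (∀ s ∈ S, ‖ρ.displacement b x s‖ ≤ M) →
        ‖ρ.affineMean μ b f x - x‖ ≤ C * M := by
  obtain ⟨C, hC0, hC⟩ := hS.exists_cocycle_bound.{u, v} f.hasCompactSupport hA
  refine ⟨(∫ g, ‖f g‖ ∂μ) * C, mul_nonneg (integral_nonneg fun _ => norm_nonneg _) hC0,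
    fun ρ hπ b hb x M hM0 hM => ?_⟩
  rw [hb.affineMean_sub_self μ hf, mul_assoc]
  exact norm_integral_smul_le μ (integrable_of_compactlySupported μ f) fun g hg =>
    hC ρ hπ _ (hb.displacement x) M hM0 hM g (subset_tsupport f hg)

theorem IsCompactGeneratingSet.exists_displacement_affineMean_bound
    (hS : IsCompactGeneratingSet S) (hf : ∫ g, f g ∂μ = 1) {A : ℝ} (hA : 1 ≤ A) :
    ∃ M : ℝ, 0 ≤ M ∧ ∀ (ρ : BanachRep.{u, v} G), (∀ s ∈ S, ‖ρ.π s‖ ≤ A) → ∀ b, ρ.IsCocycle b →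
      (∀ s ∈ S, ‖b s‖ ≤ 1) → ∀ s ∈ S, ‖ρ.displacement b (ρ.affineMean μ b f 0) s‖ ≤ M := by
  obtain ⟨C, hC0, hC⟩ := hS.exists_affineMean_sub_bound.{u, v} μ hf hA
  refine ⟨1 + A * C + C, by positivity, fun ρ hπ b hb hb1 s hs => ?_⟩
  set a := ρ.affineMean μ b f 0
  have ha : ‖a‖ ≤ C := by
    simpa using hC ρ hπ b hb 0 1 zero_le_one fun s hs => by
      simpa only [BanachRep.displacement_zero_right] using hb1 s hs
  calc ‖ρ.displacement b a s‖ ≤ ‖b s‖ + ‖ρ.π s a‖ + ‖a‖ :=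
        (norm_sub_le _ _).trans (add_le_add_left (norm_add_le _ _) _)
    _ ≤ 1 + A * C + C :=
        add_le_add (add_le_add (hb1 s hs) ((ρ.π s).le_of_opNorm_le_of_le (hπ s hs) ha)) ha

end Bounds

section Limit

variable {G : Type u} [Group G] [TopologicalSpace G] [IsTopologicalGroup G] [T2Space G]
  [LocallyCompactSpace G] [MeasurableSpace G] [BorelSpace G] (μ : Measure G) [μ.IsHaarMeasure]
  {S : Set G} (hS : IsCompactGeneratingSet S)

theorem exists_unitary_cocycle_limit {ι : Type} {𝒰 : Ultrafilter ι} {ε : ι → ℝ}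
    (hε1 : ∀ i, ε i ≤ 1) (hε : Tendsto ε 𝒰 (𝓝 0)) {ρ : ι → BanachRep.{u, v} G}
    (hρ : ∀ i, ρ i ∈ (repFamily hS (nearHilbert.{v} (ε i)) (ε i)).carrier)
    {b : ∀ i, G → (ρ i).E} (hb : ∀ i, (ρ i).IsCocycle (b i)) {M : ℝ} (hM0 : 0 ≤ M)
    (hM : ∀ i, ∀ s ∈ S, ‖b i s‖ ≤ M)
    (hequi : ∀ η : ℝ, 0 < η → ∀ᶠ g in 𝓝 (1 : G), ∀ i, ‖b i g‖ ≤ η)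
    (f : C_c(G, ℂ)) (m : ℕ) {s : ι → G} (hs : ∀ i, s i ∈ S) {r : ℝ}
    (hr : ∀ i, r ≤ ‖(ρ i).displacement (b i) (((ρ i).affineMean μ (b i) f)^[m] 0) (s i)‖) :
    ∃ ρ' : BanachRep.{u, v} G, ρ'.IsUnitary ∧ ∃ b', ρ'.IsCocycle b' ∧ (∀ s ∈ S, ‖b' s‖ ≤ M) ∧
      ∃ s₀ ∈ S, r ≤ ‖ρ'.displacement b' ((ρ'.affineMean μ b' f)^[m] 0) s₀‖ := by
  have hloc := isLocallyBounded_of_mem_repFamily hS hε1 hρ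
  have hexp : ∀ g, Tendsto (fun i => Real.exp (ε i * wordLength S g)) 𝒰 (𝓝 1) := fun g => by
    simpa using (hε.mul_const (wordLength S g : ℝ)).rexp
  have hbdd : ∀ g, ∃ C, ∀ i, ‖b i g‖ ≤ C := fun g => by
    obtain ⟨C, -, hC⟩ := hS.exists_cocycle_bound.{u, v} (isCompact_singleton (x := g))
      (Real.one_le_exp zero_le_one)
    exact ⟨C * M, fun i => hC (ρ i) (fun s hs => norm_le_exp_one hS (hε1 i) (hρ i) hs) _ (hb i) M
      hM0 (hM i) g rfl⟩
  obtain ⟨ρ', hρ', T, hTπ, hT⟩ :=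
    exists_unitary_limit hloc hε (fun i => (hρ i).1) hexp fun g i => (hρ i).2 g
  obtain ⟨c, hc, hcoord⟩ := exists_cocycle_boundedProduct hloc hb hbdd hequi
  set w := ((boundedProduct hloc).affineMean μ c f)^[m] 0 with hw
  have hcoord_w : ∀ i g, boundedProductCoord hloc i ((boundedProduct hloc).displacement c w g)
      = (ρ i).displacement (b i) (((ρ i).affineMean μ (b i) f)^[m] 0) g := fun i g => by
    rw [BanachRep.map_displacement _ (boundedProductCoord_map hloc i), hw,
      hc.map_iterate_affineMean μ _ (boundedProductCoord_map hloc i), map_zero]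
    simp only [hcoord]
  obtain ⟨s₀, hs₀, hle⟩ := exists_le_norm_limit hloc hT hS.isCompact (hc.displacement w).continuous
    hs fun i => (hr i).trans_eq (by rw [hcoord_w])
  rw [BanachRep.map_displacement T hTπ, hw, hc.map_iterate_affineMean μ T hTπ, map_zero] at hle
  refine ⟨ρ', hρ', _, hc.map T hTπ, fun s hs => le_of_tendsto' (hT (c s)) fun i => ?_, s₀, hs₀, hle⟩
  rw [hcoord]
  exact hM i s hs

end Limit

section Contraction

variable {G : Type u} [Group G] [TopologicalSpace G] [MeasurableSpace G] [BorelSpace G]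
  (μ : Measure G) [μ.IsHaarMeasure]

/-- Passing from a point to its mean with weight `φ` halves its largest displacement by elements of
`S`, for every affine action with linear part in `F`. -/
def ContractsDisplacement (S : Set G) (F : RepFamily.{u, v} G) (φ : C_c(G, ℂ)) : Prop :=
  ∀ ρ ∈ F.carrier, ∀ b, ρ.IsCocycle b → ∀ (x : ρ.E) (M : ℝ), 0 ≤ M →
    (∀ s ∈ S, ‖ρ.displacement b x s‖ ≤ M) →
    ∀ s ∈ S, ‖ρ.displacement b (ρ.affineMean μ b φ x) s‖ ≤ M / 2

theorem contractsDisplacement_of_unit {S : Set G} {F : RepFamily.{u, v} G} {φ : C_c(G, ℂ)}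
    (hφ : ∫ g, φ g ∂μ = 1)
    (h : ∀ ρ ∈ F.carrier, ∀ b, ρ.IsCocycle b → (∀ s ∈ S, ‖b s‖ ≤ 1) →
      ∀ s ∈ S, ‖ρ.displacement b (ρ.affineMean μ b φ 0) s‖ ≤ 1 / 2) :
    ContractsDisplacement μ S F φ := by
  intro ρ hρ b hb x M hM0 hM s hs
  refine le_of_forall_gt_imp_ge_of_dense fun K hK => ?_
  have hK0 : 0 < 2 * K := by linarith
  set t : ℂ := (((2 * K)⁻¹ : ℝ) : ℂ)
  have ht : ‖t‖ = (2 * K)⁻¹ := by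
    rw [Complex.norm_real, Real.norm_of_nonneg (inv_nonneg.2 hK0.le)]
  have hunit := h ρ hρ _ ((hb.displacement x).smul t) (fun s hs => by
    rw [Pi.smul_apply, norm_smul, ht, inv_mul_le_iff₀ hK0]
    linarith [hM s hs]) s hs
  have hmean := hb.affineMean_displacement_add μ hφ x 0
  rw [← smul_zero t, ρ.affineMean_smul μ, ρ.displacement_smul, norm_smul, ht,
    ρ.displacement_displacement, add_comm, hmean, zero_add, inv_mul_le_iff₀ hK0] at hunit
  linarith

variable [IsTopologicalGroup G]

theorem BanachRep.iterate_affineMean_zero (ρ : BanachRep.{u, v} G) (f : C_c(G, ℂ)) (m : ℕ) :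
    (ρ.affineMean μ 0 f)^[m] = ⇑(ρ.integrate μ f ^ m) := by
  rw [BanachRep.affineMean_zero, ← hom_coe_pow _ rfl fun _ _ => rfl]

theorem BanachRep.IsCocycle.displacement_affineMean_convPow [T2Space G]
    {ρ : BanachRep.{u, v} G} {b : G → ρ.E} (hb : ρ.IsCocycle b) {f : C_c(G, ℂ)}
    (hf : ∫ g, f g ∂μ = 1) (m : ℕ) :
    ρ.displacement b (ρ.affineMean μ b (convPow μ f m) 0)
      = ρ.displacement (ρ.displacement b (ρ.affineMean μ b f 0))
          ((ρ.affineMean μ (ρ.displacement b (ρ.affineMean μ b f 0)) f)^[m] 0) := by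
  rw [ρ.displacement_displacement, add_comm, hb.iterate_affineMean_displacement_add μ hf, zero_add,
    hb.affineMean_convPow μ hf, Function.iterate_succ_apply]

variable [LocallyCompactSpace G] {Q : Set G} {δ : ℝ}

theorem IsKazhdanPair.exists_displacement_decay (hK : IsKazhdanPair.{u, v} Q δ)
    (hQ : IsCompact Q) (hδ : 0 < δ) :
    ∃ f : C_c(G, ℂ), ∫ g, f g ∂μ = 1 ∧ ∃ c : ℝ, 0 ≤ c ∧ c < 1 ∧
      ∀ ρ : BanachRep.{u, v} G, ρ.IsUnitary → ∀ b, ρ.IsCocycle b → ∀ r : ℝ, 0 ≤ r →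
        (∀ g ∈ Q, ‖b g‖ ≤ r) → ∀ (m : ℕ) (g : G),
        δ * ‖ρ.displacement b ((ρ.affineMean μ b f)^[m] 0) g‖ ≤ 2 * (c ^ m * r) := by
  obtain ⟨f, hf, c, hc0, hc1, hgap⟩ := hK.exists_spectral_gap μ hQ hδ
  refine ⟨f, hf, c, hc0, hc1, fun ρ hρ b hb r hr0 hr m g => ?_⟩
  obtain ⟨x₀, hx₀⟩ := hK.exists_displacement_eq_zero hQ hδ hρ hb
  have hfixed : ρ.displacement b x₀ = 0 := funext hx₀
  have hb_eq : ∀ g, ρ.π g (-x₀) - -x₀ = b g := fun g => by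
    have hg := hx₀ g
    rw [BanachRep.displacement, sub_eq_zero] at hg
    rw [map_neg, sub_neg_eq_add, neg_add_eq_sub, sub_eq_iff_eq_add, hg]
  obtain ⟨z, hz, hdecay⟩ := hgap ρ hρ (-x₀) r hr0 fun g hg => by rw [hb_eq]; exact hr g hg
  set y := (ρ.integrate μ f ^ m) (-x₀)
  have hiterate := hb.iterate_affineMean_displacement_add μ hf x₀ (-x₀) m
  rw [hfixed, BanachRep.iterate_affineMean_zero, neg_add_cancel] at hiterate
  have hdisp : ρ.displacement b ((ρ.affineMean μ b f)^[m] 0) g = ρ.π g (y - z) - (y - z) := by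
    rw [← hiterate, add_comm, ← ρ.displacement_displacement, hfixed, ρ.displacement_zero_left,
      map_sub, hz g]
    abel
  have hnorm : ‖ρ.π g (y - z) - (y - z)‖ ≤ ‖y - z‖ + ‖y - z‖ :=
    (norm_sub_le _ _).trans_eq (by rw [hρ.norm_map])
  rw [hdisp]
  nlinarith [hdecay m]

variable [T2Space G] {S : Set G}

theorem IsKazhdanPair.exists_contracting_mean_unit (hK : IsKazhdanPair.{u, v} Q δ)
    (hQ : IsCompact Q) (hδ : 0 < δ) (hS : IsCompactGeneratingSet S) :
    ∃ φ : C_c(G, ℂ), ∫ g, φ g ∂μ = 1 ∧ ∃ ε : ℝ, 0 < ε ∧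
      ∀ ρ ∈ (repFamily hS (nearHilbert.{v} ε) ε).carrier, ∀ b, ρ.IsCocycle b →
        (∀ s ∈ S, ‖b s‖ ≤ 1) →
        ∀ s ∈ S, ‖ρ.displacement b (ρ.affineMean μ b φ 0) s‖ ≤ 1 / 2 := by
  have hexp : (1 : ℝ) ≤ Real.exp 1 := Real.one_le_exp zero_le_one
  obtain ⟨f, hf, c, hc0, hc1, hdecay⟩ := hK.exists_displacement_decay μ hQ hδ
  obtain ⟨C, hC0, hC⟩ := hS.exists_cocycle_bound.{u, v} hQ hexp
  obtain ⟨M, hM0, hM⟩ := hS.exists_displacement_affineMean_bound.{u, v} μ hf hexp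
  obtain ⟨m, hm⟩ : ∃ m : ℕ, 2 * (c ^ m * (C * M)) < δ * (1 / 2) := by
    have hlim := ((tendsto_pow_atTop_nhds_zero_of_lt_one hc0 hc1).mul_const (C * M)).const_mul 2
    rw [zero_mul, mul_zero] at hlim
    exact (hlim.eventually (gt_mem_nhds (by positivity))).exists
  refine ⟨convPow μ f m, integral_convPow μ hf m, ?_⟩
  by_contra! hcontra
  let ε : ℕ → ℝ := fun n => 1 / ((n : ℝ) + 1)
  have hε0 : ∀ n, 0 < ε n := fun n => by positivity
  have hε1 : ∀ n, ε n ≤ 1 := fun n => div_le_one_of_le₀ (by simp) (by positivity)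
  choose ρ hρ b hb hb1 s hs hlarge using fun n => hcontra (ε n) (hε0 n)
  have hπ : ∀ n, ∀ s ∈ S, ‖(ρ n).π s‖ ≤ Real.exp 1 := fun n s hs =>
    norm_le_exp_one hS (hε1 n) (hρ n) hs
  -- Replacing the base point `0` by its mean makes the cocycles equicontinuous.
  let b' : ∀ n, G → (ρ n).E := fun n => (ρ n).displacement (b n) ((ρ n).affineMean μ (b n) f 0)
  have hequi : ∀ η : ℝ, 0 < η → ∀ᶠ g in 𝓝 (1 : G), ∀ n, ‖b' n g‖ ≤ η := fun η hη =>
    (hS.eventually_norm_displacement_affineMean_le μ hf hexp hη).mono fun g hg n =>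
      hg (ρ n) (hπ n) (b n) (hb n) (hb1 n)
  obtain ⟨ρ', hρ', b₀, hb₀, hb₀M, s₀, -, hs₀⟩ := exists_unitary_cocycle_limit μ hS hε1
    (tendsto_one_div_add_atTop_nhds_zero_nat.mono_left Nat.hyperfilter_le_atTop) hρ
    (fun n => (hb n).displacement _) hM0
    (fun n => hM (ρ n) (hπ n) (b n) (hb n) (hb1 n)) hequi f m hs fun n => by
      rw [← (hb n).displacement_affineMean_convPow μ hf]
      exact (hlarge n).le
  have hsmall := hdecay ρ' hρ' b₀ hb₀ (C * M) (by positivity)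
    (hC ρ' (fun s _ => (hρ'.norm_le_one s).trans hexp) b₀ hb₀ M hM0 hb₀M) m s₀
  linarith [mul_le_mul_of_nonneg_left hs₀ hδ.le]

theorem PropertyT.exists_contractsDisplacement (hT : PropertyT.{u, v} G)
    (hS : IsCompactGeneratingSet S) :
    ∃ φ : C_c(G, ℂ), ∫ g, φ g ∂μ = 1 ∧ ∃ ε : ℝ, 0 < ε ∧
      ContractsDisplacement μ S (repFamily hS (nearHilbert.{v} ε) ε) φ := by
  obtain ⟨Q, hQ, δ, hδ, hK⟩ := hT
  obtain ⟨φ, hφ, ε, hε, h⟩ := IsKazhdanPair.exists_contracting_mean_unit μ hK hQ hδ hS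
  exact ⟨φ, hφ, ε, hε, contractsDisplacement_of_unit μ hφ h⟩

end Contraction

/-! ### The algebra `C_F(G)` -/

section Algebra

variable {G : Type u} [Group G] [TopologicalSpace G] [IsTopologicalGroup G] [MeasurableSpace G]
  [BorelSpace G] {μ : Measure G} [μ.IsHaarMeasure]

theorem BanachRep.integrate_sub (ρ : BanachRep.{u, v} G) (f h : C_c(G, ℂ)) :
    ρ.integrate μ (f - h) = ρ.integrate μ f - ρ.integrate μ h := by
  rw [eq_sub_iff_add_eq, ← ρ.integrate_add μ, sub_add_cancel]

theorem BanachRep.norm_integrate_sub_self_le (ρ : BanachRep.{u, v} G) {f : C_c(G, ℂ)}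
    (hf : ∫ g, f g ∂μ = 1) {x : ρ.E} {r : ℝ} (hx : ∀ g ∈ tsupport f, ‖ρ.π g x - x‖ ≤ r) :
    ‖ρ.integrate μ f x - x‖ ≤ (∫ g, ‖f g‖ ∂μ) * r := by
  rw [← ρ.affineMean_zero μ, ρ.isCocycle_zero.affineMean_sub_self μ hf]
  refine norm_integral_smul_le μ (integrable_of_compactlySupported μ f) fun g hg => ?_
  rw [ρ.displacement_zero_left]
  exact hx g (subset_tsupport f hg)

variable [T2Space G] [LocallyCompactSpace G] {F : RepFamily.{u, v} G}

theorem CF.dist_of (f h : C_c(G, ℂ)) :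
    dist (CF.of μ F f) (CF.of μ F h) = familyNorm μ F (f - h) := by
  change dist ((PreAlgebra.of μ F f : PreAlgebra μ F) : UniformSpace.Completion (PreAlgebra μ F))
    (PreAlgebra.of μ F h : PreAlgebra μ F) = _
  rw [UniformSpace.Completion.dist_eq, dist_eq_norm]
  rfl

theorem CF.denseRange_of : DenseRange (CF.of μ F) := by
  refine (UniformSpace.Completion.denseRange_coe (α := PreAlgebra μ F)).mono ?_
  rintro _ ⟨f, rfl⟩
  exact ⟨f.out, rfl⟩

theorem CF.of_mul (f h : C_c(G, ℂ)) :
    CF.of μ F f * CF.of μ F h = CF.of μ F (convolution μ f h) :=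
  (CF.coe_mul μ F (PreAlgebra.of μ F f) (PreAlgebra.of μ F h)).symm

theorem CF.dist_rep_le (ρ : F.carrier) (a b : CF μ F) :
    dist (CF.rep μ ρ a) (CF.rep μ ρ b) ≤ dist a b := by
  have hrep := CF.continuous_rep μ ρ
  refine CF.denseRange_of.induction_on₂
    (p := fun a b => dist (CF.rep μ ρ a) (CF.rep μ ρ b) ≤ dist a b)
    (isClosed_le (by fun_prop) (by fun_prop)) (fun f h => ?_) a b
  rw [CF.rep_of, CF.rep_of, CF.dist_of, dist_eq_norm, ← BanachRep.integrate_sub]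
  exact norm_integrate_le_familyNorm μ ρ.2 _

theorem CF.norm_rep_sub_integrate_le (ρ : F.carrier) (a : CF μ F) (f : C_c(G, ℂ)) (x : ρ.1.E) :
    ‖CF.rep μ ρ a x - ρ.1.integrate μ f x‖ ≤ dist a (CF.of μ F f) * ‖x‖ := by
  have hdist := CF.dist_rep_le ρ a (CF.of μ F f)
  rw [CF.rep_of, dist_eq_norm] at hdist
  exact (CF.rep μ ρ a - ρ.1.integrate μ f).le_of_opNorm_le hdist x

theorem CF.rep_mul (ρ : F.carrier) (a b : CF μ F) :
    CF.rep μ ρ (a * b) = CF.rep μ ρ a * CF.rep μ ρ b := by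
  have hrep := CF.continuous_rep μ ρ
  refine CF.denseRange_of.induction_on₂
    (p := fun a b => CF.rep μ ρ (a * b) = CF.rep μ ρ a * CF.rep μ ρ b)
    (isClosed_eq (by fun_prop) (by fun_prop)) (fun f h => ?_) a b
  rw [CF.of_mul, CF.rep_of, CF.rep_of, CF.rep_of, BanachRep.integrate_convolution]

theorem CF.rep_apply_ne_zero (ρ : F.carrier) {a : CF μ F} {f : C_c(G, ℂ)} (hf : ∫ g, f g ∂μ = 1)
    (ha : dist a (CF.of μ F f) ≤ 1 / 2) {x : ρ.1.E} {r : ℝ}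
    (hx : ∀ g ∈ tsupport f, ‖ρ.1.π g x - x‖ ≤ r) (hr : (∫ g, ‖f g‖ ∂μ) * r < 1 / 2 * ‖x‖) :
    CF.rep μ ρ a x ≠ 0 := by
  intro hzero
  have hrep := CF.norm_rep_sub_integrate_le ρ a f x
  rw [hzero] at hrep
  have hmean := ρ.1.norm_integrate_sub_self_le hf hx
  have htriangle := norm_sub_le_norm_sub_add_norm_sub 0 (ρ.1.integrate μ f x) x
  rw [zero_sub, norm_neg] at htriangle
  linarith [mul_le_mul_of_nonneg_right ha (norm_nonneg x)]

theorem CF.ext_rep {a b : CF μ F} (h : ∀ ρ : F.carrier, CF.rep μ ρ a = CF.rep μ ρ b) : a = b := by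
  refine eq_of_forall_dist_le fun η hη => ?_
  obtain ⟨f, hf⟩ := CF.denseRange_of.exists_dist_lt a (show 0 < η / 4 by positivity)
  obtain ⟨k, hk⟩ := CF.denseRange_of.exists_dist_lt b (show 0 < η / 4 by positivity)
  have hfk : dist (CF.of μ F f) (CF.of μ F k) ≤ η / 2 := by
    rw [CF.dist_of]
    refine familyNorm_le μ F _ (by positivity) fun ρ hρ => ?_
    have haf := CF.dist_rep_le ⟨ρ, hρ⟩ a (CF.of μ F f)
    have hbk := CF.dist_rep_le ⟨ρ, hρ⟩ b (CF.of μ F k)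
    rw [CF.rep_of] at haf hbk
    rw [← h ⟨ρ, hρ⟩] at hbk
    rw [BanachRep.integrate_sub, ← dist_eq_norm]
    linarith [dist_triangle_left (ρ.integrate μ f) (ρ.integrate μ k) (CF.rep μ ⟨ρ, hρ⟩ a)]
  linarith [dist_triangle4_right a b (CF.of μ F f) (CF.of μ F k)]

end Algebra

/-! ### Robust property (T) implies property (T) -/

section Converse

variable {G : Type u} [Group G] [TopologicalSpace G]

/-- A unitary representation on a Hilbert space, regarded as a Banach space representation. -/
def BanachRep.ofUnitary {H : Type v} [NormedAddCommGroup H] [InnerProductSpace ℂ H]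
    [CompleteSpace H] (π : G →* unitary (H →L[ℂ] H))
    (hπ : ∀ x : H, Continuous fun g => (π g : H →L[ℂ] H) x) : BanachRep.{u, v} G where
  E := H
  π := (unitary (H →L[ℂ] H)).subtype.comp π
  continuous_orbit := hπ

theorem BanachRep.isUnitary_ofUnitary {H : Type v} [NormedAddCommGroup H] [InnerProductSpace ℂ H]
    [CompleteSpace H] (π : G →* unitary (H →L[ℂ] H))
    (hπ : ∀ x : H, Continuous fun g => (π g : H →L[ℂ] H) x) :
    (BanachRep.ofUnitary π hπ).IsUnitary where
  parallelogram x y := by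
    simp only [← sq]
    exact parallelogram_law_with_norm (E := H) ℂ x y
  norm_map g := Unitary.norm_map (π g)

variable [IsTopologicalGroup G] [T2Space G] [LocallyCompactSpace G]

theorem BanachRep.IsUnitary.mem_repFamily {ρ : BanachRep.{u, v} G} (hρ : ρ.IsUnitary) {S : Set G}
    (hS : IsCompactGeneratingSet S) {ε c : ℝ} (hε : 0 ≤ ε) (hc : 0 ≤ c) :
    ρ ∈ (repFamily hS (nearHilbert.{v} ε) c).carrier := by
  refine ⟨fun x y => ?_, fun g => (hρ.norm_le_one g).trans (Real.one_le_exp (by positivity))⟩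
  nlinarith [hρ.parallelogram x y, mul_nonneg hε (add_nonneg (sq_nonneg ‖x‖) (sq_nonneg ‖y‖))]

variable [MeasurableSpace G] [BorelSpace G] {μ : Measure G} [μ.IsHaarMeasure]

theorem IsKazhdanProjection.propertyT {F : RepFamily.{u, v} G} {p : CF μ F}
    (hp : IsKazhdanProjection p) (hF : ∀ ρ : BanachRep.{u, v} G, ρ.IsUnitary → ρ ∈ F.carrier) :
    PropertyT.{u, v} G := by
  obtain ⟨_, ⟨f, hf, rfl⟩, hpf⟩ := Metric.mem_closure_iff.1 hp.mem_closure (1 / 2) (by norm_num)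
  have hI0 : 0 ≤ ∫ g, ‖f g‖ ∂μ := integral_nonneg fun _ => norm_nonneg _
  set I := ∫ g, ‖f g‖ ∂μ
  refine ⟨tsupport f, f.hasCompactSupport, 1 / (2 * (I + 1)), by positivity, ?_⟩
  intro H _ _ _ π hπ ⟨x, hx0, hx⟩
  let ρ : F.carrier := ⟨BanachRep.ofUnitary π hπ, hF _ (BanachRep.isUnitary_ofUnitary π hπ)⟩
  have hinv : CF.rep μ ρ p x ∈ Set.range (CF.rep μ ρ p) := ⟨x, rfl⟩
  rw [hp.range_rep ρ] at hinv
  refine ⟨CF.rep μ ρ p x, CF.rep_apply_ne_zero ρ hf hpf.le (fun g hg => (hx g hg).le) ?_, hinv⟩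
  rw [← mul_assoc, mul_one_div]
  refine mul_lt_mul_of_pos_right ?_ (norm_pos_iff.2 hx0)
  rw [div_lt_div_iff₀ (by positivity) (by norm_num)]
  linarith

end Converse

/-! ### The contragredient representation -/

section DualSpace

variable {E : Type v} [NormedAddCommGroup E] [NormedSpace ℂ E]

theorem exists_mul_norm_le_apply (ξ : E →L[ℂ] ℂ) {t : ℝ} (ht : t < 1) :
    ∃ x, ‖x‖ ≤ 1 ∧ ∃ c : ℝ, t * ‖ξ‖ ≤ c ∧ ξ x = c := by
  rcases (norm_nonneg ξ).eq_or_lt with hξ | hξ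
  · exact ⟨0, by simp, 0, by rw [← hξ, mul_zero], by simp⟩
  · obtain ⟨x, hx1, hx⟩ := ξ.exists_lt_apply_of_lt_opNorm (mul_lt_of_lt_one_left hξ ht)
    obtain ⟨c, hc, hcx⟩ := Complex.exists_norm_mul_eq_self (ξ x)
    have hc0 : c ≠ 0 := norm_ne_zero_iff.1 (hc.trans_ne one_ne_zero)
    refine ⟨c⁻¹ • x, ?_, ‖ξ x‖, hx.le, ?_⟩
    · rw [norm_smul, norm_inv, hc, inv_one, one_mul]
      exact hx1.le
    · rw [map_smul, smul_eq_mul, inv_mul_eq_iff_eq_mul₀ hc0, mul_comm, mul_comm, hcx]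

variable [CompleteSpace E]

theorem sq_norm_apply_add_apply_le {ε : ℝ} (hE : nearHilbert ε E) (ξ η : E →L[ℂ] ℂ) (x y : E) :
    ‖(ξ + η) x + (ξ - η) y‖ ^ 2
      ≤ (‖ξ‖ ^ 2 + ‖η‖ ^ 2) * (2 * (1 + ε) * (‖x‖ ^ 2 + ‖y‖ ^ 2)) := by
  have hswap : (ξ + η) x + (ξ - η) y = ξ (x + y) + η (x - y) := by
    simp only [map_add, map_sub, _root_.add_apply, _root_.sub_apply]
    ring
  calc ‖(ξ + η) x + (ξ - η) y‖ ^ 2 ≤ (‖ξ‖ * ‖x + y‖ + ‖η‖ * ‖x - y‖) ^ 2 := by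
        rw [hswap]
        gcongr
        exact (norm_add_le _ _).trans (add_le_add (ξ.le_opNorm _) (η.le_opNorm _))
    _ ≤ (‖ξ‖ ^ 2 + ‖η‖ ^ 2) * (‖x + y‖ ^ 2 + ‖x - y‖ ^ 2) := by
        nlinarith [sq_nonneg (‖ξ‖ * ‖x - y‖ - ‖η‖ * ‖x + y‖)]
    _ ≤ _ := by
        gcongr
        linarith [hE x y]

theorem sq_add_sq_le_of_apply_eq {ε : ℝ} (hε : 0 ≤ ε) (hE : nearHilbert ε E) {ξ η : E →L[ℂ] ℂ}
    {x y : E} (hx : ‖x‖ ≤ 1) (hy : ‖y‖ ≤ 1) {r s : ℝ} (hr : (ξ + η) x = r) (hs : (ξ - η) y = s) :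
    r ^ 2 + s ^ 2 ≤ 2 * (1 + ε) * (‖ξ‖ ^ 2 + ‖η‖ ^ 2) := by
  have hsq_norm_smul : ∀ (a : ℝ) (z : E), ‖z‖ ≤ 1 → ‖(a : ℂ) • z‖ ^ 2 ≤ a ^ 2 := fun a z hz => by
    rw [norm_smul, Complex.norm_real, Real.norm_eq_abs, mul_pow, sq_abs]
    exact mul_le_of_le_one_right (sq_nonneg a) (pow_le_one₀ (norm_nonneg z) hz)
  have hpair : (ξ + η) ((r : ℂ) • x) + (ξ - η) ((s : ℂ) • y) = ((r ^ 2 + s ^ 2 : ℝ) : ℂ) := by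
    rw [map_smul, map_smul, hr, hs]
    push_cast
    simp only [smul_eq_mul, sq]
  have hsq := sq_norm_apply_add_apply_le hE ξ η ((r : ℂ) • x) ((s : ℂ) • y)
  rw [hpair, Complex.norm_real, Real.norm_eq_abs, sq_abs] at hsq
  rcases (show 0 ≤ r ^ 2 + s ^ 2 by positivity).eq_or_lt with hzero | hpos
  · rw [← hzero]
    positivity
  · refine le_of_mul_le_mul_right ?_ hpos
    calc (r ^ 2 + s ^ 2) * (r ^ 2 + s ^ 2) = (r ^ 2 + s ^ 2) ^ 2 := (sq _).symm
      _ ≤ (‖ξ‖ ^ 2 + ‖η‖ ^ 2) * (2 * (1 + ε) * (r ^ 2 + s ^ 2)) := by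
        have hnorm := add_le_add (hsq_norm_smul r x hx) (hsq_norm_smul s y hy)
        exact hsq.trans (by gcongr)
      _ = _ := by ring

theorem nearHilbert_dual {ε : ℝ} (hε : 0 ≤ ε) (hE : nearHilbert ε E) :
    nearHilbert ε (E →L[ℂ] ℂ) := by
  intro ξ η
  have hscaled : ∀ t ∈ Set.Ioo (0 : ℝ) 1, t ^ 2 * (‖ξ + η‖ ^ 2 + ‖ξ - η‖ ^ 2)
      ≤ 2 * (1 + ε) * (‖ξ‖ ^ 2 + ‖η‖ ^ 2) := fun t ht => by
    obtain ⟨x, hx, r, hr, hxr⟩ := exists_mul_norm_le_apply (ξ + η) ht.2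
    obtain ⟨y, hy, s, hs, hys⟩ := exists_mul_norm_le_apply (ξ - η) ht.2
    have ht0 := ht.1.le
    calc t ^ 2 * (‖ξ + η‖ ^ 2 + ‖ξ - η‖ ^ 2) = (t * ‖ξ + η‖) ^ 2 + (t * ‖ξ - η‖) ^ 2 := by ring
      _ ≤ r ^ 2 + s ^ 2 := by gcongr
      _ ≤ _ := sq_add_sq_le_of_apply_eq hε hE hx hy hxr hys
  have hlim : Tendsto (fun t : ℝ => t ^ 2 * (‖ξ + η‖ ^ 2 + ‖ξ - η‖ ^ 2)) (𝓝[<] 1)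
      (𝓝 (1 ^ 2 * (‖ξ + η‖ ^ 2 + ‖ξ - η‖ ^ 2))) :=
    ((continuous_id.pow 2).mul continuous_const).continuousAt.tendsto.mono_left nhdsWithin_le_nhds
  linarith [le_of_tendsto hlim (mem_of_superset (Ioo_mem_nhdsLT zero_lt_one) hscaled)]

end DualSpace

section DualAction

variable {G : Type u} [Group G] {E : Type v} [NormedAddCommGroup E] [NormedSpace ℂ E]
  (π : G →* (E →L[ℂ] E))

/-- The action `ξ ↦ ξ ∘ π(g⁻¹)` on the dual space; its orbit maps need not be continuous. -/
def dualHom : G →* ((E →L[ℂ] ℂ) →L[ℂ] (E →L[ℂ] ℂ)) where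
  toFun g := (ContinuousLinearMap.compL ℂ E E ℂ).flip (π g⁻¹)
  map_one' := by ext ξ x; simp
  map_mul' g h := by ext ξ x; simp

theorem dualHom_apply (g : G) (ξ : E →L[ℂ] ℂ) (x : E) : dualHom π g ξ x = ξ (π g⁻¹ x) := rfl

theorem norm_dualHom_le (g : G) : ‖dualHom π g‖ ≤ ‖π g⁻¹‖ :=
  ContinuousLinearMap.opNorm_le_bound _ (norm_nonneg _) fun ξ => by
    rw [mul_comm]
    exact ContinuousLinearMap.opNorm_comp_le ξ (π g⁻¹)

end DualAction

section Contragredient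

variable {G : Type u} [Group G] [TopologicalSpace G]

theorem IsCompactGeneratingSet.wordLength_inv_le {S : Set G} (hS : IsCompactGeneratingSet S)
    (g : G) : wordLength S g⁻¹ ≤ wordLength S g := by
  have hinv : S⁻¹ = S :=
    Set.ext fun s => ⟨fun hs => by simpa using hS.inv_mem _ hs, fun hs => hS.inv_mem _ hs⟩
  have hmem : g⁻¹ ∈ (S ^ wordLength S g)⁻¹ :=
    Set.inv_mem_inv.2 (Nat.sInf_mem (hS.exists_mem_pow g))
  rw [← inv_pow, hinv] at hmem
  exact wordLength_le hmem

variable [IsTopologicalGroup G] [LocallyCompactSpace G]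

theorem BanachRep.exists_eventually_norm_dualHom_le (ρ : BanachRep.{u, v} G) :
    ∃ C, ∀ᶠ g in 𝓝 1, ‖dualHom ρ.π g‖ ≤ C := by
  obtain ⟨V, hV, hV1⟩ := exists_compact_mem_nhds (1 : G)
  obtain ⟨C, hC⟩ := ρ.exists_bound hV.inv
  exact ⟨C, mem_of_superset hV1 fun g hg =>
    (norm_dualHom_le ρ.π g).trans (hC _ (Set.inv_mem_inv.2 hg))⟩

/-- The contragredient representation: the dual action, restricted to the functionals with
continuous orbit. -/
def BanachRep.contragredient (ρ : BanachRep.{u, v} G) : BanachRep.{u, v} G :=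
  continuousPart (dualHom ρ.π) ρ.exists_eventually_norm_dualHom_le.choose_spec

/-- The inclusion of the space of the contragredient representation into the dual space. -/
def BanachRep.contragredientIncl (ρ : BanachRep.{u, v} G) :
    ρ.contragredient.E →L[ℂ] (ρ.E →L[ℂ] ℂ) :=
  (continuousVectors (dualHom ρ.π)).subtypeL

theorem BanachRep.contragredientIncl_map (ρ : BanachRep.{u, v} G) (g : G) (ξ : ρ.contragredient.E)
    (x : ρ.E) : ρ.contragredientIncl (ρ.contragredient.π g ξ) x
      = ρ.contragredientIncl ξ (ρ.π g⁻¹ x) :=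
  rfl

theorem BanachRep.contragredientIncl_apply_map_of_mem_invariants (ρ : BanachRep.{u, v} G)
    {ξ : ρ.contragredient.E} (hξ : ξ ∈ ρ.contragredient.invariants) (g : G) (x : ρ.E) :
    ρ.contragredientIncl ξ (ρ.π g x) = ρ.contragredientIncl ξ x := by
  rw [← inv_inv g, ← ρ.contragredientIncl_map, hξ]

theorem BanachRep.contragredient_mem_repFamily [T2Space G] {S : Set G}
    (hS : IsCompactGeneratingSet S) {ε c : ℝ} (hε : 0 ≤ ε) (hc : 0 ≤ c) {ρ : BanachRep.{u, v} G}
    (hρ : ρ ∈ (repFamily hS (nearHilbert.{v} ε) c).carrier) :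
    ρ.contragredient ∈ (repFamily hS (nearHilbert.{v} ε) c).carrier := by
  have hnorm : ∀ g, ‖dualHom ρ.π g‖ ≤ Real.exp (c * wordLength S g) := fun g =>
    (norm_dualHom_le ρ.π g).trans <| (hρ.2 g⁻¹).trans <| Real.exp_le_exp.2 <|
      mul_le_mul_of_nonneg_left (by exact_mod_cast hS.wordLength_inv_le g) hc
  exact ⟨fun ξ η => nearHilbert_dual hε hρ.1 (ρ.contragredientIncl ξ) (ρ.contragredientIncl η),
    fun g => ContinuousLinearMap.opNorm_le_bound _ (Real.exp_pos _).le fun ξ =>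
      (dualHom ρ.π g).le_of_opNorm_le (hnorm g) (ρ.contragredientIncl ξ)⟩

end Contragredient

section SmoothedFunctional

variable {G : Type u} [Group G] [TopologicalSpace G]

theorem BanachRep.exists_norm_apply_map_inv_le [ContinuousInv G] (ρ : BanachRep.{u, v} G)
    (ξ : ρ.E →L[ℂ] ℂ) {K : Set G} (hK : IsCompact K) :
    ∃ C : ℝ, 0 ≤ C ∧ ∀ k ∈ K, ∀ x, ‖ξ (ρ.π k⁻¹ x)‖ ≤ C * ‖x‖ := by
  obtain ⟨C, hC⟩ := ρ.exists_bound hK.inv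
  refine ⟨‖ξ‖ * max C 0, by positivity, fun k hk x => ?_⟩
  rw [mul_assoc]
  exact ξ.le_opNorm_of_le ((ρ.π k⁻¹).le_of_opNorm_le
    ((hC _ (Set.inv_mem_inv.2 hk)).trans (le_max_left C 0)) x)

variable [IsTopologicalGroup G] [MeasurableSpace G] [BorelSpace G] (μ : Measure G)
  [μ.IsHaarMeasure]

theorem BanachRep.integrable_apply_map_inv (ρ : BanachRep.{u, v} G) (ξ : ρ.E →L[ℂ] ℂ)
    (f : C_c(G, ℂ)) (x : ρ.E) : Integrable (fun k => f k • ξ (ρ.π k⁻¹ x)) μ :=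
  integrable_smul_of_continuous μ f
    (ξ.continuous.comp ((ρ.continuous_orbit x).comp continuous_inv))

/-- The mean `x ↦ ∫ f(k) ξ(π(k⁻¹) x) dk` of the orbit of a functional under the dual action. -/
def BanachRep.smoothedFunctional (ρ : BanachRep.{u, v} G) (ξ : ρ.E →L[ℂ] ℂ) (f : C_c(G, ℂ)) :
    ρ.E →L[ℂ] ℂ :=
  LinearMap.mkContinuousOfExistsBound
    { toFun x := ∫ k, f k • ξ (ρ.π k⁻¹ x) ∂μ
      map_add' x y := by
        simp only [map_add, smul_add]
        exact integral_add (ρ.integrable_apply_map_inv μ ξ f x) (ρ.integrable_apply_map_inv μ ξ f y)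
      map_smul' c x := by
        simp only [map_smul, smul_comm _ c, integral_smul, RingHom.id_apply] } <| by
    obtain ⟨C, -, hC⟩ := ρ.exists_norm_apply_map_inv_le ξ f.hasCompactSupport
    refine ⟨(∫ k, ‖f k‖ ∂μ) * C, fun x => ?_⟩
    rw [mul_assoc]
    exact norm_integral_smul_le μ (integrable_of_compactlySupported μ f) fun k hk =>
      hC k (subset_tsupport f hk) x

theorem BanachRep.smoothedFunctional_apply (ρ : BanachRep.{u, v} G) (ξ : ρ.E →L[ℂ] ℂ)
    (f : C_c(G, ℂ)) (x : ρ.E) :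
    ρ.smoothedFunctional μ ξ f x = ∫ k, f k • ξ (ρ.π k⁻¹ x) ∂μ :=
  rfl

theorem BanachRep.smoothedFunctional_apply_of_mem_invariants (ρ : BanachRep.{u, v} G)
    (ξ : ρ.E →L[ℂ] ℂ) {f : C_c(G, ℂ)} (hf : ∫ g, f g ∂μ = 1) {x : ρ.E} (hx : x ∈ ρ.invariants) :
    ρ.smoothedFunctional μ ξ f x = ξ x := by
  have hinv : ∀ g, ρ.π g x = x := hx
  simp only [ρ.smoothedFunctional_apply μ, hinv]
  rw [integral_smul_const, hf, one_smul]

theorem BanachRep.dualHom_smoothedFunctional_sub (ρ : BanachRep.{u, v} G) (ξ : ρ.E →L[ℂ] ℂ)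
    (f : C_c(G, ℂ)) (g : G) (x : ρ.E) :
    (dualHom ρ.π g (ρ.smoothedFunctional μ ξ f) - ρ.smoothedFunctional μ ξ f) x
      = ∫ k, (f (g⁻¹ * k) - f k) • ξ (ρ.π k⁻¹ x) ∂μ := by
  have hfx := ρ.integrable_apply_map_inv μ ξ f x
  have htranslate : dualHom ρ.π g (ρ.smoothedFunctional μ ξ f) x
      = ∫ k, f (g⁻¹ * k) • ξ (ρ.π k⁻¹ x) ∂μ := by
    rw [dualHom_apply, smoothedFunctional_apply,
      ← integral_mul_left_eq_self (fun k => f (g⁻¹ * k) • ξ (ρ.π k⁻¹ x)) g]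
    simp [mul_apply_eq_comp]
  have hint : Integrable (fun k => f (g⁻¹ * k) • ξ (ρ.π k⁻¹ x)) μ := by
    have := (ρ.integrable_apply_map_inv μ ξ f (ρ.π g⁻¹ x)).comp_mul_left g⁻¹
    simpa [← mul_apply_eq_comp, ← map_mul] using this
  simp only [sub_smul]
  rw [integral_sub hint hfx, _root_.sub_apply, htranslate, smoothedFunctional_apply]

variable [LocallyCompactSpace G]

theorem BanachRep.smoothedFunctional_mem_continuousVectors (ρ : BanachRep.{u, v} G)
    (ξ : ρ.E →L[ℂ] ℂ) (f : C_c(G, ℂ)) :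
    ρ.smoothedFunctional μ ξ f ∈ continuousVectors (dualHom ρ.π) := by
  refine continuous_orbit_of_tendsto_one _ ?_
  obtain ⟨K, hK, hsmall⟩ := exists_compact_norm_integral_translate_sub_le.{u, 0} μ f
  obtain ⟨C, hC0, hC⟩ := ρ.exists_norm_apply_map_inv_le ξ hK
  rw [Metric.tendsto_nhds]
  intro r hr
  filter_upwards [hsmall (r / (C + 1)) (by positivity)] with g hg
  have hnorm : ‖dualHom ρ.π g (ρ.smoothedFunctional μ ξ f) - ρ.smoothedFunctional μ ξ f‖
      ≤ r / (C + 1) * C :=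
    ContinuousLinearMap.opNorm_le_bound _ (by positivity) fun x => by
      rw [ρ.dualHom_smoothedFunctional_sub μ, mul_assoc]
      exact hg ℂ _ _ (by positivity) fun k hk => hC k hk x
  rw [dist_eq_norm]
  refine hnorm.trans_lt ?_
  rw [div_mul_eq_mul_div, div_lt_iff₀ (by positivity)]
  nlinarith

end SmoothedFunctional

/-! ### Fixed points and Kazhdan projections -/

section Iteration

variable {G : Type u} [Group G] [TopologicalSpace G] {S : Set G} {ρ : BanachRep.{u, v} G}
  {b : G → ρ.E}

theorem IsCompactGeneratingSet.displacement_eq_zero_of_tendsto (hS : IsCompactGeneratingSet S)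
    (hb : ρ.IsCocycle b) {x : ℕ → ρ.E} {y : ρ.E} (hx : Tendsto x atTop (𝓝 y)) {M : ℝ}
    (hM : ∀ n, ∀ s ∈ S, ‖ρ.displacement b (x n) s‖ ≤ M / 2 ^ n) (g : G) :
    ρ.displacement b y g = 0 := by
  refine hS.eq_zero_of_isCocycle (hb.displacement y) (fun s hs => ?_) g
  have hdisp : Tendsto (fun n => ‖ρ.displacement b (x n) s‖) atTop (𝓝 ‖ρ.displacement b y s‖) :=
    (((((ρ.π s).continuous.tendsto y).comp hx).const_add (b s)).sub hx).norm
  have hzero : Tendsto (fun n : ℕ => M / 2 ^ n) atTop (𝓝 0) :=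
    tendsto_const_nhds.div_atTop (tendsto_pow_atTop_atTop_of_one_lt one_lt_two)
  exact norm_le_zero_iff.1 (le_of_tendsto_of_tendsto' hdisp hzero fun n => hM n s hs)

theorem IsCompactGeneratingSet.exists_one_le_bound (hS : IsCompactGeneratingSet S)
    (F : RepFamily.{u, v} G) : ∃ A : ℝ, 1 ≤ A ∧ ∀ ρ ∈ F.carrier, ∀ s ∈ S, ‖ρ.π s‖ ≤ A := by
  obtain ⟨C, hC⟩ := F.bounded S hS.isCompact
  exact ⟨max C 1, le_max_right _ _, fun ρ hρ s hs => (hC ρ hρ s hs).trans (le_max_left _ _)⟩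

theorem AffineAction.apply_eq (a : AffineAction ρ) (g : G) (x : ρ.E) :
    a.σ g x = a.σ g 0 + ρ.π g x := by
  have hvadd := (a.σ g).map_vadd 0 x
  rw [vadd_eq_add, add_zero, a.linear_eq, vadd_eq_add] at hvadd
  rw [hvadd, add_comm]

theorem AffineAction.isCocycle (a : AffineAction ρ) : ρ.IsCocycle fun g => a.σ g 0 where
  continuous := a.continuous_orbit 0
  map_mul g h := by rw [map_mul, AffineEquiv.coe_mul, Function.comp_apply, a.apply_eq g]

variable [MeasurableSpace G] {μ : Measure G} {F : RepFamily.{u, v} G} {φ : C_c(G, ℂ)}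

theorem ContractsDisplacement.norm_displacement_iterate_le (hφ : ContractsDisplacement μ S F φ)
    (hρ : ρ ∈ F.carrier) (hb : ρ.IsCocycle b) {x : ρ.E} {M : ℝ} (hM0 : 0 ≤ M)
    (hM : ∀ s ∈ S, ‖ρ.displacement b x s‖ ≤ M) (n : ℕ) :
    ∀ s ∈ S, ‖ρ.displacement b ((ρ.affineMean μ b φ)^[n] x) s‖ ≤ M / 2 ^ n := by
  induction n with
  | zero => simpa using hM
  | succ n ih =>
    rw [Function.iterate_succ_apply', pow_succ, ← div_div]
    exact hφ ρ hρ b hb _ _ (by positivity) ih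

variable [BorelSpace G] [μ.IsHaarMeasure] [IsTopologicalGroup G] [T2Space G]

theorem ContractsDisplacement.norm_displacement_integrate_convPow_le
    (hφ : ContractsDisplacement μ S F φ) (hφ_one : ∫ g, φ g ∂μ = 1)
    (hρ : ρ ∈ F.carrier) {A : ℝ} (hA : ∀ s ∈ S, ‖ρ.π s‖ ≤ A) (hA0 : 0 ≤ A) (x : ρ.E) (n : ℕ) :
    ∀ s ∈ S, ‖ρ.displacement 0 (ρ.integrate μ (convPow μ φ n) x) s‖ ≤ (A + 1) * ‖x‖ / 2 ^ n := by
  have hx : ∀ s ∈ S, ‖ρ.displacement 0 x s‖ ≤ (A + 1) * ‖x‖ := fun s hs => by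
    rw [ρ.displacement_zero_left, add_mul, one_mul]
    exact (norm_sub_le _ _).trans (add_le_add_left ((ρ.π s).le_of_opNorm_le (hA s hs) x) _)
  intro s hs
  have hiterate :=
    hφ.norm_displacement_iterate_le hρ ρ.isCocycle_zero (by positivity) hx (n + 1) s hs
  rw [← ρ.isCocycle_zero.affineMean_convPow μ hφ_one, ρ.affineMean_zero μ] at hiterate
  refine hiterate.trans ?_
  gcongr
  exacts [one_le_two, n.le_succ]

variable [LocallyCompactSpace G]

theorem ContractsDisplacement.exists_displacement_eq_zero (hφ : ContractsDisplacement μ S F φ)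
    (hS : IsCompactGeneratingSet S) (hφ_one : ∫ g, φ g ∂μ = 1) (hρ : ρ ∈ F.carrier)
    (hb : ρ.IsCocycle b) : ∃ x, ∀ g, ρ.displacement b x g = 0 := by
  obtain ⟨A, hA, hπ⟩ := hS.exists_one_le_bound F
  obtain ⟨C, -, hC⟩ := hS.exists_affineMean_sub_bound.{u, v} μ hφ_one hA
  obtain ⟨M, hM⟩ := hS.isCompact.exists_bound_of_continuousOn hb.continuous.continuousOn
  have hM0 : 0 ≤ M := (norm_nonneg _).trans (hM 1 hS.one_mem)
  let x : ℕ → ρ.E := fun n => (ρ.affineMean μ b φ)^[n] 0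
  have hdisp : ∀ n, ∀ s ∈ S, ‖ρ.displacement b (x n) s‖ ≤ M / 2 ^ n :=
    hφ.norm_displacement_iterate_le hρ hb hM0 (by rwa [ρ.displacement_zero_right])
  have hcauchy : CauchySeq x := by
    refine cauchySeq_of_le_geometric (1 / 2) (C * M) (by norm_num) fun n => ?_
    rw [dist_comm, dist_eq_norm, one_div, inv_pow, mul_assoc, ← div_eq_mul_inv]
    have hstep := hC ρ (hπ ρ hρ) b hb (x n) _ (by positivity) (hdisp n)
    rwa [← Function.iterate_succ_apply' (ρ.affineMean μ b φ)] at hstep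
  obtain ⟨y, hy⟩ := cauchySeq_tendsto_of_complete hcauchy
  exact ⟨y, hS.displacement_eq_zero_of_tendsto hb hy hdisp⟩

theorem ContractsDisplacement.hasFixedPoint (hφ : ContractsDisplacement μ S F φ)
    (hS : IsCompactGeneratingSet S) (hφ_one : ∫ g, φ g ∂μ = 1) (hρ : ρ ∈ F.carrier)
    (a : AffineAction ρ) : a.HasFixedPoint := by
  obtain ⟨x, hx⟩ := hφ.exists_displacement_eq_zero hS hφ_one hρ a.isCocycle
  exact ⟨x, fun g => (a.apply_eq g x).trans (sub_eq_zero.1 (hx g))⟩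

end Iteration

section Projection

variable {G : Type u} [Group G] [TopologicalSpace G] [IsTopologicalGroup G] [T2Space G]
  [LocallyCompactSpace G] [MeasurableSpace G] [BorelSpace G] {μ : Measure G} [μ.IsHaarMeasure]
  {F : RepFamily.{u, v} G} {p : CF μ F}

theorem CF.tendsto_integrate {f : ℕ → C_c(G, ℂ)}
    (hf : Tendsto (fun n => CF.of μ F (f n)) atTop (𝓝 p)) (ρ : F.carrier) (x : ρ.1.E) :
    Tendsto (fun n => ρ.1.integrate μ (f n) x) atTop (𝓝 (CF.rep μ ρ p x)) := by
  have hrep := CF.continuous_rep μ ρ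
  have happly : Continuous fun a : CF μ F => CF.rep μ ρ a x := by fun_prop
  simpa only [Function.comp_def, CF.rep_of] using (happly.tendsto p).comp hf

theorem CF.map_rep_eq_of_map_orbit_eq
    (hp : p ∈ closure (CF.of μ F '' {f : C_c(G, ℂ) | ∫ g, f g ∂μ = 1})) (ρ : F.carrier)
    {E' : Type*} [NormedAddCommGroup E'] [NormedSpace ℂ E'] [CompleteSpace E']
    (T : ρ.1.E →L[ℂ] E') {x : ρ.1.E} (hT : ∀ g, T (ρ.1.π g x) = T x) :
    T (CF.rep μ ρ p x) = T x := by
  have hrep := CF.continuous_rep μ ρ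
  have hclosed : IsClosed {a : CF μ F | T (CF.rep μ ρ a x) = T x} :=
    isClosed_eq (by fun_prop) continuous_const
  refine closure_minimal ?_ hclosed hp
  rintro _ ⟨f, hf, rfl⟩
  rw [Set.mem_ofPred_eq] at hf ⊢
  rw [CF.rep_of, BanachRep.map_integrate_of_map_orbit_eq μ T hT, hf, one_smul]

theorem isKazhdanProjection_of_rep_mem_invariants
    (hp : p ∈ closure (CF.of μ F '' {f : C_c(G, ℂ) | ∫ g, f g ∂μ = 1}))
    (hinv : ∀ (ρ : F.carrier) (x : ρ.1.E), CF.rep μ ρ p x ∈ ρ.1.invariants) :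
    IsKazhdanProjection p := by
  have hfix : ∀ (ρ : F.carrier) (x : ρ.1.E), x ∈ ρ.1.invariants → CF.rep μ ρ p x = x :=
    fun ρ x hx => CF.map_rep_eq_of_map_orbit_eq hp ρ (ContinuousLinearMap.id ℂ ρ.1.E) hx
  have hidem : ∀ ρ : F.carrier, IsIdempotentElem (CF.rep μ ρ p) := fun ρ =>
    ContinuousLinearMap.ext fun x => hfix ρ _ (hinv ρ x)
  refine ⟨CF.ext_rep fun ρ => (CF.rep_mul ρ p p).trans (hidem ρ), hp, hidem, fun ρ => ?_⟩
  refine Set.Subset.antisymm ?_ fun x hx => ⟨x, hfix ρ x hx⟩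
  rintro _ ⟨x, rfl⟩
  exact hinv ρ x

variable {S : Set G} {φ : C_c(G, ℂ)}

theorem ContractsDisplacement.cauchySeq_convPow (hφ : ContractsDisplacement μ S F φ)
    (hS : IsCompactGeneratingSet S) (hφ_one : ∫ g, φ g ∂μ = 1) :
    CauchySeq fun n => CF.of μ F (convPow μ φ n) := by
  obtain ⟨A, hA, hπ⟩ := hS.exists_one_le_bound F
  obtain ⟨C, hC0, hC⟩ := hS.exists_affineMean_sub_bound.{u, v} μ hφ_one hA
  have hA0 : 0 ≤ A := zero_le_one.trans hA
  refine cauchySeq_of_le_geometric (1 / 2) (C * (A + 1)) (by norm_num) fun n => ?_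
  rw [dist_comm, CF.dist_of]
  refine familyNorm_le μ F _ (by positivity) fun ρ hρ => ?_
  refine ContinuousLinearMap.opNorm_le_bound _ (by positivity) fun x => ?_
  have hstep := hC ρ (hπ ρ hρ) 0 ρ.isCocycle_zero _ _ (by positivity)
    (hφ.norm_displacement_integrate_convPow_le hφ_one hρ (hπ ρ hρ) hA0 x n)
  rw [ρ.affineMean_zero μ] at hstep
  rw [BanachRep.integrate_sub, _root_.sub_apply, convPow, ρ.integrate_convolution_apply μ]
  refine hstep.trans_eq ?_
  rw [one_div, inv_pow]
  ring

theorem ContractsDisplacement.exists_isKazhdanProjection (hφ : ContractsDisplacement μ S F φ)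
    (hS : IsCompactGeneratingSet S) (hφ_one : ∫ g, φ g ∂μ = 1) :
    ∃ p : CF μ F, IsKazhdanProjection p := by
  obtain ⟨A, hA, hπ⟩ := hS.exists_one_le_bound F
  obtain ⟨p, hp⟩ := cauchySeq_tendsto_of_complete (hφ.cauchySeq_convPow hS hφ_one)
  refine ⟨p, isKazhdanProjection_of_rep_mem_invariants (mem_closure_of_tendsto hp
    (.of_forall fun n => ⟨_, integral_convPow μ hφ_one n, rfl⟩)) fun ρ x g => ?_⟩
  rw [← sub_eq_zero, ← ρ.1.displacement_zero_left]
  exact hS.displacement_eq_zero_of_tendsto ρ.1.isCocycle_zero (CF.tendsto_integrate hp ρ x)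
    (hφ.norm_displacement_integrate_convPow_le hφ_one ρ.2 (hπ ρ.1 ρ.2) (zero_le_one.trans hA) x) g

end Projection

section Central

variable {G : Type u} [Group G] [TopologicalSpace G] [IsTopologicalGroup G] [T2Space G]
  [LocallyCompactSpace G] [MeasurableSpace G] [BorelSpace G] {μ : Measure G} [μ.IsHaarMeasure]
  {F : RepFamily.{u, v} G} {p : CF μ F}

theorem IsKazhdanProjection.rep_mem_invariants (hp : IsKazhdanProjection p) (ρ : F.carrier)
    (x : ρ.1.E) : CF.rep μ ρ p x ∈ ρ.1.invariants :=
  (hp.range_rep ρ).subset ⟨x, rfl⟩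

theorem IsKazhdanProjection.isCentral_of_rep_map_eq (hp : IsKazhdanProjection p)
    (h : ∀ (ρ : F.carrier) (g : G) (x : ρ.1.E), CF.rep μ ρ p (ρ.1.π g x) = CF.rep μ ρ p x) :
    IsCentralKazhdanProjection p := by
  refine ⟨hp, Semigroup.mem_center_iff.2 fun a => ?_⟩
  refine CF.denseRange_of.induction_on (p := fun a => a * p = p * a) a
    (isClosed_eq (by fun_prop) (by fun_prop)) fun f => CF.ext_rep fun ρ => ?_
  ext x
  rw [CF.rep_mul, CF.rep_mul, CF.rep_of, mul_apply_eq_comp, mul_apply_eq_comp,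
    BanachRep.integrate_of_mem_invariants μ f (hp.rep_mem_invariants ρ x),
    BanachRep.map_integrate_of_map_orbit_eq μ _ fun g => h ρ g x]

/-- The projection `p` of the contragredient representation turns a functional that is nonzero at
`y` into an invariant one with the same value at `y`. -/
theorem IsKazhdanProjection.exists_invariant_functional (hp : IsKazhdanProjection p)
    {ρ : BanachRep.{u, v} G} (hρ : ρ.contragredient ∈ F.carrier) {y : ρ.E}
    (hy : y ∈ ρ.invariants) (hy0 : y ≠ 0) :
    ∃ ζ : ρ.E →L[ℂ] ℂ, (∀ g x, ζ (ρ.π g x) = ζ x) ∧ ζ y ≠ 0 := by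
  obtain ⟨_, f, hf, -⟩ := closure_nonempty_iff.1 ⟨p, hp.mem_closure⟩
  obtain ⟨ξ, -, hξ⟩ := exists_dual_vector ℂ y (norm_ne_zero_iff.2 hy0)
  let η : ρ.contragredient.E :=
    ⟨ρ.smoothedFunctional μ ξ f, ρ.smoothedFunctional_mem_continuousVectors μ ξ f⟩
  have hηy : ρ.contragredientIncl η y = ξ y :=
    ρ.smoothedFunctional_apply_of_mem_invariants μ ξ hf hy
  refine ⟨ρ.contragredientIncl (CF.rep μ ⟨_, hρ⟩ p η),
    ρ.contragredientIncl_apply_map_of_mem_invariants (hp.rep_mem_invariants ⟨_, hρ⟩ η), ?_⟩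
  have heval := CF.map_rep_eq_of_map_orbit_eq hp.mem_closure ⟨_, hρ⟩
    ((ContinuousLinearMap.apply ℂ ℂ y).comp ρ.contragredientIncl) (x := η) fun g =>
      (ρ.contragredientIncl_map g η y).trans (by rw [hy g⁻¹]; rfl)
  refine heval.trans_ne ?_
  change ρ.contragredientIncl η y ≠ 0
  rw [hηy, hξ]
  exact RCLike.ofReal_ne_zero.2 (norm_ne_zero_iff.2 hy0)

theorem IsKazhdanProjection.isCentral_of_contragredient (hp : IsKazhdanProjection p)
    (hF : ∀ ρ ∈ F.carrier, ρ.contragredient ∈ F.carrier) : IsCentralKazhdanProjection p := by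
  refine hp.isCentral_of_rep_map_eq fun ρ g x => ?_
  by_contra hne
  obtain ⟨ζ, hζ, hζ_ne⟩ := hp.exists_invariant_functional (hF ρ.1 ρ.2)
    (Submodule.sub_mem _ (hp.rep_mem_invariants ρ (ρ.1.π g x)) (hp.rep_mem_invariants ρ x))
    (sub_ne_zero.2 hne)
  have hζ_rep : ∀ z, ζ (CF.rep μ ρ p z) = ζ z := fun z =>
    CF.map_rep_eq_of_map_orbit_eq hp.mem_closure ρ ζ fun k => hζ k z
  exact hζ_ne (by rw [map_sub, hζ_rep, hζ_rep, hζ, sub_self])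

end Central

end

end KazhdanRobust

theorem corollary4p6 {G : Type u} [Group G] [TopologicalSpace G] [IsTopologicalGroup G]
    [T2Space G] [LocallyCompactSpace G] [MeasurableSpace G] [BorelSpace G]
    (μ : MeasureTheory.Measure G) [μ.IsHaarMeasure]
    (S : Set G) (hS : IsCompactGeneratingSet S) :
    (PropertyT.{u, v} G →
      ∃ ε : ℝ, 0 < ε ∧
        (∃ p : CF μ (repFamily hS (nearHilbert.{v} ε) ε), IsCentralKazhdanProjection p) ∧
        ∀ ρ ∈ (repFamily hS (nearHilbert.{v} ε) ε).carrier, ∀ a : AffineAction ρ,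
          a.HasFixedPoint) ∧
    (PropertyT.{u, v} G ↔
      ∃ ε : ℝ, 0 < ε ∧ RobustPropertyT μ hS (nearHilbert.{v} ε)) := by
  have hforward : PropertyT.{u, v} G →
      ∃ ε : ℝ, 0 < ε ∧
        (∃ p : CF μ (repFamily hS (nearHilbert.{v} ε) ε), IsCentralKazhdanProjection p) ∧
        ∀ ρ ∈ (repFamily hS (nearHilbert.{v} ε) ε).carrier, ∀ a : AffineAction ρ,
          a.HasFixedPoint := by
    intro hT
    obtain ⟨φ, hφ_one, ε, hε, hφ⟩ := hT.exists_contractsDisplacement μ hS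
    obtain ⟨p, hp⟩ := hφ.exists_isKazhdanProjection hS hφ_one
    exact ⟨ε, hε,
      ⟨p, hp.isCentral_of_contragredient fun ρ hρ =>
        BanachRep.contragredient_mem_repFamily hS hε.le hε.le hρ⟩,
      fun ρ hρ a => hφ.hasFixedPoint hS hφ_one hρ a⟩
  refine ⟨hforward, fun hT => ?_, fun ⟨ε, hε, s, hs, p, hp⟩ =>
    hp.propertyT fun ρ hρ => hρ.mem_repFamily hS hε.le hs.le⟩
  obtain ⟨ε, hε, ⟨p, hp⟩, -⟩ := hforward hT
  exact ⟨ε, hε, ε, hε, p, hp.toIsKazhdanProjection⟩
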